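/- \textbf{Theorem ($W_1$ isometry theorem).} Let $K$ be a field, and let either $P\subseteq\mathbb Z$ with $\mu$ the counting measure, or $P\subseteq\mathbb R$ be Lebesgue measurable with $\mu$ the Lebesgue measure. Let $\mathbf P=(P,\le)$ and let $\mathbf{Vect}^{\mathbf P}$ be the category of persistence modules, i.e. functors from $\mathbf P$ to $K$-vector spaces. For a nonempty interval (order-convex subset) $I\subseteq P$, the interval module of $I$ is $K$ at each point of $I$ and $0$ elsewhere, with identity maps between points of $I$ and zero maps otherwise. For persistence modules $M,N$ let $$d_\mu(M,N)=\inf_\gamma \sum_{i=1}^n\Big(\int_P\dim\ker\gamma_i(p)\,d\mu+\int_P\dim\operatorname{coker}\gamma_i(p)\,d\mu\Big)\in[0,\infty],$$ where the infimum is over all finite zigzags of morphisms $\gamma: M=M_0\xrightarrow{\gamma_1}M_1\xleftarrow{\gamma_2}M_2\to\cdots\leftarrow M_n=N$, $n\ge0$, for which all the functions $p\mapsto\dim\ker\gamma_i(p)$ and $p\mapsto\dim\operatorname{coker}\gamma_i(p)$ are (Lebesgue) measurable. Let $$W_1(d_\mu)(M,N)=\inf\sum_{a\in A}d_\mu(M_a,N_a),$$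 where the infimum is over all isomorphisms $M\cong\coprod_{a\in A}M_a$, $N\cong\coprod_{a\in A}N_a$ in which each $M_a$ and each $N_a$ is either $0$ or has a local endomorphism ring. Suppose that $M\cong\bigoplus_{a\in A} I_a$ and $N\cong\bigoplus_{b\in B} J_b$ are direct sums of interval modules, countable ones if $P\subseteq\mathbb R$, and that $M$ and $N$ have finite total persistence, i.e. $\dim M$ and $\dim N$ are measurable with $\int_P\dim M\,d\mu<\infty$ and $\int_P\dim N\,d\mu<\infty$. Then $$W_1(d_\mu)(M,N)=d_\mu(M,N).$$ If moreover $P$ is order-convex in $\mathbb Z$ or $\mathbb R$, respectively, then $$d_\mu(M,N)=W_1(\operatorname{Dgm}M,\operatorname{Dgm}N).$$ Here $\operatorname{Dgm}M=\{x(I_a)\}_{a\in A}$ and $\operatorname{Dgm}N=\{x(J_b)\}_{b\in B}$ are the persistence diagrams, multisets in $[-\infty,\infty]^2$, with $x(I)=(\inf I,\sup I)$ if $P\subseteq\mathbb R$ and, regarding $\{m,\dots,n\}$ as the half-open interval $[m,n+1)$, $x(I)=(\inf I,1+\sup I)$ if $P\subseteq\mathbb Z$; and $$W_1(\operatorname{Dgm}M,\operatorname{Dgm}N)=\inf_{\varphi}\Big(\sum_{c\in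 C}\|x(I_c)-x(J_{\varphi(c)})\|_1+\sum_{a\in A\setminus C}d(x(I_a),\Delta)+\sum_{b\in B\setminus\varphi(C)}d(x(J_b),\Delta)\Big),$$ where the infimum is over all $C\subseteq A$ and injective $\varphi:C\to B$, $\Delta$ is the diagonal of $[-\infty,\infty]^2$, and $d(x,\Delta)=\inf_{y\in\Delta}\|x-y\|_1$. -/

import Mathlib

open CategoryTheory CategoryTheory.Limits MeasureTheory
open scoped ENNReal

universe u v w

noncomputable section

namespace PersMod

/-! ### Direct sums and the 1-Wasserstein distance induced by a metric -/

section Category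

variable {C : Type u} [Category.{v} C]

/-- `M` is a coproduct (direct sum) of the family `F`. -/
def IsCoproductOf {ι : Type w} (F : ι → C) (M : C) : Prop :=
  ∃ inj : ∀ a, F a ⟶ M, Nonempty (IsColimit (Cofan.mk M inj))

/-- The 1-Wasserstein distance `W₁(d)` induced by a distance `d` on objects: the infimum of
`∑ a, d (M_a, N_a)` over all decompositions `M ≅ ∐ M_a`, `N ≅ ∐ N_a` over a common index set in
which every summand is zero or has a local endomorphism ring. -/
def wasserstein₁ [Preadditive C] (d : C → C → ℝ≥0∞) (M N : C) : ℝ≥0∞ :=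
  ⨅ (A : Type v) (F : A → C) (G : A → C)
    (_ : IsCoproductOf F M) (_ : IsCoproductOf G N)
    (_ : ∀ a, IsZero (F a) ∨ IsLocalRing (End (F a)))
    (_ : ∀ a, IsZero (G a) ∨ IsLocalRing (End (G a))),
    ∑' a, d (F a) (G a)

/-- Zigzags of morphisms from `M` to `N`: finite (possibly empty) sequences of morphisms, each
pointing forwards or backwards. (Inserting identities makes the directions alternate.) -/
inductive Zigzag : C → C → Type (max u v)
  | nil (M : C) : Zigzag M M
  | fwd {M M' N : C} (f : M ⟶ M') (γ : Zigzag M' N) : Zigzag M N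
  | bwd {M M' N : C} (f : M' ⟶ M) (γ : Zigzag M' N) : Zigzag M N

end Category

/-! ### Persistence modules, Hilbert functions and the zigzag metric -/

section Modules

/-- The dimension of a vector space, as an element of `[0, ∞]`. -/
def edim (K : Type u) [Field K] (V : Type w) [AddCommGroup V] [Module K V] : ℝ≥0∞ :=
  ((Cardinal.toENat (Module.rank K V) : ℕ∞) : ℝ≥0∞)

variable {K : Type u} [Field K] {P : Type w} [Preorder P]

/-- The Hilbert function (dimension vector) of a persistence module. -/
def dimVec (M : P ⥤ ModuleCat.{u} K) (p : P) : ℝ≥0∞ := edim K (M.obj p)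

/-- The Hilbert function of the kernel of a morphism of persistence modules. -/
def kerDim {M N : P ⥤ ModuleCat.{u} K} (f : M ⟶ N) (p : P) : ℝ≥0∞ :=
  edim K (LinearMap.ker (f.app p).hom)

/-- The Hilbert function of the cokernel of a morphism of persistence modules. -/
def cokerDim {M N : P ⥤ ModuleCat.{u} K} (f : M ⟶ N) (p : P) : ℝ≥0∞ :=
  edim K (N.obj p ⧸ LinearMap.range (f.app p).hom)

variable [MeasurableSpace P]

/-- The kernels and cokernels of all morphisms in the zigzag have measurable Hilbert functions
(measurable for the `μ`-completed σ-algebra, i.e. Lebesgue measurable for Lebesgue measure). -/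
def Zigzag.IsMeasurable (μ : Measure P) :
    {M N : P ⥤ ModuleCat.{u} K} → Zigzag M N → Prop
  | _, _, .nil _ => True
  | _, _, .fwd f γ =>
      AEMeasurable (kerDim f) μ ∧ AEMeasurable (cokerDim f) μ ∧ γ.IsMeasurable μ
  | _, _, .bwd f γ =>
      AEMeasurable (kerDim f) μ ∧ AEMeasurable (cokerDim f) μ ∧ γ.IsMeasurable μ

/-- The cost of a zigzag: the sum of the weights of all kernels and cokernels. -/
def Zigzag.cost (μ : Measure P) :
    {M N : P ⥤ ModuleCat.{u} K} → Zigzag M N → ℝ≥0∞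
  | _, _, .nil _ => 0
  | _, _, .fwd f γ => (∫⁻ p, kerDim f p ∂μ + ∫⁻ p, cokerDim f p ∂μ) + γ.cost μ
  | _, _, .bwd f γ => (∫⁻ p, kerDim f p ∂μ + ∫⁻ p, cokerDim f p ∂μ) + γ.cost μ

/-- The zigzag metric `d_μ`. -/
def zigzagDist (μ : Measure P) (M N : P ⥤ ModuleCat.{u} K) : ℝ≥0∞ :=
  ⨅ (γ : Zigzag M N) (_ : γ.IsMeasurable μ), γ.cost μ

/-- `M` has finite total persistence: `dim M` is integrable. -/
def HasFiniteTotalPersistence (μ : Measure P) (M : P ⥤ ModuleCat.{u} K) : Prop :=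
  AEMeasurable (dimVec M) μ ∧ ∫⁻ p, dimVec M p ∂μ < ∞

end Modules

/-! ### Interval modules -/

/-- Nonempty intervals (order-convex subsets) of a poset. -/
abbrev PInterval (P : Type w) [Preorder P] : Type w :=
  {I : Set P // I.Nonempty ∧ I.OrdConnected}

open Classical in
/-- The interval module of `I`. Its value at `a`, the space of functions on the proofs of `a ∈ I`,
is `K` for `a ∈ I` and `0` otherwise; the map for `a ≤ b` is the identity of `K` if `a, b ∈ I`
and is zero otherwise. -/
def intervalModule (K : Type u) [Field K] {P : Type w} [Preorder P] (I : PInterval P) :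
    P ⥤ ModuleCat.{u} K where
  obj a := ModuleCat.of K (PLift (a ∈ I.1) → K)
  map {a b} _ := ModuleCat.ofHom
    { toFun := fun g _ => if ha : a ∈ I.1 then g ⟨ha⟩ else 0
      map_add' := by
        intro g h; funext _; by_cases ha : a ∈ I.1 <;> simp [ha]
      map_smul' := by
        intro c g; funext _; by_cases ha : a ∈ I.1 <;> simp [ha] }
  map_id a := by
    refine ConcreteCategory.hom_ext _ _ fun g => ?_
    funext ⟨ha⟩
    exact dif_pos ha
  map_comp {a b c} f g := by
    refine ConcreteCategory.hom_ext _ _ fun x => ?_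
    funext ⟨hc⟩
    by_cases ha : a ∈ I.1
    · have hb : b ∈ I.1 := I.2.2.out ha hc ⟨leOfHom f, leOfHom g⟩
      simp [ha, hb]
    · simp [ha]

/-! ### Persistence diagrams and their classical 1-Wasserstein distance -/

open Classical in
/-- The distance `|x - y|` on `[-∞, ∞]`, with `|∞ - ∞| = |(-∞) - (-∞)| = 0`. -/
def erealDist (x y : EReal) : ℝ≥0∞ := if x = y then 0 else (x - y).abs

/-- The distance `‖x - y‖₁` on `[-∞, ∞]²`. -/
def planeDist (x y : EReal × EReal) : ℝ≥0∞ := erealDist x.1 y.1 + erealDist x.2 y.2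

/-- The distance of a point of `[-∞, ∞]²` to the diagonal. -/
def diagDist (x : EReal × EReal) : ℝ≥0∞ := ⨅ c : EReal, planeDist x (c, c)

/-- The 1-Wasserstein distance between the diagrams (multisets) `{x a}` and `{y b}`; the infimum
is over all matchings, i.e. injective maps `φ : S → κ` with `S ⊆ ι`. -/
def dgmWasserstein₁ {ι : Type v} {κ : Type w} (x : ι → EReal × EReal) (y : κ → EReal × EReal) :
    ℝ≥0∞ :=
  ⨅ (S : Set ι) (φ : S → κ) (_ : Function.Injective φ),
    (∑' c : S, planeDist (x c) (y (φ c))) + (∑' a : ↥Sᶜ, diagDist (x a)) +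
      ∑' b : ↥(Set.range φ)ᶜ, diagDist (y b)

/-- The point `(inf I, sup I)` of an interval of `P ⊆ ℝ`. -/
def realPoint {P : Set ℝ} (I : PInterval P) : EReal × EReal :=
  (⨅ a : I.1, (((a : P) : ℝ) : EReal), ⨆ a : I.1, (((a : P) : ℝ) : EReal))

/-- The point `(inf I, 1 + sup I)` of an interval of `P ⊆ ℤ`: a bar `{m, …, n}` is the half-open
interval `[m, n + 1)`, whose length is its number of elements. -/
def intPoint {P : Set ℤ} (I : PInterval P) : EReal × EReal :=
  (⨅ a : I.1, ((((a : P) : ℤ) : ℝ) : EReal), ⨆ a : I.1, (((((a : P) : ℤ) : ℝ) + 1 : ℝ) : EReal))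

end PersMod

end

noncomputable section

namespace PersMod

/-! ### Dimensions -/

section Dimension

variable {K : Type u} [Field K]

/-! Let D (`barDist`) be the optimal cost of a partial matching of the two barcodes, where a matched
pair costs the measure of its symmetric difference and an unmatched bar costs its own measure. The
theorem follows from the cycle D ≤ d_μ ≤ W₁(d_μ) ≤ D.

W₁(d_μ) ≤ D (`wasserstein₁_le_barDist`): a partial matching, padded with zero modules, is a pair of
decompositions over one index set, and two interval modules are joined by a zigzag through their
intersection (or through 0) whose cost is at most the measure of the symmetric difference.

d_μ ≤ W₁(d_μ) (`zigzagDist_le_wasserstein₁`): adding a common summand changes no kernel or cokernel,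
so d_μ is subadditive for finite sums; finite total persistence makes the tails small, which extends
this to countable sums (`zigzagDist_le_tsum`). A Krull–Schmidt argument
(`exists_iso_intervalModule`, `countable_not_isZero`) shows that only countably many summands of any
admissible decomposition are nonzero, and that these are interval modules.

D ≤ d_μ (`barDist_le_zigzagDist`) is the heart. On a finite chain, Möbius inversion of the rank
function gives every module a signed barcode, so the intermediate modules of a zigzag need not be
decomposed. For f : M → N, passing from M to im f shortens bars on the right, and passing from N to
im f shortens them on the left. Summation by parts writes both changes as nonnegative combinations
of unit moves, with total cost the weighted dimensions of ker f and coker f (`isFlow_hom`). Along a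
zigzag these add up to a flow between the two barcodes, with the empty interval as base point, and
the triangle inequality turns a flow into a matching that costs no more
(`exists_matching_of_boundary`). The chain is obtained by sampling: after truncation only finitely
many sets matter, and each atom they generate contains a point where the cost of the zigzag is at
most its average (`exists_sample`).

If P is order-convex, bars that meet have ℓ¹-distance equal to the measure of their symmetric
difference. For disjoint bars neither cost beats leaving both unmatched, so the optimal matchings
cost the same (`barDist_eq_dgmWasserstein₁`). -/

lemma edim_eq_of_basis {ι : Type*} {V : Type*} [AddCommGroup V] [Module K V]
    (b : Module.Basis ι K V) : edim K V = ENat.card ι := by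
  unfold edim
  have h := congrArg Cardinal.toENat b.mk_eq_rank
  rw [Cardinal.toENat_lift, Cardinal.toENat_lift] at h
  rw [← h]; rfl

lemma edim_congr {V W : Type*} [AddCommGroup V] [Module K V] [AddCommGroup W] [Module K W]
    (e : V ≃ₗ[K] W) : edim K V = edim K W := by
  rw [edim_eq_of_basis (Module.Basis.ofVectorSpace K V),
    edim_eq_of_basis ((Module.Basis.ofVectorSpace K V).map e)]

lemma edim_eq_zero {V : Type*} [AddCommGroup V] [Module K V] [Subsingleton V] :
    edim K V = 0 := by
  simp [edim]

lemma edim_self : edim K K = 1 := by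
  simp [edim]

lemma edim_prod {V W : Type*} [AddCommGroup V] [Module K V] [AddCommGroup W] [Module K W] :
    edim K (V × W) = edim K V + edim K W := by
  rw [edim_eq_of_basis (Module.Basis.ofVectorSpace K V),
    edim_eq_of_basis (Module.Basis.ofVectorSpace K W),
    edim_eq_of_basis ((Module.Basis.ofVectorSpace K V).prod (Module.Basis.ofVectorSpace K W))]
  rw [← ENNReal.tsum_one, ← ENNReal.tsum_one, ← ENNReal.tsum_one,
    ENNReal.summable.tsum_sum ENNReal.summable]

lemma edim_lt_top_iff {V : Type*} [AddCommGroup V] [Module K V] :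
    edim K V < ∞ ↔ FiniteDimensional K V := by
  unfold edim
  change _ ↔ Module.Finite K V
  rw [← Module.rank_lt_aleph0_iff, ← Cardinal.toENat_lt_top]
  simp

lemma edim_eq_finrank {V : Type*} [AddCommGroup V] [Module K V] [FiniteDimensional K V] :
    edim K V = Module.finrank K V := by
  simp [edim, ← Module.finrank_eq_rank]

/-- Rank-nullity in `[0, ∞]`, with no finiteness needed, because the kernel has a complement. -/
lemma edim_ker_add_edim_range {V W : Type*} [AddCommGroup V] [Module K V] [AddCommGroup W]
    [Module K W] (f : V →ₗ[K] W) :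
    edim K (LinearMap.ker f) + edim K (LinearMap.range f) = edim K V := by
  obtain ⟨g, hg⟩ := f.rangeRestrict.exists_rightInverse_of_surjective f.range_rangeRestrict
  rw [← edim_congr f.quotKerEquivRange]
  obtain ⟨q, hq⟩ := (LinearMap.ker f).exists_isCompl
  rw [edim_congr (Submodule.quotientEquivOfIsCompl _ q hq), ← edim_prod,
    edim_congr (Submodule.prodEquivOfIsCompl _ q hq)]

/-- The dimension of an internal direct sum. -/
lemma edim_eq_tsum {ι : Type*} {V : Type*} [AddCommGroup V] [Module K V] {W : ι → Type*}
    [∀ i, AddCommGroup (W i)] [∀ i, Module K (W i)] (inj : ∀ i, W i →ₗ[K] V)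
    (prj : ∀ i, V →ₗ[K] W i) (h1 : ∀ i x, prj i (inj i x) = x)
    (h2 : ∀ i j x, i ≠ j → prj j (inj i x) = 0)
    (h3 : ∀ x, ∃ s : Finset ι, x = ∑ i ∈ s, inj i (prj i x)) :
    edim K V = ∑' i, edim K (W i) := by
  classical
  let f : (Π₀ i, W i) →ₗ[K] V := DFinsupp.lsum ℕ inj
  have hprj : ∀ x j, prj j (f x) = x j := by
    intro x j
    induction x using DFinsupp.induction with
    | h0 => simp
    | ha i b x _ _ ih =>
      rw [map_add, map_add, ih]
      simp only [f, DFinsupp.lsum_single, DFinsupp.add_apply, add_left_inj]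
      by_cases h : i = j
      · subst h; simp [h1]
      · rw [h2 _ _ _ h, DFinsupp.single_eq_of_ne (Ne.symm h)]
  have hf : Function.Bijective f := by
    refine ⟨fun x y h => ?_, fun x => ?_⟩
    · ext j; rw [← hprj, ← hprj, h]
    · obtain ⟨s, hs⟩ := h3 x
      refine ⟨∑ i ∈ s, DFinsupp.single i (prj i x), ?_⟩
      conv_rhs => rw [hs]
      simp [f]
  rw [← edim_congr (LinearEquiv.ofBijective f hf),
    edim_eq_of_basis (DFinsupp.basis fun i => Module.Basis.ofVectorSpace K (W i)),
    ← ENNReal.tsum_one, ENNReal.tsum_sigma']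
  refine tsum_congr fun i => ?_
  rw [edim_eq_of_basis (Module.Basis.ofVectorSpace K (W i)), ENNReal.tsum_one]

end Dimension

/-! ### Direct sums of persistence modules -/

section DirectSum

variable {K : Type u} [Field K] {P : Type} [Preorder P]

/-- The data of inclusions and projections exhibiting `M` as the direct sum of a family. -/
structure DirectSumData {ι : Type w} (F : ι → P ⥤ ModuleCat.{u} K) (M : P ⥤ ModuleCat.{u} K) where
  inj : ∀ a, F a ⟶ M
  prj : ∀ a, M ⟶ F a
  inj_prj : ∀ a, inj a ≫ prj a = 𝟙 _
  inj_prj_of_ne : ∀ a b, a ≠ b → inj a ≫ prj b = 0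
  exists_sum : ∀ p (x : M.obj p), ∃ s : Finset ι, x = ∑ a ∈ s, (inj a).app p ((prj a).app p x)

namespace DirectSumData

variable {ι : Type w} {F : ι → P ⥤ ModuleCat.{u} K} {M : P ⥤ ModuleCat.{u} K}

lemma prj_inj_apply (D : DirectSumData F M) (a : ι) (p : P) (x : (F a).obj p) :
    (D.prj a).app p ((D.inj a).app p x) = x := by
  rw [← ConcreteCategory.comp_apply, ← NatTrans.comp_app, D.inj_prj]; rfl

lemma prj_inj_apply_of_ne (D : DirectSumData F M) {a b : ι} (h : a ≠ b) (p : P)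
    (x : (F a).obj p) : (D.prj b).app p ((D.inj a).app p x) = 0 := by
  rw [← ConcreteCategory.comp_apply, ← NatTrans.comp_app, D.inj_prj_of_ne _ _ h]; rfl

lemma dimVec_eq_tsum (D : DirectSumData F M) (p : P) :
    dimVec M p = ∑' a, dimVec (F a) p :=
  edim_eq_tsum (fun a => ((D.inj a).app p).hom) (fun a => ((D.prj a).app p).hom)
    (fun a x => D.prj_inj_apply a p x) (fun _ _ x h => D.prj_inj_apply_of_ne h p x)
    (D.exists_sum p)

/-- Adding zero summands and reindexing. -/
def extend (D : DirectSumData F M) {ι' : Type*} (G : ι' → P ⥤ ModuleCat.{u} K) (e : ι → ι')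
    (he : Function.Injective e) (i : ∀ a, F a ≅ G (e a))
    (hG : ∀ b, b ∉ Set.range e → IsZero (G b)) : DirectSumData G M := by
  classical
  let i' : ∀ (a : ι) (b : ι'), e a = b → (F a ≅ G b) := fun a b h => i a ≪≫ eqToIso (by rw [h])
  exact
  { inj := fun b => if h : ∃ a, e a = b then (i' h.choose b h.choose_spec).inv ≫ D.inj h.choose
      else 0
    prj := fun b => if h : ∃ a, e a = b then D.prj h.choose ≫ (i' h.choose b h.choose_spec).hom
      else 0
    inj_prj := fun b => by
      by_cases h : ∃ a, e a = b
      · simp only [h, dif_pos]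
        rw [Category.assoc, ← Category.assoc (D.inj _), D.inj_prj]
        simp
      · simp only [h, dif_neg, not_false_eq_true]
        exact (hG b h).eq_of_src _ _
    inj_prj_of_ne := fun b c hbc => by
      by_cases h : ∃ a, e a = b
      · by_cases h' : ∃ a, e a = c
        · simp only [h, h', dif_pos]
          rw [Category.assoc, ← Category.assoc (D.inj _), D.inj_prj_of_ne]
          · simp
          · intro hh
            apply hbc
            rw [← h.choose_spec, ← h'.choose_spec, hh]
        · simp [h']
      · simp [h]
    exists_sum := fun p x => by
      obtain ⟨s, hs⟩ := D.exists_sum p x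
      refine ⟨s.map ⟨e, he⟩, ?_⟩
      conv_lhs => rw [hs]
      rw [Finset.sum_map]
      refine Finset.sum_congr rfl fun a _ => ?_
      have h : ∃ a', e a' = e a := ⟨a, rfl⟩
      simp only [Function.Embedding.coeFn_mk]
      rw [dif_pos h, dif_pos h]
      -- The chosen preimage of `e a` equals `a` only propositionally, by injectivity; quantifying
      -- over all preimages makes the substitution possible.
      have key : ∀ a' (h' : e a' = e a), (D.inj a).app p ((D.prj a).app p x) =
          ((i' a' (e a) h').inv ≫ D.inj a').app p ((D.prj a' ≫ (i' a' (e a) h').hom).app p x) := by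
        intro a' h'
        obtain rfl := he h'
        rw [← ConcreteCategory.comp_apply, ← ConcreteCategory.comp_apply, ← NatTrans.comp_app,
          ← NatTrans.comp_app, Category.assoc, Iso.hom_inv_id_assoc]
      exact key _ h.choose_spec }

/-- Removing zero summands. -/
def restrict (D : DirectSumData F M) (s : Set ι) (hs : ∀ a, a ∉ s → IsZero (F a)) :
    DirectSumData (fun a : s => F a) M := by
  classical
  exact
  { inj := fun a => D.inj a
    prj := fun a => D.prj a
    inj_prj := fun a => D.inj_prj a
    inj_prj_of_ne := fun a b h => D.inj_prj_of_ne _ _ (fun h' => h (Subtype.ext h'))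
    exists_sum := fun p x => by
      obtain ⟨t, ht⟩ := D.exists_sum p x
      refine ⟨t.subtype (· ∈ s), ?_⟩
      rw [Finset.sum_subtype_eq_sum_filter (f := fun a => (D.inj a).app p ((D.prj a).app p x))]
      conv_lhs => rw [ht]
      rw [Finset.sum_filter]
      refine Finset.sum_congr rfl fun a _ => ?_
      split_ifs with h
      · rfl
      · have : D.inj a = 0 := (hs a h).eq_of_src _ _
        rw [this]; rfl }

lemma finite_support (D : DirectSumData F M) (p : P) (x : M.obj p) :
    {a | (D.prj a).app p x ≠ 0}.Finite := by
  obtain ⟨s, hs⟩ := D.exists_sum p x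
  refine s.finite_toSet.subset fun a ha => ?_
  by_contra h
  apply ha
  rw [hs, map_sum]
  refine Finset.sum_eq_zero fun b hb => ?_
  exact D.prj_inj_apply_of_ne (fun h' : b = a => h (h' ▸ hb)) _ _

lemma eq_finsum (D : DirectSumData F M) (p : P) (x : M.obj p) :
    x = ∑ᶠ a, (D.inj a).app p ((D.prj a).app p x) := by
  have hsub : Function.support (fun a => (D.inj a).app p ((D.prj a).app p x)) ⊆
      ((D.finite_support p x).toFinset : Set ι) := by
    intro a ha
    simp only [Set.Finite.coe_toFinset, Set.mem_ofPred_eq]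
    intro h
    apply ha
    simp [h]
  rw [finsum_eq_sum_of_support_subset _ hsub]
  obtain ⟨s, hs⟩ := D.exists_sum p x
  conv_lhs => rw [hs]
  symm
  apply Finset.sum_subset
  · intro a ha
    by_contra h
    have h' := (D.finite_support p x).mem_toFinset.1 ha
    apply h'
    rw [hs, map_sum]
    refine Finset.sum_eq_zero fun b hb => ?_
    exact D.prj_inj_apply_of_ne (fun h' : b = a => h (h' ▸ hb)) _ _
  · intro a _ ha
    simp only [Set.Finite.mem_toFinset, Set.mem_ofPred_eq, not_not] at ha
    simp [ha]

/-- The morphism out of a direct sum with prescribed restrictions to the summands. -/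
def desc (D : DirectSumData F M) {T : P ⥤ ModuleCat.{u} K} (t : ∀ a, F a ⟶ T) : M ⟶ T where
  app p := ModuleCat.ofHom
    { toFun := fun x => ∑ᶠ a, (t a).app p ((D.prj a).app p x)
      map_add' := fun x y => by
        rw [← finsum_add_distrib]
        · simp
        · refine (D.finite_support p x).subset fun a ha h => ha ?_
          simp [h]
        · refine (D.finite_support p y).subset fun a ha h => ha ?_
          simp [h]
      map_smul' := fun c x => by
        rw [RingHom.id_apply, smul_finsum]
        simp }
  naturality p q f := by
    ext x
    have h := (T.map f).hom.toAddMonoidHom.map_finsum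
      (f := fun a => (t a).app p ((D.prj a).app p x))
      ((D.finite_support p x).subset fun a ha h => ha (by simp [h]))
    refine Eq.trans ?_ h.symm
    change ∑ᶠ a, (t a).app q ((D.prj a).app q (M.map f x)) = _
    refine finsum_congr fun a => ?_
    exact ConcreteCategory.congr_hom ((D.prj a ≫ t a).naturality f) x

lemma isCoproductOf (D : DirectSumData F M) : IsCoproductOf F M := by
  classical
  refine ⟨D.inj, ⟨Cofan.IsColimit.mk _ (fun s => D.desc s.inj) ?_ ?_⟩⟩
  · intro s a
    ext p x
    change ∑ᶠ b, (s.inj b).app p ((D.prj b).app p ((D.inj a).app p x)) = (s.inj a).app p x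
    rw [finsum_eq_single _ a, D.prj_inj_apply]
    intro b hb
    rw [D.prj_inj_apply_of_ne hb.symm, map_zero]
  · intro s m hm
    ext p x
    change m.app p x = ∑ᶠ b, (s.inj b).app p ((D.prj b).app p x)
    conv_lhs => rw [D.eq_finsum p x]
    have h := (m.app p).hom.toAddMonoidHom.map_finsum
      (f := fun a => (D.inj a).app p ((D.prj a).app p x))
      ((D.finite_support p x).subset fun a ha h => ha (by simp [h]))
    refine Eq.trans h (finsum_congr fun a => ?_)
    rw [← hm a]
    rfl

end DirectSumData

/-- The quotient of a persistence module by a compatible family of subspaces. -/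
def quotientModule (M : P ⥤ ModuleCat.{u} K) (S : ∀ p, Submodule K (M.obj p))
    (hS : ∀ p q (f : p ⟶ q), S p ≤ (S q).comap (M.map f).hom) : P ⥤ ModuleCat.{u} K where
  obj p := ModuleCat.of K (M.obj p ⧸ S p)
  map {p q} f := ModuleCat.ofHom ((S p).mapQ (S q) (M.map f).hom (hS p q f))
  map_id p := by
    ext x
    simp
  map_comp f g := by
    ext x
    simp

/-- The universal property supplies the projections. To see that the summands span `M` pointwise,
divide by the sum of their images: the quotient map vanishes on every summand, hence is zero. -/
lemma IsCoproductOf.directSumData {ι : Type w} {F : ι → P ⥤ ModuleCat.{u} K}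
    {M : P ⥤ ModuleCat.{u} K} (h : IsCoproductOf F M) : Nonempty (DirectSumData F M) := by
  classical
  obtain ⟨inj, ⟨hc⟩⟩ := h
  let prj : ∀ a, M ⟶ F a := fun a =>
    hc.desc (Cofan.mk (F a) fun b => if h : b = a then eqToHom (by rw [h]) else 0)
  have hp : ∀ a b, inj a ≫ prj b = if h : a = b then eqToHom (by rw [h]) else 0 :=
    fun a b => hc.fac _ ⟨a⟩
  have h1 : ∀ a, inj a ≫ prj a = 𝟙 _ := fun a => by simp [hp]
  have h2 : ∀ a b, a ≠ b → inj a ≫ prj b = 0 := fun a b h => by simp [hp, h]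
  have h1' : ∀ a p (x : (F a).obj p), (prj a).app p ((inj a).app p x) = x := fun a p x => by
    rw [← ConcreteCategory.comp_apply, ← NatTrans.comp_app, h1]; rfl
  have h2' : ∀ a b, a ≠ b → ∀ p (x : (F a).obj p), (prj b).app p ((inj a).app p x) = 0 :=
    fun a b h p x => by
      rw [← ConcreteCategory.comp_apply, ← NatTrans.comp_app, h2 a b h]; rfl
  let S : ∀ p, Submodule K (M.obj p) := fun p => ⨆ a, LinearMap.range ((inj a).app p).hom
  have hS : ∀ p q (f : p ⟶ q), S p ≤ (S q).comap (M.map f).hom := by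
    intro p q f
    refine iSup_le fun a => ?_
    rintro _ ⟨x, rfl⟩
    refine (le_iSup (fun a => LinearMap.range ((inj a).app q).hom) a) ⟨(F a).map f x, ?_⟩
    exact (ConcreteCategory.congr_hom ((inj a).naturality f) x)
  let π : M ⟶ quotientModule M S hS :=
    { app := fun p => ModuleCat.ofHom (S p).mkQ
      naturality := fun p q f => by ext x; rfl }
  have hπ : π = 0 := by
    refine hc.hom_ext fun ⟨a⟩ => ?_
    ext p x
    refine (Submodule.Quotient.mk_eq_zero _).2 ?_
    exact (le_iSup (fun a => LinearMap.range ((inj a).app p).hom) a) ⟨x, rfl⟩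
  refine ⟨⟨inj, prj, h1, h2, fun p x => ?_⟩⟩
  have hx : x ∈ S p := by
    rw [← Submodule.Quotient.mk_eq_zero]
    change π.app p x = 0
    rw [hπ]; rfl
  obtain ⟨y, hy⟩ := (Submodule.mem_iSup_iff_exists_finsupp _ _).1 hx
  obtain ⟨hy, hyx⟩ := hy
  refine ⟨y.support, ?_⟩
  conv_lhs => rw [← hyx]
  refine Finset.sum_congr rfl fun a ha => ?_
  obtain ⟨z, hz⟩ := hy a
  have : (prj a).app p x = z := by
    rw [← hyx, Finsupp.sum, map_sum]
    rw [Finset.sum_eq_single a]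
    · rw [← hz]; exact h1' a p z
    · intro b _ hb
      obtain ⟨z', hz'⟩ := hy b
      rw [← hz']
      exact h2' b a hb p z'
    · intro h; exact absurd ha h
  rw [this]; exact hz.symm

end DirectSum

end PersMod

end
noncomputable section

namespace PersMod

/-! ### The zigzag metric -/

section Metric

variable {K : Type u} [Field K] {P : Type} [Preorder P]

lemma kerDim_eq_zero {M N : P ⥤ ModuleCat.{u} K} (f : M ⟶ N) (p : P)
    (h : ∀ x, f.app p x = 0 → x = 0) : kerDim f p = 0 := by
  have : LinearMap.ker (f.app p).hom = ⊥ := (Submodule.eq_bot_iff _).2 fun x hx => h x hx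
  unfold kerDim
  rw [this]
  exact edim_eq_zero

lemma cokerDim_eq_zero {M N : P ⥤ ModuleCat.{u} K} (f : M ⟶ N) (p : P)
    (h : ∀ y, ∃ x, f.app p x = y) : cokerDim f p = 0 := by
  have : LinearMap.range (f.app p).hom = ⊤ := LinearMap.range_eq_top.2 h
  have : Subsingleton (N.obj p ⧸ LinearMap.range (f.app p).hom) :=
    Submodule.Quotient.subsingleton_iff.2 this
  exact edim_eq_zero

/-- Concatenation of zigzags. -/
def Zigzag.append : {M N L : P ⥤ ModuleCat.{u} K} → Zigzag M N → Zigzag N L → Zigzag M L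
  | _, _, _, .nil _, δ => δ
  | _, _, _, .fwd f γ, δ => .fwd f (γ.append δ)
  | _, _, _, .bwd f γ, δ => .bwd f (γ.append δ)

/-- The reverse of a zigzag. -/
def Zigzag.reverse : {M N : P ⥤ ModuleCat.{u} K} → Zigzag M N → Zigzag N M
  | _, _, .nil M => .nil M
  | _, _, .fwd f γ => γ.reverse.append (.bwd f (.nil _))
  | _, _, .bwd f γ => γ.reverse.append (.fwd f (.nil _))

/-- The pointwise product of two persistence modules. -/
def prodModule (M N : P ⥤ ModuleCat.{u} K) : P ⥤ ModuleCat.{u} K where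
  obj p := ModuleCat.of K (M.obj p × N.obj p)
  map f := ModuleCat.ofHom ((M.map f).hom.prodMap (N.map f).hom)
  map_id p := by
    ext x <;> simp
  map_comp f g := by
    ext x <;> simp

/-- The product of a morphism with an identity morphism. -/
def prodModuleMap {M N : P ⥤ ModuleCat.{u} K} (f : M ⟶ N) (R : P ⥤ ModuleCat.{u} K) :
    prodModule M R ⟶ prodModule N R where
  app p := ModuleCat.ofHom ((f.app p).hom.prodMap LinearMap.id)
  naturality p q g := by
    refine ConcreteCategory.hom_ext _ _ fun x => ?_
    exact Prod.ext (ConcreteCategory.congr_hom (f.naturality g) x.1) rfl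

lemma kerDim_prodModuleMap {M N : P ⥤ ModuleCat.{u} K} (f : M ⟶ N) (R : P ⥤ ModuleCat.{u} K) :
    kerDim (prodModuleMap f R) = kerDim f := by
  funext p
  refine edim_congr (LinearEquiv.ofBijective
    ((LinearMap.fst K (M.obj p) (R.obj p)).restrict
      (p := LinearMap.ker ((f.app p).hom.prodMap LinearMap.id)) (q := LinearMap.ker (f.app p).hom)
      fun x hx => congrArg Prod.fst hx) ⟨?_, ?_⟩)
  · rintro ⟨⟨x1, x2⟩, hx⟩ ⟨⟨y1, y2⟩, hy⟩ h
    have h1 : x1 = y1 := congrArg Subtype.val h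
    have hx2 : x2 = 0 := congrArg Prod.snd hx
    have hy2 : y2 = 0 := congrArg Prod.snd hy
    subst h1 hx2 hy2
    rfl
  · rintro ⟨x, hx⟩
    exact ⟨⟨(x, 0), Prod.ext hx rfl⟩, rfl⟩

lemma cokerDim_prodModuleMap {M N : P ⥤ ModuleCat.{u} K} (f : M ⟶ N) (R : P ⥤ ModuleCat.{u} K) :
    cokerDim (prodModuleMap f R) = cokerDim f := by
  funext p
  let g : (N.obj p × R.obj p) →ₗ[K] N.obj p ⧸ LinearMap.range (f.app p).hom :=
    (LinearMap.range (f.app p).hom).mkQ ∘ₗ LinearMap.fst K _ _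
  have hg : Function.Surjective g := by
    intro y
    obtain ⟨x, rfl⟩ := Submodule.mkQ_surjective _ y
    exact ⟨(x, 0), rfl⟩
  have hk : LinearMap.range ((f.app p).hom.prodMap (LinearMap.id (R := K) (M := R.obj p))) =
      LinearMap.ker g := by
    ext ⟨x, y⟩
    simp only [g, LinearMap.mem_ker, LinearMap.comp_apply, LinearMap.fst_apply,
      Submodule.mkQ_apply, Submodule.Quotient.mk_eq_zero]
    constructor
    · rintro ⟨z, hz⟩
      exact ⟨z.1, congrArg Prod.fst hz⟩
    · rintro ⟨z, hz⟩
      exact ⟨(z, y), Prod.ext hz rfl⟩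
  exact edim_congr ((Submodule.quotEquivOfEq _ _ hk).trans (g.quotKerEquivOfSurjective hg))

/-- The product of a zigzag with a persistence module. -/
def Zigzag.prod (R : P ⥤ ModuleCat.{u} K) : {M N : P ⥤ ModuleCat.{u} K} → Zigzag M N →
    Zigzag (prodModule M R) (prodModule N R)
  | _, _, .nil M => .nil _
  | _, _, .fwd f γ => .fwd (prodModuleMap f R) (γ.prod R)
  | _, _, .bwd f γ => .bwd (prodModuleMap f R) (γ.prod R)

/-- Interchanging the factors of a product. -/
def prodModuleSwap (M N : P ⥤ ModuleCat.{u} K) : prodModule M N ⟶ prodModule N M where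
  app p := ModuleCat.ofHom (LinearEquiv.prodComm K (M.obj p) (N.obj p)).toLinearMap

/-- The product of a list of persistence modules. -/
def listSum : List (P ⥤ ModuleCat.{u} K) → (P ⥤ ModuleCat.{u} K)
  | [] => (Functor.const P).obj (ModuleCat.of K PUnit)
  | F :: l => prodModule F (listSum l)

lemma dimVec_listSum (l : List (P ⥤ ModuleCat.{u} K)) (p : P) :
    dimVec (listSum l) p = (l.map fun F => dimVec F p).sum := by
  induction l with
  | nil => exact edim_eq_zero (K := K) (V := PUnit)
  | cons F l ih =>
    rw [List.map_cons, List.sum_cons, ← ih]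
    exact edim_prod

namespace DirectSumData

variable {ι : Type w} {F : ι → P ⥤ ModuleCat.{u} K} {M : P ⥤ ModuleCat.{u} K}

/-- The projection of a direct sum to the product of finitely many summands. -/
def toListSum (D : DirectSumData F M) : ∀ l : List ι, M ⟶ listSum (l.map F)
  | [] => { app := fun p => ModuleCat.ofHom (0 : M.obj p →ₗ[K] PUnit.{u + 1}) }
  | a :: l =>
    { app := fun p => ModuleCat.ofHom
        (((D.prj a).app p).hom.prod ((D.toListSum l).app p).hom)
      naturality := fun p q f => by
        refine ConcreteCategory.hom_ext _ _ fun x => ?_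
        exact Prod.ext (ConcreteCategory.congr_hom ((D.prj a).naturality f) x)
          (ConcreteCategory.congr_hom ((D.toListSum l).naturality f) x) }

lemma toListSum_eq_zero (D : DirectSumData F M) (l : List ι) (p : P) (x : M.obj p)
    (h : ∀ a ∈ l, (D.prj a).app p x = 0) : (D.toListSum l).app p x = 0 := by
  induction l with
  | nil => rfl
  | cons a l ih =>
    exact Prod.ext (h a (by simp)) (ih fun b hb => h b (by simp [hb]))

lemma exists_toListSum_eq (D : DirectSumData F M) (l : List ι) (hl : l.Nodup) (p : P)
    (y : (listSum (l.map F)).obj p) :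
    ∃ x, (D.toListSum l).app p x = y ∧ ∀ a ∉ l, (D.prj a).app p x = 0 := by
  induction l with
  | nil => exact ⟨0, rfl, fun a _ => map_zero _⟩
  | cons a l ih =>
    obtain ⟨ha, hl⟩ := List.nodup_cons.1 hl
    obtain ⟨x, hx, hx'⟩ := ih hl y.2
    refine ⟨(D.inj a).app p y.1 + x, ?_, ?_⟩
    · rw [map_add]
      refine Prod.ext ?_ ?_
      · change (D.prj a).app p ((D.inj a).app p y.1) + (D.prj a).app p x = y.1
        rw [hx' a ha, D.prj_inj_apply, add_zero]
      · change (D.toListSum l).app p ((D.inj a).app p y.1) + (D.toListSum l).app p x = y.2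
        rw [hx, D.toListSum_eq_zero, zero_add]
        intro b hb
        exact D.prj_inj_apply_of_ne (fun h : a = b => ha (h ▸ hb)) p _
    · intro b hb
      rw [map_add, hx' b (fun h => hb (by simp [h])), add_zero]
      exact D.prj_inj_apply_of_ne (fun h : a = b => hb (by simp [h])) p _

/-- The kernel of the projection carries exactly the omitted summands. Finiteness at `p` allows the
retained dimensions to be cancelled from the rank-nullity formula. -/
lemma kerDim_toListSum (D : DirectSumData F M) (S : Finset ι) (p : P) (hp : dimVec M p ≠ ∞) :
    kerDim (D.toListSum S.toList) p = ∑' a : {a // a ∉ S}, dimVec (F a) p := by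
  have h := edim_ker_add_edim_range ((D.toListSum S.toList).app p).hom
  have hr : LinearMap.range ((D.toListSum S.toList).app p).hom = ⊤ := LinearMap.range_eq_top.2
    fun y => (D.exists_toListSum_eq _ S.nodup_toList p y).imp fun _ h => h.1
  rw [hr, edim_congr Submodule.topEquiv] at h
  replace h : kerDim (D.toListSum S.toList) p + dimVec (listSum (S.toList.map F)) p =
      dimVec M p := h
  rw [dimVec_listSum, List.map_map, D.dimVec_eq_tsum] at h
  have e : (List.map ((fun F => dimVec F p) ∘ F) S.toList).sum = ∑ a ∈ S, dimVec (F a) p :=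
    Finset.sum_map_toList S _
  have hS : ∑ a ∈ S, dimVec (F a) p ≠ ∞ := by
    refine ne_top_of_le_ne_top hp ?_
    rw [D.dimVec_eq_tsum]
    exact ENNReal.sum_le_tsum S
  have h' : ∑ a ∈ S, dimVec (F a) p + ∑' a : {a // a ∉ S}, dimVec (F a) p =
      ∑' a, dimVec (F a) p := by
    rw [← Finset.tsum_subtype S fun a => dimVec (F a) p]
    exact Summable.tsum_add_tsum_compl (f := fun a => dimVec (F a) p) (s := {a | a ∈ S})
      ENNReal.summable ENNReal.summable
  rw [e, ← h', add_comm] at h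
  exact (ENNReal.add_right_inj hS).1 h

end DirectSumData

variable [MeasurableSpace P] {μ : Measure P}

lemma Zigzag.cost_append {M N L : P ⥤ ModuleCat.{u} K} (γ : Zigzag M N) (δ : Zigzag N L) :
    (γ.append δ).cost μ = γ.cost μ + δ.cost μ := by
  induction γ with
  | nil => simp [append, cost]
  | fwd f γ ih => simp [append, cost, ih, add_assoc]
  | bwd f γ ih => simp [append, cost, ih, add_assoc]

lemma Zigzag.IsMeasurable.append {M N L : P ⥤ ModuleCat.{u} K} {γ : Zigzag M N} {δ : Zigzag N L}
    (hγ : γ.IsMeasurable μ) (hδ : δ.IsMeasurable μ) : (γ.append δ).IsMeasurable μ := by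
  induction γ with
  | nil => exact hδ
  | fwd f γ ih => exact ⟨hγ.1, hγ.2.1, ih hγ.2.2 hδ⟩
  | bwd f γ ih => exact ⟨hγ.1, hγ.2.1, ih hγ.2.2 hδ⟩

lemma Zigzag.cost_reverse {M N : P ⥤ ModuleCat.{u} K} (γ : Zigzag M N) :
    γ.reverse.cost μ = γ.cost μ := by
  induction γ with
  | nil => rfl
  | fwd f γ ih => simp [reverse, cost_append, cost, ih, add_comm]
  | bwd f γ ih => simp [reverse, cost_append, cost, ih, add_comm]

lemma Zigzag.IsMeasurable.reverse {M N : P ⥤ ModuleCat.{u} K} {γ : Zigzag M N}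
    (hγ : γ.IsMeasurable μ) : γ.reverse.IsMeasurable μ := by
  induction γ with
  | nil => trivial
  | fwd f γ ih => exact (ih hγ.2.2).append ⟨hγ.1, hγ.2.1, trivial⟩
  | bwd f γ ih => exact (ih hγ.2.2).append ⟨hγ.1, hγ.2.1, trivial⟩

lemma zigzagDist_le {M N : P ⥤ ModuleCat.{u} K} (γ : Zigzag M N) (h : γ.IsMeasurable μ) :
    zigzagDist μ M N ≤ γ.cost μ :=
  iInf₂_le γ h

lemma zigzagDist_le_of_hom {M N : P ⥤ ModuleCat.{u} K} (f : M ⟶ N)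
    (h1 : AEMeasurable (kerDim f) μ) (h2 : AEMeasurable (cokerDim f) μ) :
    zigzagDist μ M N ≤ ∫⁻ p, kerDim f p ∂μ + ∫⁻ p, cokerDim f p ∂μ := by
  refine (zigzagDist_le (.fwd f (.nil _)) ⟨h1, h2, trivial⟩).trans ?_
  simp [Zigzag.cost]

lemma zigzagDist_comm_le (M N : P ⥤ ModuleCat.{u} K) :
    zigzagDist μ M N ≤ zigzagDist μ N M := by
  refine le_iInf₂ fun γ hγ => ?_
  rw [← γ.cost_reverse]
  exact zigzagDist_le _ hγ.reverse

lemma zigzagDist_comm (M N : P ⥤ ModuleCat.{u} K) : zigzagDist μ M N = zigzagDist μ N M :=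
  le_antisymm (zigzagDist_comm_le _ _) (zigzagDist_comm_le _ _)

lemma zigzagDist_triangle (M N L : P ⥤ ModuleCat.{u} K) :
    zigzagDist μ M L ≤ zigzagDist μ M N + zigzagDist μ N L := by
  unfold zigzagDist
  simp only [ENNReal.iInf_add, ENNReal.add_iInf]
  refine le_iInf₂ fun δ hδ => le_iInf₂ fun γ hγ => ?_
  rw [← Zigzag.cost_append]
  exact zigzagDist_le _ (hγ.append hδ)

lemma zigzagDist_eq_zero_of_hom {M N : P ⥤ ModuleCat.{u} K} (f : M ⟶ N)
    (h1 : ∀ p x, f.app p x = 0 → x = 0) (h2 : ∀ p y, ∃ x, f.app p x = y) :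
    zigzagDist μ M N = 0 := by
  have h1' : kerDim f = fun _ => 0 := funext fun p => kerDim_eq_zero f p (h1 p)
  have h2' : cokerDim f = fun _ => 0 := funext fun p => cokerDim_eq_zero f p (h2 p)
  refine le_antisymm ((zigzagDist_le_of_hom f ?_ ?_).trans ?_) zero_le
  · rw [h1']; exact aemeasurable_const
  · rw [h2']; exact aemeasurable_const
  · simp [h1', h2']

lemma zigzagDist_self (M : P ⥤ ModuleCat.{u} K) : zigzagDist μ M M = 0 :=
  zigzagDist_eq_zero_of_hom (𝟙 M) (fun _ _ h => h) (fun _ y => ⟨y, rfl⟩)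

lemma Zigzag.cost_prod (R : P ⥤ ModuleCat.{u} K) {M N : P ⥤ ModuleCat.{u} K} (γ : Zigzag M N) :
    (γ.prod R).cost μ = γ.cost μ := by
  induction γ with
  | nil => rfl
  | fwd f γ ih => simp [prod, cost, ih, kerDim_prodModuleMap, cokerDim_prodModuleMap]
  | bwd f γ ih => simp [prod, cost, ih, kerDim_prodModuleMap, cokerDim_prodModuleMap]

lemma Zigzag.IsMeasurable.prod (R : P ⥤ ModuleCat.{u} K) {M N : P ⥤ ModuleCat.{u} K}
    {γ : Zigzag M N} (h : γ.IsMeasurable μ) : (γ.prod R).IsMeasurable μ := by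
  induction γ with
  | nil => trivial
  | fwd f γ ih =>
    refine ⟨?_, ?_, ih h.2.2⟩
    · rw [kerDim_prodModuleMap]; exact h.1
    · rw [cokerDim_prodModuleMap]; exact h.2.1
  | bwd f γ ih =>
    refine ⟨?_, ?_, ih h.2.2⟩
    · rw [kerDim_prodModuleMap]; exact h.1
    · rw [cokerDim_prodModuleMap]; exact h.2.1

/-- An identity summand contributes nothing to kernels and cokernels, so a zigzag can be carried
along with `R` at the same cost. -/
lemma zigzagDist_prod_right_le (M N R : P ⥤ ModuleCat.{u} K) :
    zigzagDist μ (prodModule M R) (prodModule N R) ≤ zigzagDist μ M N := by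
  refine le_iInf₂ fun γ hγ => ?_
  rw [← γ.cost_prod R]
  exact zigzagDist_le _ (hγ.prod R)

lemma zigzagDist_prodModule_swap (M N : P ⥤ ModuleCat.{u} K) :
    zigzagDist μ (prodModule M N) (prodModule N M) = 0 :=
  zigzagDist_eq_zero_of_hom (prodModuleSwap M N)
    (fun p _ h => (LinearEquiv.prodComm K (M.obj p) (N.obj p)).map_eq_zero_iff.1 h)
    (fun p y => (LinearEquiv.prodComm K (M.obj p) (N.obj p)).surjective y)

lemma zigzagDist_prod_left_le (R M N : P ⥤ ModuleCat.{u} K) :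
    zigzagDist μ (prodModule R M) (prodModule R N) ≤ zigzagDist μ M N := by
  refine (zigzagDist_triangle _ (prodModule M R) _).trans ?_
  rw [zigzagDist_prodModule_swap, zero_add]
  refine (zigzagDist_triangle _ (prodModule N R) _).trans ?_
  rw [zigzagDist_prodModule_swap, add_zero]
  exact zigzagDist_prod_right_le M N R

lemma zigzagDist_listSum_le {ι : Type*} (F G : ι → P ⥤ ModuleCat.{u} K) (l : List ι) :
    zigzagDist μ (listSum (l.map F)) (listSum (l.map G)) ≤
      (l.map fun a => zigzagDist μ (F a) (G a)).sum := by
  induction l with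
  | nil => exact (zigzagDist_self _).le
  | cons a l ih =>
    refine (zigzagDist_triangle _ (prodModule (G a) (listSum (l.map F))) _).trans ?_
    exact add_le_add (zigzagDist_prod_right_le _ _ _)
      ((zigzagDist_prod_left_le _ _ _).trans ih)

namespace DirectSumData

variable {ι : Type w} {F : ι → P ⥤ ModuleCat.{u} K} {M : P ⥤ ModuleCat.{u} K}

lemma tsum_lintegral_dimVec [Countable ι] (D : DirectSumData F M)
    (hF : ∀ a, AEMeasurable (dimVec (F a)) μ) :
    ∑' a, ∫⁻ p, dimVec (F a) p ∂μ = ∫⁻ p, dimVec M p ∂μ := by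
  rw [← lintegral_tsum hF]
  exact lintegral_congr fun p => (D.dimVec_eq_tsum p).symm

/-- Projecting onto finitely many summands is surjective, and the cost of its kernel is the tail of
a convergent series. -/
lemma zigzagDist_listSum_tendsto [Countable ι] (D : DirectSumData F M)
    (hF : ∀ a, AEMeasurable (dimVec (F a)) μ) (hM : HasFiniteTotalPersistence μ M) :
    Filter.Tendsto (fun S : Finset ι => zigzagDist μ M (listSum (S.toList.map F)))
      Filter.atTop (nhds 0) := by
  have hfin := ENNReal.tendsto_tsum_compl_atTop_zero
    (f := fun a => ∫⁻ p, dimVec (F a) p ∂μ) (by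
      rw [D.tsum_lintegral_dimVec hF]; exact hM.2.ne)
  refine tendsto_of_tendsto_of_tendsto_of_le_of_le tendsto_const_nhds hfin
    (fun _ => zero_le) fun S => ?_
  have hae : kerDim (D.toListSum S.toList) =ᵐ[μ]
      fun p => ∑' a : {a // a ∉ S}, dimVec (F a) p := by
    filter_upwards [ae_lt_top' hM.1 hM.2.ne] with p hp
    exact D.kerDim_toListSum S p hp.ne
  have hc : cokerDim (D.toListSum S.toList) = fun _ => 0 := funext fun p =>
    cokerDim_eq_zero _ p fun y => (D.exists_toListSum_eq _ S.nodup_toList p y).imp fun _ h => h.1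
  refine (zigzagDist_le_of_hom (D.toListSum S.toList) ?_ ?_).trans ?_
  · exact (AEMeasurable.tsum fun a : {a // a ∉ S} => hF a).congr hae.symm
  · rw [hc]; exact aemeasurable_const
  · rw [lintegral_congr_ae hae, hc, lintegral_tsum fun a : {a // a ∉ S} => hF a]
    simp

end DirectSumData

/-- The zigzag metric is subadditive for countable direct sums. -/
lemma zigzagDist_le_tsum {ι : Type w} [Countable ι] {F G : ι → P ⥤ ModuleCat.{u} K}
    {M N : P ⥤ ModuleCat.{u} K} (D : DirectSumData F M) (E : DirectSumData G N)
    (hF : ∀ a, AEMeasurable (dimVec (F a)) μ) (hG : ∀ a, AEMeasurable (dimVec (G a)) μ)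
    (hM : HasFiniteTotalPersistence μ M) (hN : HasFiniteTotalPersistence μ N) :
    zigzagDist μ M N ≤ ∑' a, zigzagDist μ (F a) (G a) := by
  -- Both modules are truncated to the same finite index set `S`. The truncations are compared
  -- summand by summand, and the truncation errors vanish as `S` grows.
  have h1 := D.zigzagDist_listSum_tendsto hF hM
  have h2 := E.zigzagDist_listSum_tendsto hG hN
  have h3 := (h1.add_const (∑' a, zigzagDist μ (F a) (G a))).add h2
  rw [zero_add, add_zero] at h3
  refine ge_of_tendsto' h3 fun S => ?_
  refine (zigzagDist_triangle _ (listSum (S.toList.map G)) _).trans ?_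
  refine add_le_add ((zigzagDist_triangle _ (listSum (S.toList.map F)) _).trans ?_)
    (zigzagDist_comm _ _).le
  refine add_le_add le_rfl ((zigzagDist_listSum_le F G S.toList).trans ?_)
  rw [Finset.sum_map_toList]
  exact ENNReal.sum_le_tsum S

end Metric

end PersMod

end
noncomputable section

namespace PersMod

/-! ### Interval modules -/

section Interval

variable {K : Type u} [Field K] {P : Type} [LinearOrder P]

lemma intervalModule_subsingleton {I : PInterval P} {p : P} (hp : p ∉ I.1) :
    Subsingleton ((intervalModule K I).obj p) :=
  ⟨fun _ _ => funext fun h => absurd h.down hp⟩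

lemma intervalModule_map_apply (I : PInterval P) {a b : P} (f : a ⟶ b)
    (x : (intervalModule K I).obj a) (ha : a ∈ I.1) (hb : b ∈ I.1) :
    ((intervalModule K I).map f x : PLift (b ∈ I.1) → K) ⟨hb⟩ = x ⟨ha⟩ :=
  dif_pos ha

lemma dimVec_intervalModule (I : PInterval P) (p : P) :
    dimVec (intervalModule K I) p = I.1.indicator 1 p := by
  by_cases hp : p ∈ I.1
  · rw [Set.indicator_of_mem hp, Pi.one_apply, ← edim_self (K := K)]
    have : Unique (PLift (p ∈ I.1)) := ⟨⟨⟨hp⟩⟩, fun _ => rfl⟩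
    exact edim_congr (LinearEquiv.funUnique (PLift (p ∈ I.1)) K K)
  · rw [Set.indicator_of_notMem hp]
    have := intervalModule_subsingleton (K := K) hp
    exact edim_eq_zero

open Classical in
/-- The canonical morphism between the interval modules of two intervals. -/
def intervalHom (X Y : PInterval P)
    (h : ∀ a b, a ≤ b → a ∈ X.1 → b ∈ Y.1 → (b ∈ X.1 ↔ a ∈ Y.1)) :
    intervalModule K X ⟶ intervalModule K Y where
  app a := ModuleCat.ofHom (X := PLift (a ∈ X.1) → K) (Y := PLift (a ∈ Y.1) → K)
    { toFun := fun g _ => if ha : a ∈ X.1 then g ⟨ha⟩ else 0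
      map_add' := by
        intro g h; funext _; by_cases ha : a ∈ X.1 <;> simp [ha]
      map_smul' := by
        intro c g; funext _; by_cases ha : a ∈ X.1 <;> simp [ha] }
  -- The hypothesis `h` is precisely naturality: for `a ∈ X` and `b ∈ Y` the two paths around the
  -- square are both the identity of `K` or both zero.
  naturality a b f := by
    refine ConcreteCategory.hom_ext _ _ fun x => ?_
    funext ⟨hb⟩
    change (if hb : b ∈ X.1 then (if ha : a ∈ X.1 then x ⟨ha⟩ else 0) else 0) =
      (if ha : a ∈ Y.1 then (if ha : a ∈ X.1 then x ⟨ha⟩ else 0) else 0)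
    by_cases ha : a ∈ X.1
    · have := h a b (leOfHom f) ha hb
      by_cases hb' : b ∈ X.1
      · simp [hb', this.1 hb']
      · have h' : a ∉ Y.1 := fun h' => hb' (this.2 h')
        simp [hb', h']
    · simp [ha]

lemma intervalHom_app_apply (X Y : PInterval P)
    (h : ∀ a b, a ≤ b → a ∈ X.1 → b ∈ Y.1 → (b ∈ X.1 ↔ a ∈ Y.1)) {p : P}
    (x : (intervalModule K X).obj p) (hX : p ∈ X.1) (hY : p ∈ Y.1) :
    ((intervalHom X Y h).app p x : PLift (p ∈ Y.1) → K) ⟨hY⟩ = x ⟨hX⟩ :=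
  dif_pos hX

lemma kerDim_intervalHom (X Y : PInterval P)
    (h : ∀ a b, a ≤ b → a ∈ X.1 → b ∈ Y.1 → (b ∈ X.1 ↔ a ∈ Y.1)) :
    kerDim (intervalHom (K := K) X Y h) = (X.1 \ Y.1).indicator 1 := by
  funext p
  by_cases hX : p ∈ X.1
  · by_cases hY : p ∈ Y.1
    · rw [Set.indicator_of_notMem (fun h => h.2 hY)]
      refine kerDim_eq_zero _ _ fun x hx => funext fun ⟨h'⟩ => ?_
      have := congrFun hx ⟨hY⟩
      exact (intervalHom_app_apply X Y h x hX hY).symm.trans this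
    · rw [Set.indicator_of_mem (show p ∈ X.1 \ Y.1 from ⟨hX, hY⟩)]
      have := intervalModule_subsingleton (K := K) hY
      have hk : LinearMap.ker ((intervalHom (K := K) X Y h).app p).hom = ⊤ :=
        LinearMap.ker_eq_top.2 (Subsingleton.elim _ _)
      unfold kerDim
      rw [hk, edim_congr Submodule.topEquiv]
      refine (dimVec_intervalModule X p).trans ?_
      rw [Set.indicator_of_mem hX]
  · rw [Set.indicator_of_notMem (fun h => hX h.1)]
    have := intervalModule_subsingleton (K := K) hX
    exact kerDim_eq_zero _ _ fun x _ => Subsingleton.elim _ _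

lemma cokerDim_intervalHom (X Y : PInterval P)
    (h : ∀ a b, a ≤ b → a ∈ X.1 → b ∈ Y.1 → (b ∈ X.1 ↔ a ∈ Y.1)) :
    cokerDim (intervalHom (K := K) X Y h) = (Y.1 \ X.1).indicator 1 := by
  funext p
  by_cases hY : p ∈ Y.1
  · by_cases hX : p ∈ X.1
    · rw [Set.indicator_of_notMem (fun h => h.2 hX)]
      exact cokerDim_eq_zero _ _ fun y => ⟨(fun _ => y ⟨hY⟩ : PLift (p ∈ X.1) → K),
        funext fun _ => intervalHom_app_apply X Y h _ hX hY⟩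
    · rw [Set.indicator_of_mem (show p ∈ Y.1 \ X.1 from ⟨hY, hX⟩)]
      have := intervalModule_subsingleton (K := K) hX
      have hk : LinearMap.range ((intervalHom (K := K) X Y h).app p).hom = ⊥ :=
        LinearMap.range_eq_bot.2 (Subsingleton.elim _ _)
      unfold cokerDim
      rw [edim_congr (Submodule.quotEquivOfEqBot _ hk)]
      refine (dimVec_intervalModule Y p).trans ?_
      rw [Set.indicator_of_mem hY]
  · rw [Set.indicator_of_notMem (fun h => hY h.1)]
    have := intervalModule_subsingleton (K := K) hY
    exact cokerDim_eq_zero _ _ fun y => ⟨0, Subsingleton.elim _ _⟩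

/-- Any two points of `I` are comparable, and the structure map between them is the identity of `K`;
naturality therefore forces the same scalar everywhere on `I`. -/
lemma exists_eq_smul_id {I : PInterval P} (g : intervalModule K I ⟶ intervalModule K I) :
    ∃ c : K, g = c • 𝟙 _ := by
  obtain ⟨p₀, h₀⟩ := I.2.1
  let one : ∀ p, (intervalModule K I).obj p := fun p _ => 1
  have hone : ∀ {a b : P} (f : a ⟶ b), a ∈ I.1 → (intervalModule K I).map f (one a) = one b :=
    fun f ha => funext fun ⟨hb⟩ => intervalModule_map_apply I f _ ha hb
  refine ⟨(g.app p₀ (one p₀) : PLift (p₀ ∈ I.1) → K) ⟨h₀⟩, ?_⟩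
  ext p x
  refine funext fun ⟨hp⟩ => ?_
  have key : (g.app p (one p) : PLift (p ∈ I.1) → K) ⟨hp⟩ =
      (g.app p₀ (one p₀) : PLift (p₀ ∈ I.1) → K) ⟨h₀⟩ := by
    rcases le_total p₀ p with h | h
    · have e := ConcreteCategory.congr_hom (g.naturality (homOfLE h)) (one p₀)
      have e' := congrFun e ⟨hp⟩
      change (g.app p ((intervalModule K I).map (homOfLE h) (one p₀)) : PLift (p ∈ I.1) → K) ⟨hp⟩ =
        ((intervalModule K I).map (homOfLE h) (g.app p₀ (one p₀)) : PLift (p ∈ I.1) → K) ⟨hp⟩ at e'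
      rwa [hone _ h₀, intervalModule_map_apply I _ _ h₀ hp] at e'
    · have e := ConcreteCategory.congr_hom (g.naturality (homOfLE h)) (one p)
      have e' := congrFun e ⟨h₀⟩
      change (g.app p₀ ((intervalModule K I).map (homOfLE h) (one p)) : PLift (p₀ ∈ I.1) → K) ⟨h₀⟩ =
        ((intervalModule K I).map (homOfLE h) (g.app p (one p)) : PLift (p₀ ∈ I.1) → K) ⟨h₀⟩ at e'
      rw [hone _ hp, intervalModule_map_apply I _ _ hp h₀] at e'
      exact e'.symm
  have hx : x = (x ⟨hp⟩ : K) • one p := funext fun ⟨_⟩ => (mul_one (x ⟨hp⟩ : K)).symm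
  rw [hx, map_smul]
  change (x ⟨hp⟩ : K) * (g.app p (one p) : PLift (p ∈ I.1) → K) ⟨hp⟩ = _ * (x ⟨hp⟩ * 1)
  rw [key, mul_one, mul_comm]
  rfl

lemma intervalModule_id_ne_zero (I : PInterval P) : 𝟙 (intervalModule K I) ≠ 0 := by
  obtain ⟨p₀, h₀⟩ := I.2.1
  intro h
  have e := congrFun (ConcreteCategory.congr_hom (congrArg (fun g => NatTrans.app g p₀) h)
    ((fun _ => 1 : PLift (p₀ ∈ I.1) → K))) ⟨h₀⟩
  exact one_ne_zero e

/-- All endomorphisms are scalars, and of two scalars with sum 1 at least one is nonzero, hence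
invertible. -/
instance isLocalRing_end_intervalModule (I : PInterval P) :
    IsLocalRing (End (intervalModule K I)) := by
  have hu : ∀ c : K, c ≠ 0 → IsUnit (M := End (intervalModule K I)) (c • 𝟙 _) := by
    intro c hc
    refine ⟨⟨c • 𝟙 _, c⁻¹ • 𝟙 _, ?_, ?_⟩, rfl⟩
    · change (c⁻¹ • 𝟙 _) ≫ (c • 𝟙 _) = 𝟙 _
      simp [smul_smul, hc]
    · change (c • 𝟙 _) ≫ (c⁻¹ • 𝟙 _) = 𝟙 _
      simp [smul_smul, hc]
  have : Nontrivial (End (intervalModule K I)) := ⟨⟨𝟙 _, 0, intervalModule_id_ne_zero I⟩⟩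
  refine .of_is_unit_or_is_unit_of_add_one fun {a b} hab => ?_
  obtain ⟨c, hc⟩ := exists_eq_smul_id a
  obtain ⟨d, hd⟩ := exists_eq_smul_id b
  by_cases h : c = 0
  · right
    have h' : d ≠ 0 := by
      rintro rfl
      rw [hc, hd, h] at hab
      refine intervalModule_id_ne_zero (K := K) I ?_
      change _ = (1 : End (intervalModule K I)) at hab
      refine Eq.trans hab.symm ?_
      simp
    rw [hd]; exact hu d h'
  · left
    rw [hc]; exact hu c h

lemma exists_isUnit_of_isUnit_sum {R : Type*} [Ring R] [IsLocalRing R] {ι : Type*}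
    (s : Finset ι) (f : ι → R) (h : IsUnit (∑ i ∈ s, f i)) : ∃ i ∈ s, IsUnit (f i) := by
  classical
  induction s using Finset.induction_on with
  | empty => simp at h
  | insert a s ha ih =>
    rw [Finset.sum_insert ha] at h
    obtain ⟨u, hu⟩ := h
    have h1 : ↑u⁻¹ * f a + ↑u⁻¹ * ∑ i ∈ s, f i = 1 := by
      rw [← mul_add, ← hu, Units.inv_mul]
    rcases IsLocalRing.isUnit_or_isUnit_of_add_one h1 with h2 | h2
    · exact ⟨a, by simp, (Units.isUnit_units_mul _ _).1 h2⟩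
    · obtain ⟨i, hi, hi'⟩ := ih ((Units.isUnit_units_mul _ _).1 h2)
      exact ⟨i, by simp [hi], hi'⟩

/-- A summand with local endomorphism ring of a direct sum of interval modules is an interval
module. -/
lemma exists_iso_intervalModule {ι : Type w} {I : ι → PInterval P} {M X : P ⥤ ModuleCat.{u} K}
    (D : DirectSumData (fun a => intervalModule K (I a)) M) (s : X ⟶ M) (r : M ⟶ X)
    (hsr : s ≫ r = 𝟙 X) [hX : IsLocalRing (End X)] :
    ∃ a, Nonempty (X ≅ intervalModule K (I a)) := by
  have hne : ∃ p, ∃ x : X.obj p, x ≠ 0 := by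
    by_contra! h
    refine one_ne_zero (α := End X) ?_
    change 𝟙 X = 0
    ext p x
    exact h p x
  obtain ⟨p, x, hx⟩ := hne
  obtain ⟨T, hT⟩ := D.exists_sum p (s.app p x)
  -- Each `e a` factors through one bar. Near the identity only finitely many matter: their sum over
  -- `T` fixes the chosen nonzero vector `x`.
  let e : ι → End X := fun a => s ≫ D.prj a ≫ D.inj a ≫ r
  have he : (∑ a ∈ T, e a : X ⟶ X).app p x = x := by
    have h1 : r.app p (s.app p x) = x := by
      rw [← ConcreteCategory.comp_apply, ← NatTrans.comp_app, hsr]; rfl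
    rw [hT, map_sum] at h1
    conv_rhs => rw [← h1]
    let φ : (X ⟶ X) →+ X.obj p :=
      { toFun := fun f => f.app p x
        map_zero' := rfl
        map_add' := fun _ _ => rfl }
    exact map_sum φ e T
  -- The complement `1 - ∑ e a` kills `x ≠ 0`, so it is not a unit; locality makes the sum a unit,
  -- and then one of the `e a`.
  have hunit : IsUnit (∑ a ∈ T, e a) := by
    rcases IsLocalRing.isUnit_or_isUnit_of_add_one
      (sub_add_cancel (1 : End X) (∑ a ∈ T, e a)) with h | h
    · exfalso
      obtain ⟨g, hg⟩ := h.exists_left_inv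
      refine hx ?_
      have h0 : (𝟙 X - (∑ a ∈ T, e a : X ⟶ X)).app p x = 0 := by
        change x - (∑ a ∈ T, e a : X ⟶ X).app p x = 0
        rw [he, sub_self]
      have h1 : (g : X ⟶ X).app p ((𝟙 X - (∑ a ∈ T, e a : X ⟶ X)).app p x) = x :=
        ConcreteCategory.congr_hom (congrArg (fun t : X ⟶ X => t.app p) hg) x
      rw [← h1, h0, map_zero]
    · exact h
  obtain ⟨a, _, hu⟩ := exists_isUnit_of_isUnit_sum T e hunit
  obtain ⟨g, hg⟩ := hu.exists_left_inv
  refine ⟨a, ?_⟩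
  obtain ⟨f, f', hff'⟩ : ∃ (f : X ⟶ intervalModule K (I a)) (f' : intervalModule K (I a) ⟶ X),
      f ≫ f' = 𝟙 X := by
    refine ⟨s ≫ D.prj a, D.inj a ≫ r ≫ g, ?_⟩
    change e a ≫ g = 𝟙 X at hg
    simpa [e] using hg
  -- The other composite is a scalar `c`. Sandwiched between `f` and `f'` it gives `c • 𝟙 X = 𝟙 X`,
  -- and `End X` is nontrivial, so `c = 1`.
  have hf'f : f' ≫ f = 𝟙 _ := by
    obtain ⟨c, hc⟩ := exists_eq_smul_id (f' ≫ f)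
    have h1 : c • (𝟙 X) = 𝟙 X := by
      have : f ≫ (f' ≫ f) ≫ f' = 𝟙 X := by
        rw [Category.assoc, ← Category.assoc f, hff', Category.id_comp]
      rw [hc] at this
      simpa [hff'] using this
    have h2 : c = 1 := by
      by_contra hc1
      refine one_ne_zero (α := End X) ?_
      change 𝟙 X = 0
      have h3 : (c - 1) • 𝟙 X = 0 := by rw [sub_smul, h1, one_smul, sub_self]
      exact (smul_eq_zero.1 h3).resolve_left (sub_ne_zero.2 hc1)
    rw [hc, h2, one_smul]
  exact ⟨⟨f, f', hff', hf'f⟩⟩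

end Interval

end PersMod

end
noncomputable section

namespace PersMod

/-! ### Matchings of interval modules -/

section Matching

variable {ι : Type v} {κ : Type w}

/-- The cost of a partial matching, where `c` is the cost of matching two elements and `u`, `v` are
the costs of leaving an element unmatched. -/
def matchCost (c : ι → κ → ℝ≥0∞) (u : ι → ℝ≥0∞) (v : κ → ℝ≥0∞) (f : ι ≃. κ) : ℝ≥0∞ :=
  ∑' a, (f a).elim (u a) (c a) + ∑' b, (f.symm b).elim (v b) fun _ => 0

/-- The optimal cost of a partial matching. -/
def matchDist (c : ι → κ → ℝ≥0∞) (u : ι → ℝ≥0∞) (v : κ → ℝ≥0∞) : ℝ≥0∞ :=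
  ⨅ f : ι ≃. κ, matchCost c u v f

end Matching

/-! ### Countability of the nonzero summands -/

section Dimension

variable {K : Type u} [Field K] {P : Type} [LinearOrder P]

lemma isZero_listSum_nil : IsZero (listSum [] : P ⥤ ModuleCat.{u} K) :=
  Functor.isZero _ fun _ => ModuleCat.isZero_of_subsingleton (ModuleCat.of K PUnit)

lemma dimVec_congr {M N : P ⥤ ModuleCat.{u} K} (e : M ≅ N) : dimVec M = dimVec N :=
  funext fun p => edim_congr (e.app p).toLinearEquiv

lemma dimVec_eq_zero_of_isZero {M : P ⥤ ModuleCat.{u} K} (h : IsZero M) :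
    dimVec M = fun _ => 0 := funext fun p => by
  have := ModuleCat.isZero_iff_subsingleton.1 (h.obj p)
  exact edim_eq_zero

/-- The summands in a decomposition into modules that are zero or have local endomorphism rings are
countably many up to zero modules, and have measurable dimensions. -/
lemma countable_not_isZero {ι : Type v} [Countable ι] {I : ι → PInterval P} {M : P ⥤ ModuleCat.{u} K}
    (D : DirectSumData (fun a => intervalModule K (I a)) M) {A : Type u}
    {F : A → P ⥤ ModuleCat.{u} K} (E : DirectSumData F M)
    (hF : ∀ a, IsZero (F a) ∨ IsLocalRing (End (F a))) : {a | ¬ IsZero (F a)}.Countable := by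
  -- A nonzero summand is isomorphic to some bar, hence is nonzero at the point chosen in that bar.
  -- Countably many test points suffice.
  have h : {a | ¬ IsZero (F a)} ⊆ ⋃ b : ι, {a | dimVec (F a) (I b).2.1.some ≠ 0} := by
    intro a ha
    have := (hF a).resolve_left ha
    obtain ⟨b, ⟨e⟩⟩ := exists_iso_intervalModule D (E.inj a) (E.prj a) (E.inj_prj a)
    refine Set.mem_iUnion.2 ⟨b, ?_⟩
    change dimVec (F a) (I b).2.1.some ≠ 0
    rw [dimVec_congr e, dimVec_intervalModule, Set.indicator_of_mem (I b).2.1.some_mem]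
    exact one_ne_zero
  refine (Set.countable_iUnion fun b => ?_).mono h
  set p := (I b).2.1.some
  -- At a fixed point, countably many bars span a space of countable rank, while the summands that
  -- are nonzero there contribute linearly independent vectors.
  have hb : Module.rank K (M.obj p) ≤ Cardinal.aleph0 := by
    let one : ∀ a, (intervalModule K (I a)).obj p := fun a _ => 1
    have hs : ⊤ ≤ Submodule.span K (Set.range fun a => (D.inj a).app p (one a)) := by
      intro x _
      obtain ⟨s, hs⟩ := D.exists_sum p x
      rw [hs]
      refine Submodule.sum_mem _ fun a _ => ?_
      by_cases ha : p ∈ (I a).1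
      · have e : (D.prj a).app p x = (((D.prj a).app p x : PLift (p ∈ (I a).1) → K) ⟨ha⟩) •
            one a :=
          funext fun ⟨_⟩ => (mul_one _).symm
        rw [e, map_smul]
        exact Submodule.smul_mem _ _ (Submodule.subset_span ⟨a, rfl⟩)
      · have := intervalModule_subsingleton (K := K) ha
        rw [Subsingleton.elim ((D.prj a).app p x) 0, map_zero]
        exact Submodule.zero_mem _
    rw [← rank_top, ← top_le_iff.1 hs]
    refine (rank_span_le _).trans ?_
    rw [Cardinal.le_aleph0_iff_set_countable]
    exact Set.countable_range _
  have hne : ∀ a : {a | dimVec (F a) p ≠ 0}, ∃ x : (F a).obj p, x ≠ 0 := by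
    rintro ⟨a, ha⟩
    by_contra! h
    refine ha ?_
    have : Subsingleton ((F a).obj p) := ⟨fun x y => by rw [h x, h y]⟩
    exact edim_eq_zero
  choose x hx using hne
  have hli : LinearIndependent K fun a : {a | dimVec (F a) p ≠ 0} => (E.inj a).app p (x a) := by
    rw [linearIndependent_iff']
    intro s g hg a ha
    have h1 := congrArg ((E.prj a).app p) hg
    rw [map_sum, map_zero, Finset.sum_eq_single a, map_smul, E.prj_inj_apply] at h1
    · exact (smul_eq_zero.1 h1).resolve_right (hx a)
    · intro b _ hba
      rw [map_smul, E.prj_inj_apply_of_ne (fun h => hba (Subtype.ext h)), smul_zero]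
    · exact fun h => absurd ha h
  have := hli.cardinal_le_rank.trans hb
  exact Cardinal.le_aleph0_iff_set_countable.1 this

end Dimension

/-! ### Zigzags between interval modules, and the bounds d_μ ≤ W₁(d_μ) ≤ `barDist` -/

section Upper

variable {K : Type u} [Field K] {P : Type} [LinearOrder P] [MeasurableSpace P] {μ : Measure P}

lemma zigzagDist_intervalHom_le (hm : ∀ s : Set P, s.OrdConnected → MeasurableSet s)
    (X Y : PInterval P) (h : ∀ a b, a ≤ b → a ∈ X.1 → b ∈ Y.1 → (b ∈ X.1 ↔ a ∈ Y.1)) :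
    zigzagDist μ (intervalModule K X) (intervalModule K Y) ≤ μ (X.1 \ Y.1) + μ (Y.1 \ X.1) := by
  have hXY : MeasurableSet (X.1 \ Y.1) := (hm _ X.2.2).diff (hm _ Y.2.2)
  have hYX : MeasurableSet (Y.1 \ X.1) := (hm _ Y.2.2).diff (hm _ X.2.2)
  refine (zigzagDist_le_of_hom (intervalHom X Y h) ?_ ?_).trans ?_
  · rw [kerDim_intervalHom]
    exact (measurable_one.indicator hXY).aemeasurable
  · rw [cokerDim_intervalHom]
    exact (measurable_one.indicator hYX).aemeasurable
  · rw [kerDim_intervalHom, cokerDim_intervalHom, lintegral_indicator_one hXY,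
      lintegral_indicator_one hYX]

lemma zigzagDist_intervalModule_le_of_subset
    (hm : ∀ s : Set P, s.OrdConnected → MeasurableSet s) (X Y : PInterval P) (hXY : X.1 ⊆ Y.1) :
    zigzagDist μ (intervalModule K X) (intervalModule K Y) ≤ μ (Y.1 \ X.1) := by
  -- `Z` is the part of `Y` above some point of `X`. It is an up-set of `Y`, so its module is a
  -- submodule of that of `Y`; and `X` is a down-set of `Z`, so the module of `X` is a quotient of
  -- that of `Z`. The zigzag `X ← Z → Y` costs `Z \ X` and `Y \ Z`, which are disjoint.
  have hXZ : X.1 ⊆ {z ∈ Y.1 | ∃ x ∈ X.1, x ≤ z} := fun x hx => ⟨hXY hx, x, hx, le_rfl⟩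
  let Z : PInterval P := ⟨{z ∈ Y.1 | ∃ x ∈ X.1, x ≤ z}, X.2.1.mono hXZ, ⟨by
    rintro a ⟨ha, x, hx, hxa⟩ b ⟨hb, -⟩ c hc
    exact ⟨Y.2.2.out ha hb hc, x, hx, hxa.trans hc.1⟩⟩⟩
  have hZY : Z.1 ⊆ Y.1 := fun z hz => hz.1
  have h1 := zigzagDist_intervalHom_le (K := K) (μ := μ) hm Z X (by
    rintro a b hab ⟨_, x, hx, hxa⟩ hb
    exact ⟨fun _ => X.2.2.out hx hb ⟨hxa, hab⟩, fun _ => hXZ hb⟩)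
  have h2 := zigzagDist_intervalHom_le (K := K) (μ := μ) hm Z Y (by
    rintro a b hab ⟨ha, x, hx, hxa⟩ hb
    exact ⟨fun _ => ha, fun _ => ⟨hb, x, hx, hxa.trans hab⟩⟩)
  rw [Set.sdiff_eq_empty.2 hXZ, measure_empty, add_zero] at h1
  rw [Set.sdiff_eq_empty.2 hZY, measure_empty, zero_add] at h2
  refine (zigzagDist_triangle _ (intervalModule K Z) _).trans ?_
  rw [zigzagDist_comm]
  refine (add_le_add h1 h2).trans ?_
  rw [← measure_union]
  · refine measure_mono ?_
    rintro p (hp | hp)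
    · exact ⟨hZY hp.1, hp.2⟩
    · exact ⟨hp.1, fun h => hp.2 (hXZ h)⟩
  · exact Set.disjoint_left.2 fun p hp hp' => hp'.2 hp.1
  · exact (hm _ Y.2.2).diff (hm _ Z.2.2)

lemma zigzagDist_le_of_isZero {M Z : P ⥤ ModuleCat.{u} K} (hZ : IsZero Z)
    (hM : AEMeasurable (dimVec M) μ) : zigzagDist μ M Z ≤ ∫⁻ p, dimVec M p ∂μ := by
  have hZ' : ∀ p, Subsingleton (Z.obj p) := fun p =>
    ModuleCat.isZero_iff_subsingleton.1 (hZ.obj p)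
  have hk : kerDim (0 : M ⟶ Z) = dimVec M := funext fun p => by
    have : LinearMap.ker ((0 : M ⟶ Z).app p).hom = ⊤ := LinearMap.ker_eq_top.2 rfl
    unfold kerDim
    rw [this, edim_congr Submodule.topEquiv]
    rfl
  have hc : cokerDim (0 : M ⟶ Z) = fun _ => 0 := funext fun p =>
    cokerDim_eq_zero _ _ fun y => ⟨0, Subsingleton.elim _ _⟩
  refine (zigzagDist_le_of_hom 0 ?_ ?_).trans ?_
  · rwa [hk]
  · rw [hc]; exact aemeasurable_const
  · simp [hk, hc]

lemma measurable_dimVec_intervalModule (hm : ∀ s : Set P, s.OrdConnected → MeasurableSet s)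
    (I : PInterval P) : Measurable (dimVec (intervalModule K I)) := by
  rw [funext (dimVec_intervalModule I)]
  exact measurable_one.indicator (hm _ I.2.2)

lemma lintegral_dimVec_intervalModule (hm : ∀ s : Set P, s.OrdConnected → MeasurableSet s)
    (I : PInterval P) : ∫⁻ p, dimVec (intervalModule K I) p ∂μ = μ I.1 := by
  rw [funext (dimVec_intervalModule I), lintegral_indicator_one (hm _ I.2.2)]

lemma zigzagDist_intervalModule_le_of_isZero
    (hm : ∀ s : Set P, s.OrdConnected → MeasurableSet s) (I : PInterval P)
    {Z : P ⥤ ModuleCat.{u} K} (hZ : IsZero Z) :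
    zigzagDist μ (intervalModule K I) Z ≤ μ I.1 := by
  refine (zigzagDist_le_of_isZero hZ (measurable_dimVec_intervalModule hm I).aemeasurable).trans ?_
  rw [lintegral_dimVec_intervalModule hm]

/-- The zigzag passes through the module of `I ∩ J`, or through zero if the intervals are disjoint.
-/
lemma zigzagDist_intervalModule_le (hm : ∀ s : Set P, s.OrdConnected → MeasurableSet s)
    (I J : PInterval P) :
    zigzagDist μ (intervalModule K I) (intervalModule K J) ≤ μ (symmDiff I.1 J.1) := by
  have hd : μ (symmDiff I.1 J.1) = μ (I.1 \ J.1) + μ (J.1 \ I.1) :=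
    measure_symmDiff_eq (hm _ I.2.2).nullMeasurableSet (hm _ J.2.2).nullMeasurableSet
  rw [hd]
  by_cases h : (I.1 ∩ J.1).Nonempty
  · let L : PInterval P := ⟨I.1 ∩ J.1, h, I.2.2.inter J.2.2⟩
    refine (zigzagDist_triangle _ (intervalModule K L) _).trans ?_
    rw [zigzagDist_comm]
    refine add_le_add ((zigzagDist_intervalModule_le_of_subset hm L I Set.inter_subset_left).trans
      (le_of_eq ?_)) ((zigzagDist_intervalModule_le_of_subset hm L J
        Set.inter_subset_right).trans (le_of_eq ?_))
    · exact congrArg μ Set.sdiff_self_inter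
    · exact congrArg μ ((congrArg (J.1 \ ·) (Set.inter_comm _ _)).trans Set.sdiff_self_inter)
  · have hdis : Disjoint I.1 J.1 :=
      Set.disjoint_iff_inter_eq_empty.2 (Set.not_nonempty_iff_eq_empty.1 h)
    rw [hdis.sdiff_eq_left, hdis.sdiff_eq_right]
    refine (zigzagDist_triangle _ (listSum []) _).trans ?_
    rw [zigzagDist_comm (listSum [])]
    exact add_le_add (zigzagDist_intervalModule_le_of_isZero hm I isZero_listSum_nil)
      (zigzagDist_intervalModule_le_of_isZero hm J isZero_listSum_nil)

variable {ι : Type v} {κ : Type w}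

/-- The optimal cost of a matching of two families of intervals with respect to the measure of the
symmetric difference. -/
def barDist (μ : Measure P) (I : ι → PInterval P) (J : κ → PInterval P) : ℝ≥0∞ :=
  matchDist (fun a b => μ (symmDiff (I a).1 (J b).1)) (fun a => μ (I a).1) fun b => μ (J b).1

/-- A partial matching is a pair of decompositions over `ι ⊕ κ`: the index `a : ι` pairs `I a` with
its partner or with zero, and `b : κ` pairs zero with `J b` if `b` is unmatched and with zero
otherwise. -/
lemma wasserstein₁_le_barDist [Countable ι] [Countable κ]
    (hm : ∀ s : Set P, s.OrdConnected → MeasurableSet s)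
    {I : ι → PInterval P} {J : κ → PInterval P} {M N : P ⥤ ModuleCat.{u} K}
    (D : DirectSumData (fun a => intervalModule K (I a)) M)
    (E : DirectSumData (fun b => intervalModule K (J b)) N) :
    wasserstein₁ (zigzagDist μ) M N ≤ barDist μ I J := by
  refine le_iInf fun f => ?_
  -- The infimum ranges over index types in `Type u`; a countable type has a model there.
  let σ := equivShrink.{u} (ι ⊕ κ)
  let F : ι ⊕ κ → P ⥤ ModuleCat.{u} K :=
    Sum.elim (fun a => intervalModule K (I a)) fun _ => listSum []
  let G : ι ⊕ κ → P ⥤ ModuleCat.{u} K :=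
    Sum.elim (fun a => (f a).elim (listSum []) fun b => intervalModule K (J b))
      fun b => (f.symm b).elim (intervalModule K (J b)) fun _ => listSum []
  -- `e b` is the index at which `J b` occurs in `G`: that of its partner, if it has one.
  let e : κ → ι ⊕ κ := fun b => (f.symm b).elim (Sum.inr b) Sum.inl
  have he : ∀ b, G (e b) = intervalModule K (J b) := by
    intro b
    rcases hb : f.symm b with _ | a
    · simp [e, G, hb]
    · have : f a = some b := f.eq_some_iff.1 hb
      simp [e, G, hb, this]
  have hei : Function.Injective e := by
    intro b b' h
    rcases hb : f.symm b with _ | a <;> rcases hb' : f.symm b' with _ | a' <;>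
      simp only [e, hb, hb', Option.elim_none, Option.elim_some, Sum.inr.injEq, Sum.inl.injEq,
        reduceCtorEq] at h
    · exact h
    · subst h
      have h1 := f.eq_some_iff.1 hb
      rw [f.eq_some_iff.1 hb'] at h1
      exact (Option.some.inj h1).symm
  have D' : DirectSumData (F ∘ σ.symm) M := by
    refine D.extend _ (σ ∘ Sum.inl) (σ.injective.comp Sum.inl_injective)
      (fun a => eqToIso (by simp [F])) ?_
    intro b hb
    obtain ⟨b, rfl⟩ := σ.surjective b
    rcases b with a | b
    · exact absurd ⟨a, rfl⟩ hb
    · simpa [F] using isZero_listSum_nil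
  have E' : DirectSumData (G ∘ σ.symm) N := by
    refine E.extend _ (σ ∘ e) (σ.injective.comp hei)
      (fun a => eqToIso (by simp [he])) ?_
    intro b hb
    obtain ⟨b, rfl⟩ := σ.surjective b
    rcases b with a | b
    · rcases ha : f a with _ | b
      · simpa [G, ha] using isZero_listSum_nil
      · refine absurd ⟨b, ?_⟩ hb
        simp [e, f.eq_some_iff.2 ha]
    · rcases hb' : f.symm b with _ | a
      · refine absurd ⟨b, ?_⟩ hb
        simp [e, hb']
      · simpa [G, hb'] using isZero_listSum_nil
  have hloc : ∀ X : P ⥤ ModuleCat.{u} K, (X = listSum [] ∨ ∃ L, X = intervalModule K L) →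
      IsZero X ∨ IsLocalRing (End X) := by
    rintro X (rfl | ⟨L, rfl⟩)
    · exact Or.inl isZero_listSum_nil
    · exact Or.inr inferInstance
  have hF : ∀ x, F x = listSum [] ∨ ∃ L, F x = intervalModule K L := by
    rintro (a | b)
    · exact Or.inr ⟨_, rfl⟩
    · exact Or.inl rfl
  have hG : ∀ x, G x = listSum [] ∨ ∃ L, G x = intervalModule K L := by
    rintro (a | b)
    · rcases ha : f a with _ | b
      · exact Or.inl (by simp [G, ha])
      · exact Or.inr ⟨J b, by simp [G, ha]⟩
    · rcases hb : f.symm b with _ | a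
      · exact Or.inr ⟨J b, by simp [G, hb]⟩
      · exact Or.inl (by simp [G, hb])
  unfold wasserstein₁
  refine iInf_le_of_le (Shrink.{u} (ι ⊕ κ)) (iInf_le_of_le (F ∘ σ.symm)
    (iInf_le_of_le (G ∘ σ.symm) (iInf₂_le_of_le D'.isCoproductOf E'.isCoproductOf
      (iInf₂_le_of_le (fun _ => hloc _ (hF _)) (fun _ => hloc _ (hG _)) ?_))))
  rw [← σ.tsum_eq]
  simp only [Function.comp_apply, Equiv.symm_apply_apply]
  rw [ENNReal.summable.tsum_sum ENNReal.summable]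
  refine add_le_add (ENNReal.tsum_le_tsum fun a => ?_) (ENNReal.tsum_le_tsum fun b => ?_)
  · rcases ha : f a with _ | b
    · simpa [F, G, ha] using zigzagDist_intervalModule_le_of_isZero hm (I a) isZero_listSum_nil
    · simpa [F, G, ha] using zigzagDist_intervalModule_le hm (I a) (J b)
  · rw [zigzagDist_comm]
    rcases hb : f.symm b with _ | a
    · simpa [F, G, hb] using zigzagDist_intervalModule_le_of_isZero hm (J b) isZero_listSum_nil
    · simp [F, G, hb, zigzagDist_self]

lemma aemeasurable_dimVec_of_summand (hm : ∀ s : Set P, s.OrdConnected → MeasurableSet s)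
    {I : ι → PInterval P} {M X : P ⥤ ModuleCat.{u} K}
    (D : DirectSumData (fun a => intervalModule K (I a)) M) (s : X ⟶ M) (r : M ⟶ X)
    (hsr : s ≫ r = 𝟙 X) (h : IsZero X ∨ IsLocalRing (End X)) : AEMeasurable (dimVec X) μ := by
  rcases h with h | h
  · rw [dimVec_eq_zero_of_isZero h]; exact aemeasurable_const
  · obtain ⟨a, ⟨e⟩⟩ := exists_iso_intervalModule D s r hsr
    rw [dimVec_congr e]
    exact (measurable_dimVec_intervalModule hm _).aemeasurable

/-- Discarding the indices where both summands vanish leaves a countable family of modules with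
measurable dimensions, to which countable subadditivity applies. -/
lemma zigzagDist_le_wasserstein₁ [Countable ι] [Countable κ]
    (hm : ∀ s : Set P, s.OrdConnected → MeasurableSet s)
    {I : ι → PInterval P} {J : κ → PInterval P} {M N : P ⥤ ModuleCat.{u} K}
    (D : DirectSumData (fun a => intervalModule K (I a)) M)
    (E : DirectSumData (fun b => intervalModule K (J b)) N)
    (hM : HasFiniteTotalPersistence μ M) (hN : HasFiniteTotalPersistence μ N) :
    zigzagDist μ M N ≤ wasserstein₁ (zigzagDist μ) M N := by
  refine le_iInf fun A => le_iInf fun F => le_iInf fun G => le_iInf₂ fun cF cG =>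
    le_iInf₂ fun hF hG => ?_
  obtain ⟨DF⟩ := cF.directSumData
  obtain ⟨DG⟩ := cG.directSumData
  let s : Set A := {a | ¬ IsZero (F a)} ∪ {a | ¬ IsZero (G a)}
  have hs : Countable s :=
    ((countable_not_isZero D DF hF).union (countable_not_isZero E DG hG)).to_subtype
  refine (zigzagDist_le_tsum (DF.restrict s fun a ha => not_not.1 fun h => ha (Or.inl h))
    (DG.restrict s fun a ha => not_not.1 fun h => ha (Or.inr h)) ?_ ?_ hM hN).trans ?_
  · exact fun a => aemeasurable_dimVec_of_summand hm D _ _ (DF.inj_prj a) (hF a)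
  · exact fun a => aemeasurable_dimVec_of_summand hm E _ _ (DG.inj_prj a) (hG a)
  · exact ENNReal.tsum_comp_le_tsum_of_injective Subtype.val_injective
      fun a => zigzagDist μ (F a) (G a)

end Upper

end PersMod

end
noncomputable section

namespace PersMod

/-! ### Flows and matchings -/

section Flow

variable {X : Type*} (d : X → X → ℝ≥0∞)

/-- The total length of a multiset of edges. -/
def edgeCost (E : Multiset (X × X)) : ℝ≥0∞ := (E.map fun e => d e.1 e.2).sum

/-- If `s - t` is the boundary of a multiset of edges, then there is a matching of `s` and `t` of at
most the same cost. -/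
lemma exists_matching_of_boundary (h0 : ∀ x, d x x = 0) (htri : ∀ x y z, d x z ≤ d x y + d y z)
    (E : Multiset (X × X)) : ∀ s t : Multiset X, s + E.map Prod.snd = t + E.map Prod.fst →
    ∃ T : Multiset (X × X), T.map Prod.fst = s ∧ T.map Prod.snd = t ∧
      edgeCost d T ≤ edgeCost d E := by
  classical
  induction E using Multiset.induction_on with
  | empty =>
    intro s t h
    refine ⟨s.map fun x => (x, x), by simp, by simpa using h, ?_⟩
    simp [edgeCost, h0]
  | cons e E ih =>
    obtain ⟨x, y⟩ := e
    intro s t h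
    -- Removing the edge `(x, y)` turns `y` into an additional source and `x` into an additional
    -- target.
    obtain ⟨T', h1, h2, h3⟩ := ih (y ::ₘ s) (x ::ₘ t) (by simpa using h)
    have hy : y ∈ T'.map Prod.fst := by rw [h1]; simp
    obtain ⟨⟨y', z⟩, hT1, rfl⟩ := Multiset.mem_map.1 hy
    obtain ⟨T1, rfl⟩ := Multiset.exists_cons_of_mem hT1
    simp only [Multiset.map_cons, Multiset.cons_inj_right] at h1
    simp only [Multiset.map_cons, Multiset.cons_eq_cons] at h2
    have hE : edgeCost d ((x, y') ::ₘ E) = d x y' + edgeCost d E := by simp [edgeCost]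
    have h3' : d y' z + edgeCost d T1 ≤ edgeCost d E := by simpa [edgeCost] using h3
    rw [hE]
    -- If `y` is matched to `x`, that pair is dropped. Otherwise the pairs that use `y` and `x` are
    -- spliced through the removed edge into one pair, which the triangle inequality pays for.
    rcases h2 with ⟨rfl, h2⟩ | ⟨_, cs, h2, h4⟩
    · exact ⟨T1, h1, h2, le_add_left (le_trans (le_add_left le_rfl) h3')⟩
    · have hx : x ∈ T1.map Prod.snd := by rw [h2]; simp
      obtain ⟨⟨z', x'⟩, hT2, rfl⟩ := Multiset.mem_map.1 hx
      obtain ⟨T2, rfl⟩ := Multiset.exists_cons_of_mem hT2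
      simp only [Multiset.map_cons, Multiset.cons_inj_right] at h2
      refine ⟨(z', z) ::ₘ T2, by simpa using h1, by simp [h2, h4], ?_⟩
      have hT : edgeCost d ((z', z) ::ₘ T2) = d z' z + edgeCost d T2 := by simp [edgeCost]
      have hT' : edgeCost d ((z', x') ::ₘ T2) = d z' x' + edgeCost d T2 := by simp [edgeCost]
      rw [hT]
      calc d z' z + edgeCost d T2 ≤ (d z' x' + (d x' y' + d y' z)) + edgeCost d T2 := by
            gcongr
            exact (htri _ x' _).trans (add_le_add le_rfl (htri _ y' _))
        _ = d x' y' + (d y' z + edgeCost d ((z', x') ::ₘ T2)) := by rw [hT']; ring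
        _ ≤ _ := by gcongr

variable (o : X)

/-- The functional `L` is, modulo the base point, the boundary of a multiset of edges of total
length at most `C`. -/
def IsFlow (L : (X → ℤ) → ℤ) (C : ℝ≥0∞) : Prop :=
  ∃ E : Multiset (X × X), edgeCost d E ≤ C ∧
    ∀ φ : X → ℤ, φ o = 0 → L φ = (E.map fun e => φ e.1 - φ e.2).sum

variable {d o}

lemma IsFlow.of_eq {L L' : (X → ℤ) → ℤ} {C C' : ℝ≥0∞} (h : IsFlow d o L C)
    (hL : ∀ φ : X → ℤ, φ o = 0 → L' φ = L φ) (hC : C ≤ C') : IsFlow d o L' C' := by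
  obtain ⟨E, hE, h⟩ := h
  exact ⟨E, hE.trans hC, fun φ hφ => (hL φ hφ).trans (h φ hφ)⟩

lemma IsFlow.zero : IsFlow d o (fun _ => 0) 0 := ⟨0, by simp [edgeCost], fun _ _ => by simp⟩

lemma IsFlow.add {L L' : (X → ℤ) → ℤ} {C C' : ℝ≥0∞} (h : IsFlow d o L C)
    (h' : IsFlow d o L' C') : IsFlow d o (fun φ => L φ + L' φ) (C + C') := by
  obtain ⟨E, hE, h⟩ := h
  obtain ⟨E', hE', h'⟩ := h'
  refine ⟨E + E', ?_, fun φ hφ => ?_⟩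
  · simpa [edgeCost] using add_le_add hE hE'
  · simp [h φ hφ, h' φ hφ]

lemma IsFlow.sum {ι : Type*} (s : Finset ι) {L : ι → (X → ℤ) → ℤ} {C : ι → ℝ≥0∞}
    (h : ∀ i ∈ s, IsFlow d o (L i) (C i)) :
    IsFlow d o (fun φ => ∑ i ∈ s, L i φ) (∑ i ∈ s, C i) := by
  classical
  induction s using Finset.induction_on with
  | empty => simpa using IsFlow.zero
  | insert a s ha ih =>
    simp only [Finset.sum_insert ha]
    exact (h a (by simp)).add (ih fun i hi => h i (by simp [hi]))

lemma IsFlow.nsmul {L : (X → ℤ) → ℤ} {C : ℝ≥0∞} (h : IsFlow d o L C) (n : ℕ) :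
    IsFlow d o (fun φ => n * L φ) (n * C) := by
  have := IsFlow.sum (Finset.range n) fun _ _ => h
  simpa using this

lemma IsFlow.edge (x y : X) : IsFlow d o (fun φ => φ x - φ y) (d x y) :=
  ⟨{(x, y)}, by simp [edgeCost], fun φ _ => by simp⟩

lemma IsFlow.neg (hsymm : ∀ x y, d x y = d y x) {L : (X → ℤ) → ℤ} {C : ℝ≥0∞}
    (h : IsFlow d o L C) : IsFlow d o (fun φ => - L φ) C := by
  obtain ⟨E, hE, h⟩ := h
  refine ⟨E.map Prod.swap, ?_, fun φ hφ => ?_⟩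
  · simpa [edgeCost, hsymm] using hE
  · simp only [h φ hφ, Multiset.map_map]
    rw [← Multiset.sum_map_neg]
    simp

/-- Testing the flow on the indicator of each `z ≠ o` compares the multiplicities away from the base
point. -/
lemma IsFlow.exists_matching (h0 : ∀ x, d x x = 0) (htri : ∀ x y z, d x z ≤ d x y + d y z)
    {s t : Multiset X} {C : ℝ≥0∞}
    (h : IsFlow d o (fun φ => (s.map φ).sum - (t.map φ).sum) C) :
    ∃ (k l : ℕ) (T : Multiset (X × X)), T.map Prod.fst = s + Multiset.replicate k o ∧
      T.map Prod.snd = t + Multiset.replicate l o ∧ edgeCost d T ≤ C := by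
  classical
  obtain ⟨E, hE, h⟩ := h
  -- Each side receives as many copies of `o` as the other side already contains, so the
  -- multiplicities of `o` agree as well.
  obtain ⟨T, h1, h2, h3⟩ := exists_matching_of_boundary d h0 htri E
    (s + Multiset.replicate ((t + E.map Prod.fst).count o) o)
    (t + Multiset.replicate ((s + E.map Prod.snd).count o) o) (by
      ext z
      by_cases hz : z = o
      · subst hz
        simp only [Multiset.count_add, Multiset.count_replicate_self]
        ring
      · have hc : ∀ m : Multiset X, ((m.map fun x => if x = z then (1 : ℤ) else 0)).sum =
            m.count z := by
          intro m
          induction m using Multiset.induction_on with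
          | empty => simp
          | cons a m ih =>
            rw [Multiset.map_cons, Multiset.sum_cons, ih, Multiset.count_cons]
            by_cases haz : a = z
            · simp [haz, add_comm]
            · simp [haz, Ne.symm haz]
        have := h (fun x => if x = z then (1 : ℤ) else 0) (if_neg (Ne.symm hz))
        rw [Multiset.sum_map_sub] at this
        have e1 := hc (E.map Prod.fst)
        have e2 := hc (E.map Prod.snd)
        rw [Multiset.map_map] at e1 e2
        simp only [Function.comp_def] at e1 e2
        simp only [hc, e1, e2] at this
        simp only [Multiset.count_add, Multiset.count_replicate, if_neg (Ne.symm hz)]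
        omega)
  exact ⟨_, _, T, h1, h2, h3.trans hE⟩

lemma exists_equiv_of_map_eq {α β : Type*} [Fintype α] [Fintype β] (f : α → X) (g : β → X)
    (h : (Finset.univ : Finset α).val.map f = (Finset.univ : Finset β).val.map g) :
    ∃ e : α ≃ β, ∀ a, g (e a) = f a := by
  classical
  have hc : ∀ x, Fintype.card {a // f a = x} = Fintype.card {b // g b = x} := by
    intro x
    have := congrArg (Multiset.count x) h
    rw [Multiset.count_map, Multiset.count_map] at this
    rw [Fintype.card_subtype, Fintype.card_subtype]
    simpa [Finset.card, eq_comm] using this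
  let e : ∀ x, {a // f a = x} ≃ {b // g b = x} := fun x => Fintype.equivOfCardEq (hc x)
  refine ⟨(Equiv.sigmaFiberEquiv f).symm.trans ((Equiv.sigmaCongrRight e).trans
    (Equiv.sigmaFiberEquiv g)), fun a => ?_⟩
  exact (e (f a) ⟨a, rfl⟩).2

lemma map_coe_eq_map_univ {Y Z : Type*} (T : List Y) (g : Y → Z) : (T : Multiset Y).map g =
    (Finset.univ : Finset (Fin T.length)).val.map fun i => g (T.get i) := by
  rw [Fin.univ_val_map, Multiset.map_coe]
  congr 1
  conv_lhs => rw [← List.ofFn_get T, List.map_ofFn]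
  rfl

lemma map_univ_sumElim {ι : Type*} (S : Finset ι) (x : ι → X) (o : X) (k : ℕ) :
    (Finset.univ : Finset (S ⊕ Fin k)).val.map (Sum.elim (fun a : S => x a) fun _ => o) =
      S.val.map x + Multiset.replicate k o := by
  rw [← Finset.univ_disjSum_univ, Finset.val_disjSum, Multiset.disjSum, Multiset.map_add,
    Multiset.map_map, Multiset.map_map]
  congr 1
  · exact Multiset.attach_map_val' S.val x
  · rw [Multiset.eq_replicate]
    refine ⟨by simp, fun b hb => ?_⟩
    obtain ⟨_, _, rfl⟩ := Multiset.mem_map.1 hb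
    rfl

lemma tsum_eq_sum_add_tsum_notMem {α : Type*} (R : Finset α) (g : α → ℝ≥0∞) :
    ∑' a, g a = ∑ a : R, g a + ∑' a : {a // a ∉ R}, g a := by
  rw [Finset.univ_eq_attach, Finset.sum_attach R g, ← Finset.tsum_subtype R g]
  exact (Summable.tsum_add_tsum_compl (f := g) (s := {a | a ∈ R})
    ENNReal.summable ENNReal.summable).symm

/-- Elements paired with a copy of the base point become unmatched, and so do all elements outside
`S` and `U`, whose costs appear separately. -/
lemma matchDist_le_of_isFlow {ι : Type v} {κ : Type w} (h0 : ∀ x, d x x = 0)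
    (htri : ∀ x y z, d x z ≤ d x y + d y z) (S : Finset ι) (U : Finset κ) (x : ι → X) (y : κ → X)
    (c : ι → κ → ℝ≥0∞) (u : ι → ℝ≥0∞) (v : κ → ℝ≥0∞) (hc : ∀ a ∈ S, ∀ b ∈ U, c a b ≤ d (x a) (y b))
    (hu : ∀ a ∈ S, u a ≤ d (x a) o) (hv : ∀ b ∈ U, v b ≤ d o (y b)) {C : ℝ≥0∞}
    (h : IsFlow d o (fun φ => ∑ a ∈ S, φ (x a) - ∑ b ∈ U, φ (y b)) C) :
    matchDist c u v ≤ C + ∑' a : {a // a ∉ S}, u a + ∑' b : {b // b ∉ U}, v b := by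
  classical
  have h' : IsFlow d o (fun φ => ((S.val.map x).map φ).sum - ((U.val.map y).map φ).sum) C :=
    h.of_eq (fun φ _ => by simp only [Multiset.map_map]; rfl) le_rfl
  obtain ⟨k, l, T, h1, h2, h3⟩ := h'.exists_matching h0 htri
  let xx : S ⊕ Fin k → X := Sum.elim (fun a => x a) fun _ => o
  let yy : U ⊕ Fin l → X := Sum.elim (fun b => y b) fun _ => o
  -- The positions in the list `T` are in bijection with both padded index sets; composing the two
  -- bijections gives `e`.
  obtain ⟨e, he⟩ : ∃ e : S ⊕ Fin k ≃ U ⊕ Fin l, ∑ z, d (xx z) (yy (e z)) ≤ C := by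
    obtain ⟨T, rfl⟩ : ∃ T' : List (X × X), T = T' := ⟨T.toList, T.coe_toList.symm⟩
    rw [← map_univ_sumElim, map_coe_eq_map_univ] at h1 h2
    obtain ⟨e₁, he₁⟩ := exists_equiv_of_map_eq _ _ h1
    obtain ⟨e₂, he₂⟩ := exists_equiv_of_map_eq _ _ h2
    refine ⟨e₁.symm.trans e₂, le_trans (le_of_eq ?_) h3⟩
    rw [edgeCost, map_coe_eq_map_univ]
    change _ = ∑ i : Fin T.length, d (T.get i).1 (T.get i).2
    rw [← e₁.sum_comp]
    refine Finset.sum_congr rfl fun i _ => ?_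
    rw [Equiv.trans_apply, Equiv.symm_apply_apply]
    exact congrArg₂ d (he₁ i) (he₂ i)
  let f : ι ≃. κ :=
    { toFun := fun a => if h : a ∈ S then (e (Sum.inl ⟨a, h⟩)).elim (fun b => some b.1)
        fun _ => none else none
      invFun := fun b => if h : b ∈ U then (e.symm (Sum.inl ⟨b, h⟩)).elim (fun a => some a.1)
        fun _ => none else none
      inv := fun a b => by
        constructor
        · intro hab
          split_ifs at hab with hb
          rcases hz : e.symm (Sum.inl ⟨b, hb⟩) with ⟨a', ha'⟩ | _
          · rw [hz] at hab
            obtain rfl : a' = a := Option.some.inj hab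
            have : e (Sum.inl ⟨a', ha'⟩) = Sum.inl ⟨b, hb⟩ := by rw [← hz, e.apply_symm_apply]
            simp [ha', this]
          · rw [hz] at hab; cases hab
        · intro hab
          split_ifs at hab with ha
          rcases hz : e (Sum.inl ⟨a, ha⟩) with ⟨b', hb'⟩ | _
          · rw [hz] at hab
            obtain rfl : b' = b := Option.some.inj hab
            have : e.symm (Sum.inl ⟨b', hb'⟩) = Sum.inl ⟨a, ha⟩ := by
              rw [← hz, e.symm_apply_apply]
            simp [hb', this]
          · rw [hz] at hab; cases hab }
  refine (iInf_le _ f).trans ?_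
  have hx : ∀ a : S, (f a).elim (u a) (c a) ≤ d (xx (Sum.inl a)) (yy (e (Sum.inl a))) := by
    rintro ⟨a, ha⟩
    have hf : f a = (e (Sum.inl ⟨a, ha⟩)).elim (fun b => some b.1) fun _ => none := dif_pos ha
    simp only [hf]
    rcases e (Sum.inl ⟨a, ha⟩) with ⟨b, hb⟩ | i
    · exact hc a ha b hb
    · exact hu a ha
  have hx' : ∀ a : {a // a ∉ S}, (f a).elim (u a) (c a) = u a := by
    rintro ⟨a, ha⟩
    have hf : f a = none := dif_neg ha
    simp [hf]
  -- `g` charges an element of `U` only if its partner is a copy of the base point, so its sum is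
  -- bounded by the cost of the pairs that start at such a copy.
  let g : U ⊕ Fin l → ℝ≥0∞ := fun z => (e.symm z).elim (fun _ => 0) fun _ => d o (yy z)
  have hy : ∀ b : U, (f.symm b).elim (v b) (fun _ => 0) ≤ g (Sum.inl b) := by
    rintro ⟨b, hb⟩
    have hf : f.symm b = (e.symm (Sum.inl ⟨b, hb⟩)).elim (fun a => some a.1) fun _ => none :=
      dif_pos hb
    simp only [hf, g]
    rcases e.symm (Sum.inl ⟨b, hb⟩) with ⟨a, ha⟩ | i
    · exact zero_le
    · exact hv b hb
  have hy' : ∀ b : {b // b ∉ U}, (f.symm b).elim (v b) (fun _ => 0) = v b := by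
    rintro ⟨b, hb⟩
    have hf : f.symm b = none := dif_neg hb
    simp [hf]
  have hg : ∑ b : U, g (Sum.inl b) ≤ ∑ i, d o (yy (e (Sum.inr i))) := by
    calc ∑ b : U, g (Sum.inl b) ≤ ∑ z, g z := by
          rw [Fintype.sum_sum_type]; exact le_self_add
      _ = ∑ z, g (e z) := (e.sum_comp g).symm
      _ = _ := by
          rw [Fintype.sum_sum_type]
          simp [g]
  rw [Fintype.sum_sum_type] at he
  rw [matchCost, tsum_eq_sum_add_tsum_notMem S, tsum_eq_sum_add_tsum_notMem U, tsum_congr hx',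
    tsum_congr hy']
  refine le_trans (add_le_add (add_le_add_left (Finset.sum_le_sum fun a _ => hx a) _)
    (add_le_add_left ((Finset.sum_le_sum fun b _ => hy b).trans hg) _)) ?_
  calc _ = (∑ a : S, d (xx (Sum.inl a)) (yy (e (Sum.inl a))) +
        ∑ i, d o (yy (e (Sum.inr i)))) + ∑' a : {a // a ∉ S}, u a + ∑' b : {b // b ∉ U}, v b := by
        ring
    _ ≤ _ := by gcongr; exact he

end Flow

end PersMod

end
noncomputable section

namespace PersMod

/-! ### Summation by parts for rank functions -/

section RankFunction

/-- The weight of the symmetric difference of two finite sets of natural numbers. -/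
def wDist (w : ℕ → ℝ≥0∞) (A B : Finset ℕ) : ℝ≥0∞ := ∑ k ∈ symmDiff A B, w k

lemma wDist_self (w : ℕ → ℝ≥0∞) (A : Finset ℕ) : wDist w A A = 0 := by simp [wDist]

lemma wDist_comm (w : ℕ → ℝ≥0∞) (A B : Finset ℕ) : wDist w A B = wDist w B A := by
  rw [wDist, wDist, symmDiff_comm]

lemma wDist_triangle (w : ℕ → ℝ≥0∞) (A B C : Finset ℕ) :
    wDist w A C ≤ wDist w A B + wDist w B C := by
  refine (Finset.sum_le_sum_of_subset (symmDiff_triangle A B C)).trans ?_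
  rw [Finset.sup_eq_union, wDist, wDist, ← Finset.sum_union_inter]
  exact le_self_add

lemma wDist_Icc_succ_left (w : ℕ → ℝ≥0∞) {i j : ℕ} (h : i ≤ j) :
    wDist w (Finset.Icc i j) (Finset.Icc (i + 1) j) = w i := by
  have : symmDiff (Finset.Icc i j) (Finset.Icc (i + 1) j) = {i} := by
    ext k
    simp only [Finset.mem_symmDiff, Finset.mem_Icc, Finset.mem_singleton]
    omega
  rw [wDist, this, Finset.sum_singleton]

lemma wDist_Icc_pred_right (w : ℕ → ℝ≥0∞) {i j : ℕ} (hi : 1 ≤ i) (h : i ≤ j) :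
    wDist w (Finset.Icc i j) (Finset.Icc i (j - 1)) = w j := by
  have : symmDiff (Finset.Icc i j) (Finset.Icc i (j - 1)) = {j} := by
    ext k
    simp only [Finset.mem_symmDiff, Finset.mem_Icc, Finset.mem_singleton]
    omega
  rw [wDist, this, Finset.sum_singleton]

/-- The signed barcode of the rank function `r` of a module on `{1, …, n}`, as a functional on
functions of intervals. -/
def rankSum (n : ℕ) (r : ℕ → ℕ → ℤ) (φ : Finset ℕ → ℤ) : ℤ :=
  ∑ i ∈ Finset.Icc 1 n, ∑ j ∈ Finset.Icc 1 n,
    (r i j - r (i - 1) j - r i (j + 1) + r (i - 1) (j + 1)) * φ (Finset.Icc i j)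

lemma sum_by_parts_left (D φ : ℕ → ℤ) (n : ℕ) :
    ∑ i ∈ Finset.Icc 1 n, (D i - D (i - 1)) * φ i =
      ∑ i ∈ Finset.Icc 1 n, D i * (φ i - φ (i + 1)) + D n * φ (n + 1) - D 0 * φ 1 := by
  induction n with
  | zero => simp
  | succ n ih =>
    rw [Finset.sum_Icc_succ_top (by omega), Finset.sum_Icc_succ_top (by omega), ih,
      Nat.add_sub_cancel]
    ring

lemma sum_by_parts_right (G φ : ℕ → ℤ) (n : ℕ) :
    ∑ j ∈ Finset.Icc 1 n, (G j - G (j + 1)) * φ j =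
      ∑ j ∈ Finset.Icc 1 n, G j * (φ j - φ (j - 1)) + G 1 * φ 0 - G (n + 1) * φ n := by
  induction n with
  | zero => simp
  | succ n ih =>
    rw [Finset.sum_Icc_succ_top (by omega), Finset.sum_Icc_succ_top (by omega), ih,
      Nat.add_sub_cancel]
    ring

lemma sum_Icc_sub_succ (g : ℕ → ℤ) {i n : ℕ} (h : i ≤ n) :
    ∑ j ∈ Finset.Icc i n, (g j - g (j + 1)) = g i - g (n + 1) := by
  induction n, h using Nat.le_induction with
  | base => simp
  | succ n h ih =>
    rw [Finset.sum_Icc_succ_top (by omega), ih]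
    ring

lemma sum_Icc_sub_pred (g : ℕ → ℤ) (n : ℕ) :
    ∑ j ∈ Finset.Icc 1 n, (g j - g (j - 1)) = g n - g 0 := by
  induction n with
  | zero => simp
  | succ n ih =>
    rw [Finset.sum_Icc_succ_top (by omega), ih, Nat.add_sub_cancel]
    ring

lemma sum_toNat {α : Type*} (s : Finset α) (f : α → ℤ) (h : ∀ a ∈ s, 0 ≤ f a) :
    ∑ a ∈ s, ((f a).toNat : ℝ≥0∞) = ((∑ a ∈ s, f a).toNat : ℝ≥0∞) := by
  rw [← Nat.cast_sum]
  congr 1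
  zify
  rw [Int.toNat_of_nonneg (Finset.sum_nonneg h)]
  exact Finset.sum_congr rfl fun a ha => Int.toNat_of_nonneg (h a ha)

lemma isFlow_toNat {w : ℕ → ℝ≥0∞} {D : ℤ} (hD : 0 ≤ D) (A B : Finset ℕ) :
    IsFlow (wDist w) ∅ (fun φ => D * (φ A - φ B)) (D.toNat * wDist w A B) :=
  ((IsFlow.edge A B).nsmul D.toNat).of_eq
    (fun φ _ => by rw [Int.toNat_of_nonneg hD]) le_rfl

/-- Moving the left end points of bars. -/
lemma isFlow_rankSum_left (w : ℕ → ℝ≥0∞) (n : ℕ) (r r' : ℕ → ℕ → ℤ) (h0 : ∀ j, r 0 j = 0)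
    (h0' : ∀ j, r' 0 j = 0) (hn : ∀ i, r i (n + 1) = 0) (hn' : ∀ i, r' i (n + 1) = 0)
    (h : ∀ i j, 1 ≤ i → i ≤ j → j ≤ n → r' i j - r' i (j + 1) ≤ r i j - r i (j + 1)) :
    IsFlow (wDist w) ∅ (fun φ => rankSum n r φ - rankSum n r' φ)
      (∑ i ∈ Finset.Icc 1 n, w i * (r i i - r' i i).toNat) := by
  -- `r i j - r i (j + 1)` counts, with sign, the bars that contain `i` and end exactly at `j`.
  -- Hence `D i j` is the number of bars with right end `j` whose left end moves from `i` to `i +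
  -- 1`.
  let D : ℕ → ℕ → ℤ := fun i j => (r i j - r i (j + 1)) - (r' i j - r' i (j + 1))
  have hD : ∀ i j, 1 ≤ i → i ≤ j → j ≤ n → 0 ≤ D i j := fun i j hi hij hj =>
    sub_nonneg.2 (h i j hi hij hj)
  have hflow : IsFlow (wDist w) ∅
      (fun φ => ∑ j ∈ Finset.Icc 1 n, ∑ i ∈ Finset.Icc 1 j,
        D i j * (φ (Finset.Icc i j) - φ (Finset.Icc (i + 1) j)))
      (∑ j ∈ Finset.Icc 1 n, ∑ i ∈ Finset.Icc 1 j, (D i j).toNat * w i) := by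
    refine IsFlow.sum _ fun j hj => IsFlow.sum _ fun i hi => ?_
    rw [Finset.mem_Icc] at hi hj
    rw [← wDist_Icc_succ_left w hi.2]
    exact isFlow_toNat (hD i j hi.1 hi.2 hj.2) _ _
  refine hflow.of_eq (fun φ hφ => ?_) (le_of_eq ?_)
  · have hempty : ∀ i j, j < i → φ (Finset.Icc i j) = 0 := fun i j hij => by
      rw [Finset.Icc_eq_empty (by omega), hφ]
    have e : rankSum n r φ - rankSum n r' φ = ∑ j ∈ Finset.Icc 1 n, ∑ i ∈ Finset.Icc 1 n,
        (D i j - D (i - 1) j) * φ (Finset.Icc i j) := by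
      refine Eq.trans ?_ Finset.sum_comm
      rw [rankSum, rankSum, ← Finset.sum_sub_distrib]
      refine Finset.sum_congr rfl fun i _ => ?_
      rw [← Finset.sum_sub_distrib]
      refine Finset.sum_congr rfl fun j _ => ?_
      simp only [D]
      ring
    rw [e]
    refine Finset.sum_congr rfl fun j hj => ?_
    rw [Finset.mem_Icc] at hj
    rw [sum_by_parts_left (fun i => D i j) (fun i => φ (Finset.Icc i j)), hempty (n + 1) j (by omega)]
    have hD0 : D 0 j = 0 := by simp [D, h0, h0']
    simp only [hD0, mul_zero, zero_mul, add_zero, sub_zero]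
    symm
    -- For `i > j` both intervals are empty, where `φ` vanishes; the flow needs only the moves with
    -- `i ≤ j`.
    refine Finset.sum_subset (Finset.Icc_subset_Icc_right hj.2) fun i hi hi' => ?_
    rw [Finset.mem_Icc] at hi hi'
    rw [hempty i j (by omega), hempty (i + 1) j (by omega)]
    simp
  · rw [Finset.sum_comm' (t' := Finset.Icc 1 n) (s' := fun i => Finset.Icc i n)
      (by intro j i; simp only [Finset.mem_Icc]; omega)]
    refine Finset.sum_congr rfl fun i hi => ?_
    rw [Finset.mem_Icc] at hi
    rw [← Finset.sum_mul, mul_comm, sum_toNat]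
    · congr 3
      -- Each of these moves past `i` costs `w i`, and their number telescopes over the right ends
      -- to `r i i - r' i i`.
      have := sum_Icc_sub_succ (fun j => r i j - r' i j) hi.2
      simp only [hn, hn', sub_zero] at this
      rw [← this]
      refine Finset.sum_congr rfl fun j _ => ?_
      simp only [D]
      ring
    · intro j hj
      rw [Finset.mem_Icc] at hj
      exact hD i j hi.1 hj.1 hj.2

/-- Moving the right end points of bars. -/
lemma isFlow_rankSum_right (w : ℕ → ℝ≥0∞) (n : ℕ) (r r' : ℕ → ℕ → ℤ) (h0 : ∀ j, r 0 j = 0)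
    (h0' : ∀ j, r' 0 j = 0) (hn : ∀ i, r i (n + 1) = 0) (hn' : ∀ i, r' i (n + 1) = 0)
    (h : ∀ i j, 1 ≤ i → i ≤ j → j ≤ n → r' i j - r' (i - 1) j ≤ r i j - r (i - 1) j) :
    IsFlow (wDist w) ∅ (fun φ => rankSum n r φ - rankSum n r' φ)
      (∑ i ∈ Finset.Icc 1 n, w i * (r i i - r' i i).toNat) := by
  -- Dually, `G i j` is the number of bars with left end `i` whose right end moves from `j` to `j -
  -- 1`.
  let G : ℕ → ℕ → ℤ := fun i j => (r i j - r (i - 1) j) - (r' i j - r' (i - 1) j)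
  have hG : ∀ i j, 1 ≤ i → i ≤ j → j ≤ n → 0 ≤ G i j := fun i j hi hij hj =>
    sub_nonneg.2 (h i j hi hij hj)
  have hflow : IsFlow (wDist w) ∅
      (fun φ => ∑ i ∈ Finset.Icc 1 n, ∑ j ∈ Finset.Icc i n,
        G i j * (φ (Finset.Icc i j) - φ (Finset.Icc i (j - 1))))
      (∑ i ∈ Finset.Icc 1 n, ∑ j ∈ Finset.Icc i n, (G i j).toNat * w j) := by
    refine IsFlow.sum _ fun i hi => IsFlow.sum _ fun j hj => ?_
    rw [Finset.mem_Icc] at hi hj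
    rw [← wDist_Icc_pred_right w hi.1 hj.1]
    exact isFlow_toNat (hG i j hi.1 hj.1 hj.2) _ _
  refine hflow.of_eq (fun φ hφ => ?_) (le_of_eq ?_)
  · have hempty : ∀ i j, j < i → φ (Finset.Icc i j) = 0 := fun i j hij => by
      rw [Finset.Icc_eq_empty (by omega), hφ]
    have e : rankSum n r φ - rankSum n r' φ = ∑ i ∈ Finset.Icc 1 n, ∑ j ∈ Finset.Icc 1 n,
        (G i j - G i (j + 1)) * φ (Finset.Icc i j) := by
      rw [rankSum, rankSum, ← Finset.sum_sub_distrib]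
      refine Finset.sum_congr rfl fun i _ => ?_
      rw [← Finset.sum_sub_distrib]
      refine Finset.sum_congr rfl fun j _ => ?_
      simp only [G]
      ring
    rw [e]
    refine Finset.sum_congr rfl fun i hi => ?_
    rw [Finset.mem_Icc] at hi
    rw [sum_by_parts_right (fun j => G i j) (fun j => φ (Finset.Icc i j)), hempty i 0 (by omega)]
    have hGn : G i (n + 1) = 0 := by simp [G, hn, hn']
    simp only [hGn, mul_zero, zero_mul, add_zero, sub_zero]
    symm
    refine Finset.sum_subset (Finset.Icc_subset_Icc_left hi.1) fun j hj hj' => ?_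
    rw [Finset.mem_Icc] at hj hj'
    rw [hempty i j (by omega), hempty i (j - 1) (by omega)]
    simp
  · rw [Finset.sum_comm' (t' := Finset.Icc 1 n) (s' := fun j => Finset.Icc 1 j)
      (by intro j i; simp only [Finset.mem_Icc]; omega)]
    refine Finset.sum_congr rfl fun j hj => ?_
    rw [Finset.mem_Icc] at hj
    rw [← Finset.sum_mul, mul_comm, sum_toNat]
    · congr 3
      have := sum_Icc_sub_pred (fun i => r i j - r' i j) j
      simp only [h0, h0', sub_zero] at this
      rw [← this]
      refine Finset.sum_congr rfl fun i _ => ?_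
      simp only [G]
      ring
    · intro i hi
      rw [Finset.mem_Icc] at hi
      exact hG i j hi.1 hi.2 hj.2

lemma rankSum_add (n : ℕ) (r r' : ℕ → ℕ → ℤ) (φ : Finset ℕ → ℤ) :
    rankSum n (fun i j => r i j + r' i j) φ = rankSum n r φ + rankSum n r' φ := by
  rw [rankSum, rankSum, rankSum, ← Finset.sum_add_distrib]
  refine Finset.sum_congr rfl fun i _ => ?_
  rw [← Finset.sum_add_distrib]
  refine Finset.sum_congr rfl fun j _ => ?_
  ring

lemma rankSum_zero (n : ℕ) (φ : Finset ℕ → ℤ) : rankSum n (fun _ _ => 0) φ = 0 := by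
  simp [rankSum]

/-- Möbius inversion recovers a bar from its rank function: the alternating sum of four indicators
is nonzero only at the pair of end points. -/
lemma rankSum_interval (n : ℕ) (t : Finset ℕ) (ht : t ⊆ Finset.Icc 1 n)
    (ht' : ∀ i j k, i ∈ t → k ∈ t → i ≤ j → j ≤ k → j ∈ t) (φ : Finset ℕ → ℤ) (hφ : φ ∅ = 0) :
    rankSum n (fun i j => if i ∈ t ∧ j ∈ t ∧ i ≤ j then 1 else 0) φ = φ t := by
  rcases t.eq_empty_or_nonempty with rfl | hne
  · simp [rankSum, hφ]
  · obtain ⟨a, b, hab, rfl⟩ : ∃ a b, a ≤ b ∧ t = Finset.Icc a b := by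
      refine ⟨t.min' hne, t.max' hne, t.min'_le _ (t.max'_mem hne), ?_⟩
      ext k
      rw [Finset.mem_Icc]
      exact ⟨fun hk => ⟨t.min'_le _ hk, t.le_max' _ hk⟩,
        fun hk => ht' _ _ _ (t.min'_mem hne) (t.max'_mem hne) hk.1 hk.2⟩
    have ha : a ∈ Finset.Icc 1 n := ht (Finset.mem_Icc.2 ⟨le_rfl, hab⟩)
    have hb : b ∈ Finset.Icc 1 n := ht (Finset.mem_Icc.2 ⟨hab, le_rfl⟩)
    have key : ∀ i ∈ Finset.Icc 1 n, ∀ j ∈ Finset.Icc 1 n,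
        ((if i ∈ Finset.Icc a b ∧ j ∈ Finset.Icc a b ∧ i ≤ j then (1 : ℤ) else 0) -
          (if i - 1 ∈ Finset.Icc a b ∧ j ∈ Finset.Icc a b ∧ i - 1 ≤ j then 1 else 0) -
          (if i ∈ Finset.Icc a b ∧ j + 1 ∈ Finset.Icc a b ∧ i ≤ j + 1 then 1 else 0) +
          (if i - 1 ∈ Finset.Icc a b ∧ j + 1 ∈ Finset.Icc a b ∧ i - 1 ≤ j + 1 then 1 else 0)) *
          φ (Finset.Icc i j) = if i = a then if j = b then φ (Finset.Icc a b) else 0 else 0 := by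
      intro i hi j hj
      rw [Finset.mem_Icc] at hi hj ha hb
      by_cases hij : i ≤ j
      · have h1 : (if i = a then if j = b then φ (Finset.Icc a b) else 0 else 0) =
            (if i = a ∧ j = b then (1 : ℤ) else 0) * φ (Finset.Icc i j) := by
          by_cases hia : i = a <;> by_cases hjb : j = b <;> simp [hia, hjb]
        rw [h1]
        congr 1
        simp only [Finset.mem_Icc]
        split_ifs <;> omega
      · rw [Finset.Icc_eq_empty hij, hφ, mul_zero]
        split_ifs <;> first | rfl | omega
    rw [rankSum, Finset.sum_congr rfl fun i hi => Finset.sum_congr rfl fun j hj => key i hi j hj]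
    simp only [Finset.sum_ite_irrel, Finset.sum_const_zero, Finset.sum_ite_eq', ha, hb, if_true]

end RankFunction

end PersMod

end
noncomputable section

namespace PersMod

/-! ### Rank functions of persistence modules -/

section Rank

variable {K : Type u} [Field K]

/-- The two sides are the dimensions of `ker g ∩ A` and `ker g ∩ B`. -/
lemma finrank_sub_finrank_map_le {V W : Type*} [AddCommGroup V] [Module K V] [AddCommGroup W]
    [Module K W] [FiniteDimensional K V] {A B : Submodule K V} (h : A ≤ B) (g : V →ₗ[K] W) :
    (Module.finrank K A : ℤ) - Module.finrank K (A.map g) ≤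
      Module.finrank K B - Module.finrank K (B.map g) := by
  have hA := (g.domRestrict A).finrank_range_add_finrank_ker
  have hB := (g.domRestrict B).finrank_range_add_finrank_ker
  rw [LinearMap.range_domRestrict] at hA hB
  have hle : Module.finrank K (LinearMap.ker (g.domRestrict A)) ≤
      Module.finrank K (LinearMap.ker (g.domRestrict B)) := by
    refine LinearMap.finrank_le_finrank_of_injective
      (f := (Submodule.inclusion h).restrict (p := LinearMap.ker (g.domRestrict A))
        (q := LinearMap.ker (g.domRestrict B)) fun x hx => hx) ?_
    intro x y hxy
    have := congrArg (fun z => z.1.1) hxy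
    exact Subtype.ext (Subtype.ext this)
  omega

lemma finrank_submodule_prod {V W : Type*} [AddCommGroup V] [Module K V] [AddCommGroup W]
    [Module K W] [FiniteDimensional K V] [FiniteDimensional K W] (A : Submodule K V)
    (B : Submodule K W) :
    Module.finrank K (A.prod B) = Module.finrank K A + Module.finrank K B := by
  rw [← Module.finrank_prod]
  exact LinearEquiv.finrank_eq
    { toFun := fun x => (⟨x.1.1, x.2.1⟩, ⟨x.1.2, x.2.2⟩)
      map_add' := fun _ _ => rfl
      map_smul' := fun _ _ => rfl
      invFun := fun x => ⟨(x.1.1, x.2.1), x.1.2, x.2.2⟩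
      left_inv := fun _ => rfl
      right_inv := fun _ => rfl }

variable {P : Type} [Preorder P]

/-- The rank function of a morphism along a sequence of points. -/
def rk {p : ℕ → P} (hp : Monotone p) (n : ℕ) {M N : P ⥤ ModuleCat.{u} K} (f : M ⟶ N)
    (i j : ℕ) : ℤ :=
  if h : 1 ≤ i ∧ i ≤ j ∧ j ≤ n then
    Module.finrank K (LinearMap.range (M.map (homOfLE (hp h.2.1)) ≫ f.app (p j)).hom) else 0

section

variable {p : ℕ → P} (hp : Monotone p) (n : ℕ) {M N : P ⥤ ModuleCat.{u} K} (f : M ⟶ N)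

lemma rk_of_le {i j : ℕ} (hi : 1 ≤ i) (hij : i ≤ j) (hj : j ≤ n) : rk hp n f i j =
    Module.finrank K (LinearMap.range (M.map (homOfLE (hp hij)) ≫ f.app (p j)).hom) :=
  dif_pos ⟨hi, hij, hj⟩

lemma rk_id_of_le {i j : ℕ} (hi : 1 ≤ i) (hij : i ≤ j) (hj : j ≤ n) : rk hp n (𝟙 M) i j =
    Module.finrank K (LinearMap.range (M.map (homOfLE (hp hij))).hom) := by
  rw [rk_of_le hp n _ hi hij hj]
  have : M.map (homOfLE (hp hij)) ≫ (𝟙 M : M ⟶ M).app (p j) = M.map (homOfLE (hp hij)) :=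
    Category.comp_id _
  rw [this]

/-- Together with `rk_succ_right`, these boundary values remove the end terms of the summation by
parts. -/
lemma rk_zero_left (j : ℕ) : rk hp n f 0 j = 0 := dif_neg (by omega)

lemma rk_succ_right (i : ℕ) : rk hp n f i (n + 1) = 0 := dif_neg (by omega)

lemma rk_self_eq {i : ℕ} (hi : 1 ≤ i) (hn : i ≤ n) :
    rk hp n f i i = Module.finrank K (LinearMap.range (f.app (p i)).hom) := by
  rw [rk_of_le hp n f hi le_rfl hn]
  have : M.map (homOfLE (hp (le_refl i))) = 𝟙 _ := M.map_id _
  rw [this, Category.id_comp]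

lemma rk_id_self {i : ℕ} (hi : 1 ≤ i) (hn : i ≤ n) :
    rk hp n (𝟙 M) i i = Module.finrank K (M.obj (p i)) := by
  rw [rk_self_eq hp n _ hi hn]
  have : LinearMap.range ((𝟙 M : M ⟶ M).app (p i)).hom = ⊤ := LinearMap.range_eq_top.2
    fun x => ⟨x, rfl⟩
  rw [this, finrank_top]

/-- The rank lost by applying `f` at `p j` is the dimension of `ker f` inside the image of `M (p
i)`, and this image grows with `i`. -/
lemma rk_right_ineq {i j : ℕ} [FiniteDimensional K (M.obj (p j))] (hi : 1 ≤ i) (hij : i ≤ j)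
    (hj : j ≤ n) : rk hp n f i j - rk hp n f (i - 1) j ≤
      rk hp n (𝟙 M) i j - rk hp n (𝟙 M) (i - 1) j := by
  have hmap : ∀ i (hij : i ≤ j), LinearMap.range (M.map (homOfLE (hp hij)) ≫ f.app (p j)).hom =
      (LinearMap.range (M.map (homOfLE (hp hij)) ≫ (𝟙 M : M ⟶ M).app (p j)).hom).map
        (f.app (p j)).hom := by
    intro i hij
    rw [← LinearMap.range_comp, NatTrans.id_app, Category.comp_id]
    rfl
  rw [rk_of_le hp n f hi hij hj, rk_of_le hp n (𝟙 M) hi hij hj, hmap i hij]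
  obtain rfl | hi' := Nat.eq_or_lt_of_le hi
  · rw [Nat.sub_self, rk_zero_left, rk_zero_left]
    have := Submodule.finrank_map_le (f.app (p j)).hom (LinearMap.range
      (M.map (homOfLE (hp hij)) ≫ (𝟙 M : M ⟶ M).app (p j)).hom)
    omega
  · rw [rk_of_le hp n f (by omega) (by omega : i - 1 ≤ j) hj,
      rk_of_le hp n (𝟙 M) (by omega) (by omega : i - 1 ≤ j) hj, hmap (i - 1) (by omega)]
    have hle : LinearMap.range (M.map (homOfLE (hp (by omega : i - 1 ≤ j))) ≫
          (𝟙 M : M ⟶ M).app (p j)).hom ≤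
        LinearMap.range (M.map (homOfLE (hp hij)) ≫ (𝟙 M : M ⟶ M).app (p j)).hom := by
      rintro _ ⟨x, rfl⟩
      refine ⟨M.map (homOfLE (hp (by omega : i - 1 ≤ i))) x, ?_⟩
      exact ConcreteCategory.congr_hom (M.map_comp (homOfLE (hp (by omega : i - 1 ≤ i)))
        (homOfLE (hp hij))).symm x
    have := finrank_sub_finrank_map_le hle (f.app (p j)).hom
    omega

/-- The rank lost from `p j` to `p (j + 1)` is the dimension of the kernel of that map on an image,
and the image of `M (p i)` lies inside that of `N (p i)`. For `j = n` the inclusion alone is enough.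
-/
lemma rk_left_ineq {i j : ℕ} [FiniteDimensional K (N.obj (p j))] (hi : 1 ≤ i) (hij : i ≤ j)
    (hj : j ≤ n) : rk hp n f i j - rk hp n f i (j + 1) ≤
      rk hp n (𝟙 N) i j - rk hp n (𝟙 N) i (j + 1) := by
  have hle : LinearMap.range (M.map (homOfLE (hp hij)) ≫ f.app (p j)).hom ≤
      LinearMap.range (N.map (homOfLE (hp hij)) ≫ (𝟙 N : N ⟶ N).app (p j)).hom := by
    rintro _ ⟨x, rfl⟩
    refine ⟨f.app (p i) x, ?_⟩
    exact (ConcreteCategory.congr_hom (f.naturality (homOfLE (hp hij))) x).symm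
  have key : (Module.finrank K (LinearMap.range (M.map (homOfLE (hp hij)) ≫ f.app (p j)).hom) : ℤ) ≤
      Module.finrank K (LinearMap.range (N.map (homOfLE (hp hij)) ≫ (𝟙 N : N ⟶ N).app (p j)).hom) :=
    mod_cast Submodule.finrank_mono hle
  rw [rk_of_le hp n f hi hij hj, rk_of_le hp n (𝟙 N) hi hij hj]
  obtain rfl | hj' := Nat.eq_or_lt_of_le hj
  · rw [rk_succ_right, rk_succ_right]
    omega
  · rw [rk_of_le hp n f hi (by omega : i ≤ j + 1) hj',
      rk_of_le hp n (𝟙 N) hi (by omega : i ≤ j + 1) hj']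
    have hjj : p j ≤ p (j + 1) := hp (by omega)
    have h1 : LinearMap.range (M.map (homOfLE (hp (by omega : i ≤ j + 1))) ≫
          f.app (p (j + 1))).hom =
        (LinearMap.range (M.map (homOfLE (hp hij)) ≫ f.app (p j)).hom).map
          (N.map (homOfLE hjj)).hom := by
      rw [← LinearMap.range_comp, ← ModuleCat.hom_comp, Category.assoc, ← f.naturality,
        ← Category.assoc, ← M.map_comp]
      rfl
    have h2 : LinearMap.range (N.map (homOfLE (hp (by omega : i ≤ j + 1))) ≫
          (𝟙 N : N ⟶ N).app (p (j + 1))).hom =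
        (LinearMap.range (N.map (homOfLE (hp hij)) ≫ (𝟙 N : N ⟶ N).app (p j)).hom).map
          (N.map (homOfLE hjj)).hom := by
      rw [← LinearMap.range_comp, ← ModuleCat.hom_comp, Category.assoc, ← (𝟙 N : N ⟶ N).naturality,
        ← Category.assoc, ← N.map_comp]
      rfl
    rw [h1, h2]
    exact finrank_sub_finrank_map_le hle _

lemma rk_id_sub_rk_eq_kerDim {i : ℕ} [FiniteDimensional K (M.obj (p i))] (hi : 1 ≤ i)
    (hn : i ≤ n) : ((rk hp n (𝟙 M) i i - rk hp n f i i).toNat : ℝ≥0∞) = kerDim f (p i) := by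
  rw [rk_id_self hp n hi hn, rk_self_eq hp n f hi hn, kerDim, edim_eq_finrank]
  have := (f.app (p i)).hom.finrank_range_add_finrank_ker
  congr 1
  omega

lemma rk_id_sub_rk_eq_cokerDim {i : ℕ} [FiniteDimensional K (N.obj (p i))] (hi : 1 ≤ i)
    (hn : i ≤ n) : ((rk hp n (𝟙 N) i i - rk hp n f i i).toNat : ℝ≥0∞) = cokerDim f (p i) := by
  rw [rk_id_self hp n hi hn, rk_self_eq hp n f hi hn, cokerDim, edim_eq_finrank]
  have := (LinearMap.range (f.app (p i)).hom).finrank_quotient_add_finrank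
  congr 1
  omega

/-- Both modules are compared with the image of `f`, whose rank function is `rk hp n f`: from `M`
right ends move, at the cost of the kernel, and from `N` left ends move, at the cost of the
cokernel. -/
lemma isFlow_hom (w : ℕ → ℝ≥0∞) (hM : ∀ i ∈ Finset.Icc 1 n, FiniteDimensional K (M.obj (p i)))
    (hN : ∀ i ∈ Finset.Icc 1 n, FiniteDimensional K (N.obj (p i))) :
    IsFlow (wDist w) ∅ (fun φ => rankSum n (rk hp n (𝟙 M)) φ - rankSum n (rk hp n (𝟙 N)) φ)
      (∑ i ∈ Finset.Icc 1 n, w i * (kerDim f (p i) + cokerDim f (p i))) := by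
  have h1 := isFlow_rankSum_right w n (rk hp n (𝟙 M)) (rk hp n f) (rk_zero_left hp n _)
    (rk_zero_left hp n _) (rk_succ_right hp n _) (rk_succ_right hp n _) fun i j hi hij hj => by
      have := hM j (Finset.mem_Icc.2 ⟨by omega, hj⟩)
      exact rk_right_ineq hp n f hi hij hj
  have h2 := isFlow_rankSum_left w n (rk hp n (𝟙 N)) (rk hp n f) (rk_zero_left hp n _)
    (rk_zero_left hp n _) (rk_succ_right hp n _) (rk_succ_right hp n _) fun i j hi hij hj => by
      have := hN j (Finset.mem_Icc.2 ⟨by omega, hj⟩)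
      exact rk_left_ineq hp n f hi hij hj
  refine (h1.add (h2.neg (wDist_comm w))).of_eq (fun φ _ => by ring) (le_of_eq ?_)
  rw [← Finset.sum_add_distrib]
  refine Finset.sum_congr rfl fun i hi => ?_
  have := hM i hi
  have := hN i hi
  rw [Finset.mem_Icc] at hi
  rw [rk_id_sub_rk_eq_kerDim hp n f hi.1 hi.2, rk_id_sub_rk_eq_cokerDim hp n f hi.1 hi.2, mul_add]

end

/-- The pointwise cost of a zigzag. -/
def Zigzag.pointCost : {M N : P ⥤ ModuleCat.{u} K} → Zigzag M N → P → ℝ≥0∞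
  | _, _, .nil _, _ => 0
  | _, _, .fwd f γ, p => (kerDim f p + cokerDim f p) + γ.pointCost p
  | _, _, .bwd f γ, p => (kerDim f p + cokerDim f p) + γ.pointCost p

/-- Finite pointwise cost carries finite dimensionality from one end of a zigzag through all its
modules. -/
lemma finiteDimensional_iff_of_hom {M N : P ⥤ ModuleCat.{u} K} (f : M ⟶ N) {p : P}
    (h : kerDim f p + cokerDim f p < ∞) :
    FiniteDimensional K (M.obj p) ↔ FiniteDimensional K (N.obj p) := by
  obtain ⟨h1, h2⟩ := ENNReal.add_lt_top.1 h
  have hk := edim_ker_add_edim_range (f.app p).hom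
  have hc := edim_ker_add_edim_range (LinearMap.range (f.app p).hom).mkQ
  rw [Submodule.ker_mkQ, Submodule.range_mkQ, edim_congr Submodule.topEquiv] at hc
  rw [← edim_lt_top_iff, ← edim_lt_top_iff, ← hk, ← hc, ENNReal.add_lt_top, ENNReal.add_lt_top]
  exact ⟨fun h => ⟨h.2, h2⟩, fun h => ⟨h1, h.1⟩⟩

/-- The signed barcodes of the intermediate modules cancel, so no decomposition of these modules is
used. -/
lemma Zigzag.isFlow {p : ℕ → P} (hp : Monotone p) (n : ℕ) (w : ℕ → ℝ≥0∞)
    {M N : P ⥤ ModuleCat.{u} K} (γ : Zigzag M N)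
    (hM : ∀ i ∈ Finset.Icc 1 n, FiniteDimensional K (M.obj (p i)))
    (hγ : ∀ i ∈ Finset.Icc 1 n, γ.pointCost (p i) < ∞) :
    IsFlow (wDist w) ∅ (fun φ => rankSum n (rk hp n (𝟙 M)) φ - rankSum n (rk hp n (𝟙 N)) φ)
      (∑ i ∈ Finset.Icc 1 n, w i * γ.pointCost (p i)) := by
  induction γ with
  | nil => exact IsFlow.zero.of_eq (fun φ _ => by simp) zero_le
  | fwd f γ ih =>
    have h1 := fun i hi => (ENNReal.add_lt_top.1 (hγ i hi)).1
    have hN := fun i hi => (finiteDimensional_iff_of_hom f (h1 i hi)).1 (hM i hi)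
    refine ((isFlow_hom hp n f w hM hN).add
      (ih hN fun i hi => (ENNReal.add_lt_top.1 (hγ i hi)).2)).of_eq (fun φ _ => by ring)
      (le_of_eq ?_)
    rw [← Finset.sum_add_distrib]
    exact Finset.sum_congr rfl fun i _ => (mul_add _ _ _).symm
  | bwd f γ ih =>
    have h1 := fun i hi => (ENNReal.add_lt_top.1 (hγ i hi)).1
    have hN := fun i hi => (finiteDimensional_iff_of_hom f (h1 i hi)).2 (hM i hi)
    refine (((isFlow_hom hp n f w hN hM).neg (wDist_comm w)).add
      (ih hN fun i hi => (ENNReal.add_lt_top.1 (hγ i hi)).2)).of_eq (fun φ _ => by ring)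
      (le_of_eq ?_)
    rw [← Finset.sum_add_distrib]
    exact Finset.sum_congr rfl fun i _ => (mul_add _ _ _).symm

lemma rk_id_prodModule {p : ℕ → P} (hp : Monotone p) (n : ℕ) (M N : P ⥤ ModuleCat.{u} K)
    (hM : ∀ i ∈ Finset.Icc 1 n, FiniteDimensional K (M.obj (p i)))
    (hN : ∀ i ∈ Finset.Icc 1 n, FiniteDimensional K (N.obj (p i))) :
    rk hp n (𝟙 (prodModule M N)) = fun i j => rk hp n (𝟙 M) i j + rk hp n (𝟙 N) i j := by
  funext i j
  by_cases h : 1 ≤ i ∧ i ≤ j ∧ j ≤ n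
  · obtain ⟨hi, hij, hj⟩ := h
    have := hM j (Finset.mem_Icc.2 ⟨by omega, hj⟩)
    have := hN j (Finset.mem_Icc.2 ⟨by omega, hj⟩)
    rw [rk_id_of_le hp n hi hij hj, rk_id_of_le hp n hi hij hj, rk_id_of_le hp n hi hij hj]
    have : LinearMap.range ((prodModule M N).map (homOfLE (hp hij))).hom =
        (LinearMap.range (M.map (homOfLE (hp hij))).hom).prod
          (LinearMap.range (N.map (homOfLE (hp hij))).hom) := LinearMap.range_prodMap _ _
    rw [this, ← Nat.cast_add]
    exact congrArg Nat.cast (finrank_submodule_prod _ _)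
  · simp only [rk, dif_neg h, add_zero]

lemma finiteDimensional_listSum (l : List (P ⥤ ModuleCat.{u} K)) (p : P)
    (h : ∀ M ∈ l, FiniteDimensional K (M.obj p)) : FiniteDimensional K ((listSum l).obj p) := by
  induction l with
  | nil => exact inferInstanceAs (FiniteDimensional K PUnit)
  | cons M l ih =>
    have := h M (by simp)
    have := ih fun N hN => h N (by simp [hN])
    exact inferInstanceAs (FiniteDimensional K (M.obj p × (listSum l).obj p))

lemma rankSum_listSum {p : ℕ → P} (hp : Monotone p) (n : ℕ) (l : List (P ⥤ ModuleCat.{u} K))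
    (h : ∀ M ∈ l, ∀ i ∈ Finset.Icc 1 n, FiniteDimensional K (M.obj (p i))) (φ : Finset ℕ → ℤ) :
    rankSum n (rk hp n (𝟙 (listSum l))) φ =
      (l.map fun M => rankSum n (rk hp n (𝟙 M)) φ).sum := by
  induction l with
  | nil =>
    have : rk hp n (𝟙 (listSum [] : P ⥤ ModuleCat.{u} K)) = fun _ _ => 0 := by
      funext i j
      by_cases h : 1 ≤ i ∧ i ≤ j ∧ j ≤ n
      · rw [rk_of_le hp n _ h.1 h.2.1 h.2.2]
        have : Subsingleton ((listSum [] : P ⥤ ModuleCat.{u} K).obj (p j)) :=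
          inferInstanceAs (Subsingleton PUnit)
        rw [Module.finrank_zero_of_subsingleton]
        rfl
      · exact dif_neg h
    rw [this, rankSum_zero]
    rfl
  | cons M l ih =>
    change rankSum n (rk hp n (𝟙 (prodModule M (listSum l)))) φ = _
    rw [rk_id_prodModule hp n M (listSum l) (h M (by simp)) fun i hi =>
      finiteDimensional_listSum l _ fun N hN => h N (by simp [hN]) i hi, rankSum_add,
      ih fun N hN => h N (by simp [hN]), List.map_cons, List.sum_cons]

end Rank

/-! ### Interval modules seen along a finite sequence of points -/

section RankInterval

variable {K : Type u} [Field K] {P : Type} [LinearOrder P]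

instance finiteDimensional_intervalModule (I : PInterval P) (p : P) :
    FiniteDimensional K ((intervalModule K I).obj p) :=
  inferInstanceAs (FiniteDimensional K (PLift (p ∈ I.1) → K))

open Classical in
/-- The indices of the points of a sequence that belong to an interval. -/
def trace (p : ℕ → P) (n : ℕ) (I : PInterval P) : Finset ℕ :=
  (Finset.Icc 1 n).filter fun k => p k ∈ I.1

lemma rankSum_intervalModule {p : ℕ → P} (hp : Monotone p) (n : ℕ) (I : PInterval P)
    (φ : Finset ℕ → ℤ) (hφ : φ ∅ = 0) :
    rankSum n (rk hp n (𝟙 (intervalModule K I))) φ = φ (trace p n I) := by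
  classical
  have hr : rk hp n (𝟙 (intervalModule K I)) = fun i j =>
      if i ∈ trace p n I ∧ j ∈ trace p n I ∧ i ≤ j then 1 else 0 := by
    funext i j
    by_cases h : 1 ≤ i ∧ i ≤ j ∧ j ≤ n
    · rw [rk_id_of_le hp n h.1 h.2.1 h.2.2]
      by_cases hi : p i ∈ I.1
      · by_cases hj : p j ∈ I.1
        · have : LinearMap.range ((intervalModule K I).map (homOfLE (hp h.2.1))).hom = ⊤ :=
            LinearMap.range_eq_top.2 fun y => ⟨(fun _ => y ⟨hj⟩ : PLift (p i ∈ I.1) → K),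
              funext fun _ => intervalModule_map_apply I _ _ hi hj⟩
          rw [this, finrank_top, if_pos]
          · have : Unique (PLift (p j ∈ I.1)) := ⟨⟨⟨hj⟩⟩, fun _ => rfl⟩
            have h1 : Module.finrank K (PLift (p j ∈ I.1) → K) = 1 := by simp
            exact congrArg Nat.cast h1
          · simp only [trace, Finset.mem_filter, Finset.mem_Icc]
            exact ⟨⟨by omega, hi⟩, ⟨by omega, hj⟩, h.2.1⟩
        · have := intervalModule_subsingleton (K := K) hj
          rw [Module.finrank_zero_of_subsingleton, if_neg]
          · rfl
          · simp [trace, hj]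
      · have := intervalModule_subsingleton (K := K) hi
        have h0 : LinearMap.range ((intervalModule K I).map (homOfLE (hp h.2.1))).hom = ⊥ :=
          LinearMap.range_eq_bot.2 (LinearMap.ext fun x => by
            rw [Subsingleton.elim x 0, map_zero, map_zero])
        rw [h0, finrank_bot, if_neg]
        · rfl
        · simp [trace, hi]
    · rw [if_neg]
      · exact dif_neg h
      · simp only [trace, Finset.mem_filter, Finset.mem_Icc]
        omega
  rw [hr]
  refine rankSum_interval n _ (Finset.filter_subset _ _) (fun i j k hi hk hij hjk => ?_) φ hφ
  simp only [Finset.mem_filter, Finset.mem_Icc] at hi hk ⊢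
  exact ⟨by omega, I.2.2.out hi.2 hk.2 ⟨hp hij, hp hjk⟩⟩

lemma sum_trace (p : ℕ → P) (n : ℕ) (w : ℕ → ℝ≥0∞) (I : PInterval P) :
    wDist w (trace p n I) ∅ = ∑ k ∈ Finset.Icc 1 n, w k * I.1.indicator 1 (p k) := by
  classical
  rw [wDist, ← Finset.bot_eq_empty, symmDiff_bot, trace, Finset.sum_filter]
  refine Finset.sum_congr rfl fun k _ => ?_
  by_cases h : p k ∈ I.1 <;> simp [h]

/-- Once the weights sample `μ`, the combinatorial distance of two traces is the measure of the
symmetric difference of the bars. -/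
lemma wDist_trace (p : ℕ → P) (n : ℕ) (w : ℕ → ℝ≥0∞) (I J : PInterval P) :
    wDist w (trace p n I) (trace p n J) =
      ∑ k ∈ Finset.Icc 1 n, w k * (symmDiff I.1 J.1).indicator 1 (p k) := by
  classical
  have : symmDiff (trace p n I) (trace p n J) =
      (Finset.Icc 1 n).filter fun k => p k ∈ symmDiff I.1 J.1 := by
    ext k
    simp only [trace, Finset.mem_symmDiff, Finset.mem_filter, Set.mem_symmDiff]
    tauto
  rw [wDist, this, Finset.sum_filter]
  refine Finset.sum_congr rfl fun k _ => ?_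
  by_cases h : p k ∈ symmDiff I.1 J.1 <;> simp [h]

lemma rankSum_listSum_intervalModule {p : ℕ → P} (hp : Monotone p) (n : ℕ) {ι : Type*}
    (I : ι → PInterval P) (l : List ι) (φ : Finset ℕ → ℤ) (hφ : φ ∅ = 0) :
    rankSum n (rk hp n (𝟙 (listSum (l.map fun a => intervalModule K (I a))))) φ =
      (l.map fun a => φ (trace p n (I a))).sum := by
  rw [rankSum_listSum hp n, List.map_map]
  · simp only [Function.comp_def, rankSum_intervalModule hp n _ φ hφ]
  · intro M hM i _
    obtain ⟨a, _, rfl⟩ := List.mem_map.1 hM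
    infer_instance

end RankInterval

end PersMod

end
noncomputable section

namespace PersMod

/-! ### Stability -/

section Sample

variable {P : Type} [LinearOrder P]

/-- Finitely many weighted points can be arranged in a monotone sequence. -/
lemma exists_monotone_sample [Nonempty P] {γ : Type*} (S : Finset γ) (q : γ → P)
    (v : γ → ℝ≥0∞) : ∃ (n : ℕ) (p : ℕ → P) (w : ℕ → ℝ≥0∞), Monotone p ∧
      (∀ k ∈ Finset.Icc 1 n, ∃ c ∈ S, p k = q c) ∧
      ∀ g : P → ℝ≥0∞, ∑ k ∈ Finset.Icc 1 n, w k * g (p k) = ∑ c ∈ S, v c * g (q c) := by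
  classical
  rcases S.eq_empty_or_nonempty with rfl | hS
  · exact ⟨0, fun _ => Classical.arbitrary P, 0, monotone_const, by simp, by simp⟩
  let N := S.card
  have hN : 0 < N := Finset.card_pos.2 hS
  let e : Fin N ≃ S := S.equivFin.symm
  let τ := Tuple.sort fun i => q (e i)
  have hτ : Monotone ((fun i => q (e i)) ∘ τ) := Tuple.monotone_sort _
  -- The sorted points are numbered from 1; clamping at both ends extends the sequence monotonically
  -- to all of `ℕ`.
  let idx : ℕ → Fin N := fun k => ⟨min (k - 1) (N - 1), by omega⟩
  refine ⟨N, fun k => q (e (τ (idx k))), fun k => v (e (τ (idx k))), ?_, ?_, ?_⟩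
  · intro a b hab
    refine hτ (Fin.mk_le_mk.2 ?_)
    omega
  · exact fun k _ => ⟨_, (e (τ (idx k))).2, rfl⟩
  · intro g
    have h1 : ∑ c ∈ S, v c * g (q c) = ∑ i : Fin N, v (e (τ i)) * g (q (e (τ i))) := by
      rw [Equiv.sum_comp τ fun i => v (e i) * g (q (e i)), e.sum_comp fun c => v c * g (q c),
        Finset.sum_coe_sort S fun c => v c * g (q c)]
    rw [h1]
    refine Finset.sum_bij' (fun k _ => idx k) (fun i _ => i.1 + 1) ?_ ?_ ?_ ?_ ?_
    · simp
    · intro i _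
      have := i.2
      rw [Finset.mem_Icc]; omega
    · intro k hk
      rw [Finset.mem_Icc] at hk
      simp only [idx]; omega
    · intro i _
      have := i.2
      ext
      simp only [idx]; omega
    · intro k _; rfl

variable [MeasurableSpace P] {μ : Measure P}

/-- A measure can be sampled at finitely many points so that finitely many sets of finite measure
keep their measure and a given integrable function does not increase its integral. -/
lemma exists_sample [Nonempty P] (T : Finset (Set P)) (hT : ∀ s ∈ T, MeasurableSet s)
    (hT' : ∀ s ∈ T, μ s < ∞) (f : P → ℝ≥0∞) (hf : AEMeasurable f μ) (hf' : ∫⁻ x, f x ∂μ < ∞) :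
    ∃ (n : ℕ) (p : ℕ → P) (w : ℕ → ℝ≥0∞), Monotone p ∧
      (∀ k ∈ Finset.Icc 1 n, f (p k) < ∞) ∧
      (∀ s ∈ T, ∑ k ∈ Finset.Icc 1 n, w k * s.indicator 1 (p k) = μ s) ∧
      ∑ k ∈ Finset.Icc 1 n, w k * f (p k) ≤ ∫⁻ x, f x ∂μ := by
  classical
  -- `sig x` records which sets of `T` contain `x`. Its fibres `A c` are the atoms of the algebra
  -- generated by `T`.
  let sig : P → Finset (Set P) := fun x => T.filter (x ∈ ·)
  let A : Finset (Set P) → Set P := fun c => {x | sig x = c}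
  have hA : ∀ c, MeasurableSet (A c) := by
    intro c
    by_cases hc : c ⊆ T
    · have : A c = ⋂ s ∈ T, if s ∈ c then s else sᶜ := by
        ext x
        simp only [A, sig, Set.mem_ofPred_eq, Set.mem_iInter]
        constructor
        · rintro rfl s hs
          by_cases hx : x ∈ s <;> simp [hs, hx]
        · intro h
          ext s
          rw [Finset.mem_filter]
          constructor
          · rintro ⟨hs, hx⟩
            by_contra hsc
            have := h s hs
            rw [if_neg hsc] at this
            exact this hx
          · intro hs
            have := h s (hc hs)
            rw [if_pos hs] at this
            exact ⟨hc hs, this⟩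
      rw [this]
      refine Finset.measurableSet_biInter _ fun s hs => ?_
      split_ifs
      · exact hT s hs
      · exact (hT s hs).compl
    · have : A c = ∅ := by
        ext x
        simp only [A, Set.mem_ofPred_eq, Set.mem_empty_iff_false, iff_false]
        rintro rfl
        exact hc (Finset.filter_subset _ _)
      rw [this]
      exact MeasurableSet.empty
  have hdisj : ∀ (C : Finset (Finset (Set P))), Set.PairwiseDisjoint (C : Set (Finset (Set P))) A := by
    intro C c _ c' _ hcc
    refine Set.disjoint_left.2 fun x hx hx' => hcc ?_
    exact Eq.trans (Eq.symm hx) hx'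
  have hfin : ∀ c, c ≠ ∅ → μ (A c) < ∞ := by
    intro c hc
    obtain ⟨s, hs⟩ := Finset.nonempty_iff_ne_empty.2 hc
    by_cases hsT : s ∈ T
    · refine (measure_mono fun x hx => ?_).trans_lt (hT' s hsT)
      have : s ∈ sig x := by rw [show sig x = c from hx]; exact hs
      exact (Finset.mem_filter.1 this).2
    · have : A c = ∅ := by
        ext x
        simp only [A, Set.mem_ofPred_eq, Set.mem_empty_iff_false, iff_false]
        rintro rfl
        exact hsT (Finset.filter_subset _ _ hs)
      simp [this]
  have hq : ∀ c, ∃ x, c ≠ ∅ → μ (A c) ≠ 0 →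
      x ∈ A c ∧ f x < ∞ ∧ μ (A c) * f x ≤ ∫⁻ y in A c, f y ∂μ := by
    intro c
    by_cases h : c ≠ ∅ ∧ μ (A c) ≠ 0
    · obtain ⟨hc, h0⟩ := h
      -- Some point of the atom has a value of `f` at most the average there; weighted by the
      -- measure of the atom, it does not exceed the integral over the atom.
      obtain ⟨x, hx, hxf⟩ := exists_le_setLAverage h0 (hfin c hc).ne hf.restrict
      rw [setLAverage_eq] at hxf
      have hlt : ∫⁻ y in A c, f y ∂μ < ∞ := (setLIntegral_le_lintegral _ _).trans_lt hf'
      refine ⟨x, fun _ _ => ⟨hx, hxf.trans_lt (ENNReal.div_lt_top hlt.ne h0), ?_⟩⟩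
      rw [mul_comm]
      exact ENNReal.mul_le_of_le_div hxf
    · exact ⟨Classical.arbitrary P, fun h1 h2 => absurd ⟨h1, h2⟩ h⟩
  choose q hq using hq
  -- The atom outside all sets of `T`, which may have infinite measure, and the null atoms are
  -- omitted: neither affects the measure of a set in `T`.
  let C : Finset (Finset (Set P)) := T.powerset.filter fun c => c ≠ ∅ ∧ μ (A c) ≠ 0
  have hC : ∀ c ∈ C, c ≠ ∅ ∧ μ (A c) ≠ 0 := fun c hc => (Finset.mem_filter.1 hc).2
  obtain ⟨n, p, w, hp, hpq, hsum⟩ := exists_monotone_sample C q fun c => μ (A c)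
  refine ⟨n, p, w, hp, fun k hk => ?_, fun s hs => ?_, ?_⟩
  · obtain ⟨c, hc, hck⟩ := hpq k hk
    rw [hck]
    exact (hq c (hC c hc).1 (hC c hc).2).2.1
  · rw [hsum]
    have hmem : ∀ c ∈ C, (q c ∈ s ↔ s ∈ c) := by
      intro c hc
      have h1 : sig (q c) = c := (hq c (hC c hc).1 (hC c hc).2).1
      conv_rhs => rw [← h1]
      simp [sig, hs]
    have h2 : s = ⋃ c ∈ T.powerset.filter (s ∈ ·), A c := by
      ext x
      simp only [Set.mem_iUnion, exists_prop, A, Set.mem_ofPred_eq]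
      constructor
      · intro hx
        exact ⟨sig x, by simp [sig, hs, hx], rfl⟩
      · rintro ⟨c, hc, rfl⟩
        exact (Finset.mem_filter.1 (Finset.mem_filter.1 hc).2).2
    conv_rhs => rw [h2]
    rw [measure_biUnion_finset (hdisj _) fun c _ => hA c]
    have h3 : ∀ c ∈ C, μ (A c) * s.indicator 1 (q c) = if s ∈ c then μ (A c) else 0 := by
      intro c hc
      by_cases hsc : s ∈ c
      · rw [if_pos hsc, Set.indicator_of_mem ((hmem c hc).2 hsc), Pi.one_apply, mul_one]
      · rw [if_neg hsc, Set.indicator_of_notMem (fun h => hsc ((hmem c hc).1 h)), mul_zero]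
    rw [Finset.sum_congr rfl h3, Finset.sum_filter (s ∈ ·)]
    refine Finset.sum_subset (Finset.filter_subset _ _) fun c hc hc' => ?_
    split_ifs with hsc
    · by_contra h0
      refine hc' (Finset.mem_filter.2 ⟨hc, ?_, h0⟩)
      rintro rfl
      simp at hsc
    · rfl
  · rw [hsum]
    refine (Finset.sum_le_sum fun c hc => (hq c (hC c hc).1 (hC c hc).2).2.2).trans ?_
    rw [← lintegral_biUnion_finset (hdisj C) fun c _ => hA c]
    exact setLIntegral_le_lintegral _ _

end Sample

/-! ### The bound `barDist` ≤ d_μ -/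

section Stability

variable {K : Type u} [Field K] {P : Type} [LinearOrder P] [MeasurableSpace P] {μ : Measure P}

lemma Zigzag.IsMeasurable.aemeasurable_pointCost {M N : P ⥤ ModuleCat.{u} K} {γ : Zigzag M N}
    (h : γ.IsMeasurable μ) : AEMeasurable γ.pointCost μ := by
  induction γ with
  | nil => exact aemeasurable_const
  | fwd f γ ih => exact (h.1.add h.2.1).add (ih h.2.2)
  | bwd f γ ih => exact (h.1.add h.2.1).add (ih h.2.2)

lemma Zigzag.IsMeasurable.lintegral_pointCost {M N : P ⥤ ModuleCat.{u} K} {γ : Zigzag M N}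
    (h : γ.IsMeasurable μ) : ∫⁻ p, γ.pointCost p ∂μ = γ.cost μ := by
  induction γ with
  | nil => simp [pointCost, cost]
  | fwd f γ ih =>
    simp only [pointCost, cost]
    rw [lintegral_add_left' (f := fun p => kerDim f p + cokerDim f p) (h.1.add h.2.1),
      lintegral_add_left' h.1, ih h.2.2]
  | bwd f γ ih =>
    simp only [pointCost, cost]
    rw [lintegral_add_left' (f := fun p => kerDim f p + cokerDim f p) (h.1.add h.2.1),
      lintegral_add_left' h.1, ih h.2.2]

variable {ι : Type v} {κ : Type w}

/-- Sampling reduces the finite sums to a finite chain, where the zigzag is a flow between the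
traces of the bars and yields a matching. -/
lemma barDist_le_cost (hm : ∀ s : Set P, s.OrdConnected → MeasurableSet s)
    (I : ι → PInterval P) (J : κ → PInterval P) (hI : ∀ a, μ (I a).1 < ∞)
    (hJ : ∀ b, μ (J b).1 < ∞) (S : Finset ι) (U : Finset κ)
    (γ : Zigzag (listSum (S.toList.map fun a => intervalModule K (I a)))
      (listSum (U.toList.map fun b => intervalModule K (J b)))) (hγ : γ.IsMeasurable μ) :
    barDist μ I J ≤ γ.cost μ + ∑' a : {a // a ∉ S}, μ (I a).1 + ∑' b : {b // b ∉ U}, μ (J b).1 := by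
  classical
  rcases isEmpty_or_nonempty P with hP | hP
  · refine (iInf_le _ ⊥).trans ?_
    have : ∀ s : Set P, μ s = 0 := fun s => by rw [Set.eq_empty_of_isEmpty s, measure_empty]
    simp [matchCost, this]
  by_cases hcost : γ.cost μ = ∞
  · simp [hcost]
  -- These are all the sets whose measures occur as matching costs within `S` and `U`; sampling must
  -- preserve them exactly.
  let T : Finset (Set P) := (S.image fun a => (I a).1) ∪ (U.image fun b => (J b).1) ∪
    (S ×ˢ U).image fun c => symmDiff (I c.1).1 (J c.2).1
  have hIm : ∀ a, MeasurableSet (I a).1 := fun a => hm _ (I a).2.2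
  have hJm : ∀ b, MeasurableSet (J b).1 := fun b => hm _ (J b).2.2
  have hTmem : ∀ s ∈ T, MeasurableSet s ∧ μ s < ∞ := by
    intro s hs
    simp only [T, Finset.mem_union, Finset.mem_image] at hs
    rcases hs with (⟨a, _, rfl⟩ | ⟨b, _, rfl⟩) | ⟨c, _, rfl⟩
    · exact ⟨hIm a, hI a⟩
    · exact ⟨hJm b, hJ b⟩
    · refine ⟨(hIm _).symmDiff (hJm _), ?_⟩
      refine (measure_mono (symmDiff_le_sup (a := (I c.1).1) (b := (J c.2).1))).trans_lt ?_
      exact (measure_union_le _ _).trans_lt (ENNReal.add_lt_top.2 ⟨hI _, hJ _⟩)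
  obtain ⟨n, p, w, hp, hfin, hsamp, hle⟩ := exists_sample (μ := μ) T (fun s hs => (hTmem s hs).1)
    (fun s hs => (hTmem s hs).2) γ.pointCost hγ.aemeasurable_pointCost
    (by rw [hγ.lintegral_pointCost]; exact lt_top_iff_ne_top.2 hcost)
  rw [hγ.lintegral_pointCost] at hle
  have hflow := γ.isFlow hp n w (fun i _ => finiteDimensional_listSum _ _ fun M hM => by
    obtain ⟨a, _, rfl⟩ := List.mem_map.1 hM
    infer_instance) hfin
  refine (matchDist_le_of_isFlow (o := ∅) (wDist_self w) (wDist_triangle w) S U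
    (fun a => trace p n (I a)) (fun b => trace p n (J b)) _ _ _ ?_ ?_ ?_
    (hflow.of_eq (fun φ hφ => ?_) hle))
  · intro a ha b hb
    rw [wDist_trace, hsamp]
    exact Finset.mem_union_right _ (Finset.mem_image.2 ⟨(a, b), Finset.mk_mem_product ha hb, rfl⟩)
  · intro a ha
    rw [sum_trace, hsamp]
    exact Finset.mem_union_left _ (Finset.mem_union_left _ (Finset.mem_image_of_mem _ ha))
  · intro b hb
    rw [wDist_comm, sum_trace, hsamp]
    exact Finset.mem_union_left _ (Finset.mem_union_right _ (Finset.mem_image_of_mem _ hb))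
  · rw [rankSum_listSum_intervalModule hp n I _ φ hφ, rankSum_listSum_intervalModule hp n J _ φ hφ]
    rw [Finset.sum_map_toList, Finset.sum_map_toList]

/-- Truncation to finite sets of bars costs the distance to the truncation and the tail of the bar
lengths on each side; all four errors tend to zero. -/
lemma barDist_le_zigzagDist [Countable ι] [Countable κ]
    (hm : ∀ s : Set P, s.OrdConnected → MeasurableSet s)
    {I : ι → PInterval P} {J : κ → PInterval P} {M N : P ⥤ ModuleCat.{u} K}
    (D : DirectSumData (fun a => intervalModule K (I a)) M)
    (E : DirectSumData (fun b => intervalModule K (J b)) N)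
    (hM : HasFiniteTotalPersistence μ M) (hN : HasFiniteTotalPersistence μ N) :
    barDist μ I J ≤ zigzagDist μ M N := by
  have hIm := fun a => (measurable_dimVec_intervalModule (K := K) hm (I a)).aemeasurable (μ := μ)
  have hJm := fun b => (measurable_dimVec_intervalModule (K := K) hm (J b)).aemeasurable (μ := μ)
  have hI := D.tsum_lintegral_dimVec hIm
  have hJ := E.tsum_lintegral_dimVec hJm
  simp only [lintegral_dimVec_intervalModule hm] at hI hJ
  have hI' : ∑' a, μ (I a).1 ≠ ∞ := by rw [hI]; exact hM.2.ne
  have hJ' : ∑' b, μ (J b).1 ≠ ∞ := by rw [hJ]; exact hN.2.ne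
  have key : ∀ (S : Finset ι) (U : Finset κ), barDist μ I J ≤
      ((zigzagDist μ M (listSum (S.toList.map fun a => intervalModule K (I a))) +
        ∑' a : {a // a ∉ S}, μ (I a).1) + zigzagDist μ M N) +
      (zigzagDist μ N (listSum (U.toList.map fun b => intervalModule K (J b))) +
        ∑' b : {b // b ∉ U}, μ (J b).1) := by
    intro S U
    have h1 : barDist μ I J ≤ zigzagDist μ
        (listSum (S.toList.map fun a => intervalModule K (I a)))
        (listSum (U.toList.map fun b => intervalModule K (J b))) +
          ∑' a : {a // a ∉ S}, μ (I a).1 + ∑' b : {b // b ∉ U}, μ (J b).1 := by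
      unfold zigzagDist
      simp only [ENNReal.iInf_add]
      exact le_iInf₂ fun γ hγ => barDist_le_cost hm I J
        (fun a => lt_top_iff_ne_top.2 (ENNReal.ne_top_of_tsum_ne_top hI' a))
        (fun b => lt_top_iff_ne_top.2 (ENNReal.ne_top_of_tsum_ne_top hJ' b)) S U γ hγ
    refine h1.trans ?_
    have h2 := (zigzagDist_triangle (μ := μ)
        (listSum (S.toList.map fun a => intervalModule K (I a))) M
        (listSum (U.toList.map fun b => intervalModule K (J b)))).trans
      (add_le_add (zigzagDist_comm _ _).le (zigzagDist_triangle _ N _))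
    refine (add_le_add (add_le_add h2 le_rfl) le_rfl).trans (le_of_eq ?_)
    ring
  have t1 := (D.zigzagDist_listSum_tendsto hIm hM).add
    (ENNReal.tendsto_tsum_compl_atTop_zero hI')
  have t2 := (E.zigzagDist_listSum_tendsto hJm hN).add
    (ENNReal.tendsto_tsum_compl_atTop_zero hJ')
  rw [add_zero] at t1 t2
  have h3 : ∀ U : Finset κ, barDist μ I J ≤ zigzagDist μ M N +
      (zigzagDist μ N (listSum (U.toList.map fun b => intervalModule K (J b))) +
        ∑' b : {b // b ∉ U}, μ (J b).1) := fun U => by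
    have := ge_of_tendsto' ((t1.add_const (zigzagDist μ M N)).add_const _) fun S => key S U
    rwa [zero_add] at this
  have := ge_of_tendsto' (t2.const_add (zigzagDist μ M N)) h3
  rwa [add_zero] at this

theorem wasserstein₁_eq_zigzagDist_and_zigzagDist_eq_barDist [Countable ι] [Countable κ]
    (hm : ∀ s : Set P, s.OrdConnected → MeasurableSet s)
    {I : ι → PInterval P} {J : κ → PInterval P} {M N : P ⥤ ModuleCat.{u} K}
    (D : DirectSumData (fun a => intervalModule K (I a)) M)
    (E : DirectSumData (fun b => intervalModule K (J b)) N)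
    (hM : HasFiniteTotalPersistence μ M) (hN : HasFiniteTotalPersistence μ N) :
    wasserstein₁ (zigzagDist μ) M N = zigzagDist μ M N ∧ zigzagDist μ M N = barDist μ I J := by
  have h1 := barDist_le_zigzagDist hm D E hM hN
  have h2 := zigzagDist_le_wasserstein₁ hm D E hM hN
  have h3 := wasserstein₁_le_barDist (μ := μ) hm D E
  exact ⟨le_antisymm (h3.trans h1) h2, le_antisymm (h2.trans h3) h1⟩

end Stability

end PersMod

end
noncomputable section

namespace PersMod

/-! ### Comparison with the Wasserstein distance of persistence diagrams -/

section Matching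

variable {ι : Type v} {κ : Type w}

lemma matchCost_eq_of_subset (c : ι → κ → ℝ≥0∞) (u : ι → ℝ≥0∞) (v : κ → ℝ≥0∞) (f : ι ≃. κ)
    (S : Set ι) (φ : S → κ) (h1 : ∀ a : S, f a = some (φ a)) (h2 : ∀ a ∉ S, f a = none) :
    matchCost c u v f = (∑' a : S, c a (φ a)) + (∑' a : ↥Sᶜ, u a) +
      ∑' b : ↥(Set.range φ)ᶜ, v b := by
  have e1 : ∑' a, (f a).elim (u a) (c a) = (∑' a : S, c a (φ a)) + ∑' a : ↥Sᶜ, u a := by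
    rw [← Summable.tsum_add_tsum_compl (f := fun a => (f a).elim (u a) (c a)) (s := S)
      ENNReal.summable ENNReal.summable]
    congr 1
    · exact tsum_congr fun a => by simp [h1 a]
    · exact tsum_congr fun a => by simp [h2 a a.2]
  have e2 : ∑' b, (f.symm b).elim (v b) (fun _ => 0) = ∑' b : ↥(Set.range φ)ᶜ, v b := by
    rw [← Summable.tsum_add_tsum_compl (f := fun b => (f.symm b).elim (v b) fun _ => 0)
      (s := Set.range φ) ENNReal.summable ENNReal.summable]
    have h0 : ∀ b : Set.range φ, (f.symm b).elim (v b) (fun _ => 0) = 0 := by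
      rintro ⟨_, a, rfl⟩
      have : f.symm (φ a) = some a.1 := f.eq_some_iff.2 (h1 a)
      simp [this]
    rw [tsum_congr h0, tsum_zero, zero_add]
    refine tsum_congr fun b => ?_
    rcases hb : f.symm b with _ | a
    · rfl
    · exfalso
      have ha := f.eq_some_iff.1 hb
      by_cases haS : a ∈ S
      · have := h1 ⟨a, haS⟩
        rw [ha] at this
        exact b.2 ⟨_, (Option.some.inj this).symm⟩
      · rw [h2 a haS] at ha
        cases ha
  rw [matchCost, e1, e2]

lemma dgmWasserstein₁_eq_matchDist (x : ι → EReal × EReal) (y : κ → EReal × EReal) :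
    dgmWasserstein₁ x y = matchDist (fun a b => planeDist (x a) (y b)) (fun a => diagDist (x a))
      fun b => diagDist (y b) := by
  classical
  apply le_antisymm
  · refine le_iInf fun f => ?_
    let S : Set ι := {a | (f a).isSome}
    let φ : S → κ := fun a => (f a.1).get a.2
    have hφ : ∀ a : S, f a = some (φ a) := fun a => (Option.some_get a.2).symm
    have hinj : Function.Injective φ := fun a b hab => by
      refine Subtype.ext (f.inj (hφ a) ?_)
      rw [hab]
      exact hφ b
    rw [matchCost_eq_of_subset _ _ _ f S φ hφ fun a ha => by simpa [S] using ha]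
    exact iInf_le_of_le S (iInf₂_le_of_le φ hinj le_rfl)
  · refine le_iInf fun S => le_iInf₂ fun φ hφ => ?_
    let f : ι ≃. κ :=
      { toFun := fun a => if h : a ∈ S then some (φ ⟨a, h⟩) else none
        invFun := fun b => if h : ∃ a, φ a = b then some h.choose.1 else none
        inv := fun a b => by
          constructor
          · intro h
            split_ifs at h with hb
            obtain rfl : hb.choose.1 = a := Option.some.inj h
            rw [dif_pos hb.choose.2]
            exact congrArg some hb.choose_spec
          · intro h
            split_ifs at h with ha
            obtain rfl : φ ⟨a, ha⟩ = b := Option.some.inj h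
            have hex : ∃ a', φ a' = φ ⟨a, ha⟩ := ⟨_, rfl⟩
            rw [dif_pos hex]
            exact congrArg some (congrArg Subtype.val (hφ hex.choose_spec)) }
    refine (iInf_le _ f).trans (le_of_eq ?_)
    exact matchCost_eq_of_subset _ _ _ f S φ (fun a => dif_pos a.2) fun a ha => dif_neg ha

/-- Both sums run over the matched pairs. -/
lemma tsum_symm_elim (f : ι ≃. κ) (F : ι → κ → ℝ≥0∞) :
    ∑' b, (f.symm b).elim 0 (fun a => F a b) = ∑' a, (f a).elim 0 (F a) := by
  classical
  have h1 : ∀ a, (f a).elim 0 (F a) = ∑' b, if f a = some b then F a b else 0 := by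
    intro a
    rcases f a with _ | b
    · simp
    · rw [tsum_eq_single b]
      · simp
      · intro b' hb'
        simp [Ne.symm hb']
  have h2 : ∀ b, (f.symm b).elim 0 (fun a => F a b) =
      ∑' a, if f.symm b = some a then F a b else 0 := by
    intro b
    rcases f.symm b with _ | a
    · simp
    · rw [tsum_eq_single a]
      · simp
      · intro a' ha'
        simp [Ne.symm ha']
  rw [tsum_congr h1, tsum_congr h2, ENNReal.tsum_comm]
  refine tsum_congr fun a => tsum_congr fun b => ?_
  simp only [f.eq_some_iff]

/-- A pair that costs more than leaving both its members unmatched can be split, so only `min (c a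
b) (u a + v b)` matters. -/
lemma matchDist_mono (c c' : ι → κ → ℝ≥0∞) (u : ι → ℝ≥0∞) (v : κ → ℝ≥0∞)
    (h : ∀ a b, min (c a b) (u a + v b) ≤ c' a b) : matchDist c u v ≤ matchDist c' u v := by
  classical
  refine le_iInf fun f => ?_
  let f' : ι ≃. κ :=
    { toFun := fun a => (f a).bind fun b => if c a b ≤ u a + v b then some b else none
      invFun := fun b => (f.symm b).bind fun a => if c a b ≤ u a + v b then some a else none
      inv := fun a b => by
        simp only [Option.bind_eq_some_iff, Option.ite_none_right_eq_some,
          Option.some.injEq]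
        constructor
        · rintro ⟨a', h1, h2, rfl⟩
          exact ⟨b, f.eq_some_iff.1 h1, h2, rfl⟩
        · rintro ⟨b', h1, h2, rfl⟩
          exact ⟨a, f.eq_some_iff.2 h1, h2, rfl⟩ }
  refine (iInf_le _ f').trans ?_
  -- `F a b` is the additional cost on the side of `κ` when the pair is split; `tsum_symm_elim`
  -- charges it to `a`.
  let F : ι → κ → ℝ≥0∞ := fun a b => if c a b ≤ u a + v b then 0 else v b
  have e1 : ∀ b, (f'.symm b).elim (v b) (fun _ => 0) =
      (f.symm b).elim (v b) (fun _ => 0) + (f.symm b).elim 0 (fun a => F a b) := by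
    intro b
    have hf : f'.symm b = (f.symm b).bind fun a => if c a b ≤ u a + v b then some a else none := rfl
    rw [hf]
    rcases f.symm b with _ | a
    · simp
    · by_cases hc : c a b ≤ u a + v b <;> simp [F, hc]
  have e2 : ∀ a, (f' a).elim (u a) (c a) + (f a).elim 0 (F a) ≤ (f a).elim (u a) (c' a) := by
    intro a
    have hf : f' a = (f a).bind fun b => if c a b ≤ u a + v b then some b else none := rfl
    rw [hf]
    rcases f a with _ | b
    · simp
    · have := h a b
      by_cases hc : c a b ≤ u a + v b
      · rw [min_eq_left hc] at this
        simpa [F, hc] using this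
      · rw [min_eq_right (le_of_not_ge hc)] at this
        simpa [F, hc] using this
  have e3 : matchCost c u v f' = (∑' a, ((f' a).elim (u a) (c a) + (f a).elim 0 (F a))) +
      ∑' b, (f.symm b).elim (v b) fun _ => 0 := by
    rw [matchCost, tsum_congr e1, ENNReal.tsum_add, tsum_symm_elim, ENNReal.tsum_add]
    ring
  rw [e3, matchCost]
  exact add_le_add (ENNReal.tsum_le_tsum e2) le_rfl

end Matching

/-! ### End points and measures of intervals -/

section Points

lemma erealDist_coe (a b : ℝ) : erealDist a b = ENNReal.ofReal |a - b| := by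
  unfold erealDist
  split_ifs with h
  · rw [EReal.coe_eq_coe_iff] at h
    simp [h]
  · rw [← EReal.coe_sub, EReal.abs_def]

lemma diagDist_coe {a b : ℝ} (h : a ≤ b) :
    diagDist ((a : EReal), (b : EReal)) = ENNReal.ofReal (b - a) := by
  apply le_antisymm
  · refine (iInf_le _ (a : EReal)).trans (le_of_eq ?_)
    change erealDist a a + erealDist b a = _
    rw [erealDist_coe, erealDist_coe, sub_self, abs_zero, ENNReal.ofReal_zero, zero_add,
      abs_of_nonneg (sub_nonneg.2 h)]
  · refine le_iInf fun c => ?_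
    change _ ≤ erealDist a c + erealDist b c
    induction c with
    | bot => simp [erealDist]
    | top => simp [erealDist]
    | coe c =>
      rw [erealDist_coe, erealDist_coe, ← ENNReal.ofReal_add (abs_nonneg _) (abs_nonneg _)]
      refine ENNReal.ofReal_le_ofReal ?_
      linarith [neg_abs_le (a - c), le_abs_self (b - c)]

variable {P : Type} [LinearOrder P]

/-- Disjoint intervals are comparable. -/
lemma PInterval.lt_or_lt_of_disjoint {I J : PInterval P} (h : ¬ (I.1 ∩ J.1).Nonempty) :
    (∀ x ∈ I.1, ∀ y ∈ J.1, x < y) ∨ ∀ y ∈ J.1, ∀ x ∈ I.1, y < x := by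
  by_contra! hc
  obtain ⟨⟨x, hx, y, hy, hyx⟩, y', hy', x', hx', hxy⟩ := hc
  rcases le_total y x' with h1 | h1
  · exact h ⟨x', hx', J.2.2.out hy hy' ⟨h1, hxy⟩⟩
  · exact h ⟨y, I.2.2.out hx' hx ⟨h1, hyx⟩, hy⟩

/-- The intersection of two intervals that meet. -/
def PInterval.inter (I J : PInterval P) (h : (I.1 ∩ J.1).Nonempty) : PInterval P :=
  ⟨I.1 ∩ J.1, h, I.2.2.inter J.2.2⟩

/-- If both infima were smaller than that of the intersection, points of `I` and `J` witnessing this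
would lie below a common point `p`; by convexity the larger of them would lie in both intervals. -/
lemma iInf_inter_eq_max {g : P → EReal} (hg : Monotone g) (I J : PInterval P)
    (h : (I.1 ∩ J.1).Nonempty) :
    ⨅ a : (I.inter J h).1, g a = max (⨅ a : I.1, g a) (⨅ a : J.1, g a) := by
  apply le_antisymm
  · by_contra hlt
    rw [not_le, max_lt_iff, iInf_lt_iff, iInf_lt_iff] at hlt
    obtain ⟨⟨⟨i, hi⟩, hi'⟩, ⟨j, hj⟩, hj'⟩ := hlt
    obtain ⟨p, hp⟩ := h
    have hle : ∀ q ∈ I.1 ∩ J.1, ⨅ a : (I.inter J ⟨p, hp⟩).1, g a ≤ g q := fun q hq =>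
      iInf_le (fun a : (I.inter J ⟨p, hp⟩).1 => g a) ⟨q, hq⟩
    have hpi : i < p := by
      by_contra hip
      exact absurd ((hle p hp).trans (hg (not_lt.1 hip))) (not_le.2 hi')
    have hpj : j < p := by
      by_contra hjp
      exact absurd ((hle p hp).trans (hg (not_lt.1 hjp))) (not_le.2 hj')
    rcases le_total i j with hij | hij
    · exact absurd (hle j ⟨I.2.2.out hi hp.1 ⟨hij, hpj.le⟩, hj⟩) (not_le.2 hj')
    · exact absurd (hle i ⟨hi, J.2.2.out hj hp.2 ⟨hij, hpi.le⟩⟩) (not_le.2 hi')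
  · exact le_iInf fun a => max_le (iInf_le (fun a : I.1 => g a) ⟨a.1, a.2.1⟩)
      (iInf_le (fun a : J.1 => g a) ⟨a.1, a.2.2⟩)

lemma iSup_inter_eq_min {g : P → EReal} (hg : Monotone g) (I J : PInterval P)
    (h : (I.1 ∩ J.1).Nonempty) :
    ⨆ a : (I.inter J h).1, g a = min (⨆ a : I.1, g a) (⨆ a : J.1, g a) := by
  apply le_antisymm
  · exact iSup_le fun a => le_min (le_iSup (fun a : I.1 => g a) ⟨a.1, a.2.1⟩)
      (le_iSup (fun a : J.1 => g a) ⟨a.1, a.2.2⟩)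
  · by_contra hlt
    rw [not_le, lt_min_iff, lt_iSup_iff, lt_iSup_iff] at hlt
    obtain ⟨⟨⟨i, hi⟩, hi'⟩, ⟨j, hj⟩, hj'⟩ := hlt
    obtain ⟨p, hp⟩ := h
    have hle : ∀ q ∈ I.1 ∩ J.1, g q ≤ ⨆ a : (I.inter J ⟨p, hp⟩).1, g a := fun q hq =>
      le_iSup (fun a : (I.inter J ⟨p, hp⟩).1 => g a) ⟨q, hq⟩
    have hpi : p < i := by
      by_contra hip
      exact absurd ((hg (not_lt.1 hip)).trans (hle p hp)) (not_le.2 hi')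
    have hpj : p < j := by
      by_contra hjp
      exact absurd ((hg (not_lt.1 hjp)).trans (hle p hp)) (not_le.2 hj')
    rcases le_total i j with hij | hij
    · exact absurd (hle i ⟨hi, J.2.2.out hp.2 hj ⟨hpi.le, hij⟩⟩) (not_le.2 hi')
    · exact absurd (hle j ⟨I.2.2.out hp.1 hi ⟨hpj.le, hij⟩, hj⟩) (not_le.2 hj')

variable [MeasurableSpace P] {μ : Measure P} {ι : Type v} {κ : Type w}

/-- The two costs agree on bars that meet. On disjoint bars each is at least the cost of leaving
both unmatched, so `matchDist_mono` applies in both directions. -/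
lemma barDist_eq_dgmWasserstein₁ (hm : ∀ s : Set P, s.OrdConnected → MeasurableSet s)
    (pt : PInterval P → EReal × EReal)
    (hpt : ∀ I : PInterval P, μ I.1 < ∞ → ∃ a b : ℝ, a ≤ b ∧ pt I = (↑a, ↑b) ∧
      μ I.1 = ENNReal.ofReal (b - a))
    (hinter : ∀ (I J : PInterval P) (h : (I.1 ∩ J.1).Nonempty),
      pt (I.inter J h) = (max (pt I).1 (pt J).1, min (pt I).2 (pt J).2))
    (hlt : ∀ I J : PInterval P, (∀ x ∈ I.1, ∀ y ∈ J.1, x < y) → (pt I).2 ≤ (pt J).1)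
    (I : ι → PInterval P) (J : κ → PInterval P) (hI : ∀ a, μ (I a).1 < ∞)
    (hJ : ∀ b, μ (J b).1 < ∞) :
    barDist μ I J = dgmWasserstein₁ (fun a => pt (I a)) fun b => pt (J b) := by
  have hdiag : ∀ L : PInterval P, μ L.1 < ∞ → diagDist (pt L) = μ L.1 := by
    intro L hL
    obtain ⟨a, b, hab, h1, h2⟩ := hpt L hL
    rw [h1, h2, diagDist_coe hab]
  have hplane : ∀ a b c d : ℝ, planeDist ((a : EReal), (b : EReal)) (↑c, ↑d) =
      ENNReal.ofReal (|a - c| + |b - d|) := by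
    intro a b c d
    rw [ENNReal.ofReal_add (abs_nonneg _) (abs_nonneg _), ← erealDist_coe, ← erealDist_coe]
    rfl
  have hsymm : ∀ I J : PInterval P,
      μ (symmDiff I.1 J.1) + 2 * μ (I.1 ∩ J.1) = μ I.1 + μ J.1 := by
    intro I J
    rw [measure_symmDiff_eq (hm _ I.2.2).nullMeasurableSet (hm _ J.2.2).nullMeasurableSet,
      ← measure_inter_add_sdiff I.1 (hm _ J.2.2), ← measure_inter_add_sdiff J.1 (hm _ I.2.2),
      Set.inter_comm J.1 I.1]
    ring
  have hmeet : ∀ I J : PInterval P, μ I.1 < ∞ → μ J.1 < ∞ → (I.1 ∩ J.1).Nonempty →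
      planeDist (pt I) (pt J) = μ (symmDiff I.1 J.1) := by
    intro I J hI hJ h
    obtain ⟨a, b, hab, h1, h2⟩ := hpt I hI
    obtain ⟨c, d, hcd, h3, h4⟩ := hpt J hJ
    have hfin : μ (I.1 ∩ J.1) < ∞ := (measure_mono Set.inter_subset_left).trans_lt hI
    obtain ⟨s, t, hst, h5, h6⟩ := hpt (I.inter J h) hfin
    replace h6 : μ (I.1 ∩ J.1) = ENNReal.ofReal (t - s) := h6
    rw [hinter, h1, h3] at h5
    obtain rfl : max a c = s := by
      have : max (a : EReal) c = s := congrArg Prod.fst h5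
      exact EReal.coe_injective ((EReal.coe_strictMono.monotone.map_max).trans this)
    obtain rfl : min b d = t := by
      have : min (b : EReal) d = t := congrArg Prod.snd h5
      exact EReal.coe_injective ((EReal.coe_strictMono.monotone.map_min).trans this)
    have hs := hsymm I J
    rw [h2, h4, h6] at hs
    -- After adding `2 * μ (I ∩ J)` the claim is `|a - c| + |b - d| + 2 (min b d - max a c) = (b -
    -- a) + (d - c)`; here `max a c ≤ min b d` because the intersection is itself a bar.
    refine (ENNReal.add_left_inj (ENNReal.mul_ne_top ENNReal.ofNat_ne_top
      ENNReal.ofReal_ne_top)).1 (Eq.trans ?_ hs.symm)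
    rw [h1, h3, hplane, two_mul, ← ENNReal.ofReal_add (by linarith) (by linarith),
      ← ENNReal.ofReal_add (by positivity) (by linarith),
      ← ENNReal.ofReal_add (by linarith) (by linarith)]
    congr 1
    rcases le_total a c with hac | hac <;> rcases le_total b d with hbd | hbd
    · rw [max_eq_right hac, min_eq_left hbd, abs_of_nonpos (by linarith),
        abs_of_nonpos (by linarith)]
      ring
    · rw [max_eq_right hac, min_eq_right hbd, abs_of_nonpos (by linarith),
        abs_of_nonneg (by linarith)]
      ring
    · rw [max_eq_left hac, min_eq_left hbd, abs_of_nonneg (by linarith),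
        abs_of_nonpos (by linarith)]
      ring
    · rw [max_eq_left hac, min_eq_right hbd, abs_of_nonneg (by linarith),
        abs_of_nonneg (by linarith)]
      ring
  have hdis : ∀ I J : PInterval P, ¬ (I.1 ∩ J.1).Nonempty →
      μ (symmDiff I.1 J.1) = μ I.1 + μ J.1 := by
    intro I J h
    rw [← hsymm, Set.not_nonempty_iff_eq_empty.1 h, measure_empty, mul_zero, add_zero]
  have hdis' : ∀ I J : PInterval P, μ I.1 < ∞ → μ J.1 < ∞ → ¬ (I.1 ∩ J.1).Nonempty →
      μ I.1 + μ J.1 ≤ planeDist (pt I) (pt J) := by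
    intro I J hI hJ h
    have h' := PInterval.lt_or_lt_of_disjoint h
    obtain ⟨a, b, hab, h1, h2⟩ := hpt I hI
    obtain ⟨c, d, hcd, h3, h4⟩ := hpt J hJ
    rw [h1, h3, h2, h4, hplane, ← ENNReal.ofReal_add (by linarith) (by linarith)]
    refine ENNReal.ofReal_le_ofReal ?_
    rcases h' with h' | h'
    · have hbc := hlt I J h'
      rw [h1, h3] at hbc
      have hbc' : b ≤ c := EReal.coe_le_coe_iff.1 hbc
      linarith [neg_abs_le (a - c), neg_abs_le (b - d)]
    · have hbc := hlt J I h'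
      rw [h1, h3] at hbc
      have hbc' : d ≤ a := EReal.coe_le_coe_iff.1 hbc
      linarith [le_abs_self (a - c), le_abs_self (b - d)]
  rw [dgmWasserstein₁_eq_matchDist]
  simp only [fun a => hdiag (I a) (hI a), fun b => hdiag (J b) (hJ b)]
  apply le_antisymm
  · refine matchDist_mono _ _ _ _ fun a b => ?_
    by_cases h : ((I a).1 ∩ (J b).1).Nonempty
    · rw [hmeet _ _ (hI a) (hJ b) h]
      exact min_le_left _ _
    · exact (min_le_right _ _).trans (hdis' _ _ (hI a) (hJ b) h)
  · refine matchDist_mono _ _ _ _ fun a b => ?_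
    by_cases h : ((I a).1 ∩ (J b).1).Nonempty
    · rw [hmeet _ _ (hI a) (hJ b) h]
      exact min_le_left _ _
    · rw [hdis _ _ h]
      exact min_le_right _ _

end Points

/-! ### Subsets of the real line -/

section Real

variable {P : Set ℝ}

/-- An order-convex subset of `P` is the trace on `P` of its convex hull in `ℝ`, which is Borel
whatever `P` is. -/
lemma measurableSet_of_ordConnected_real (s : Set P) (hs : s.OrdConnected) : MeasurableSet s := by
  have h : s = Subtype.val ⁻¹' {t : ℝ | ∃ x ∈ s, ∃ y ∈ s, (x : ℝ) ≤ t ∧ t ≤ y} := by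
    ext z
    constructor
    · exact fun hz => ⟨z, hz, z, hz, le_rfl, le_rfl⟩
    · rintro ⟨x, hx, y, hy, h1, h2⟩
      exact hs.out hx hy ⟨h1, h2⟩
  rw [h]
  refine measurable_subtype_coe (Set.OrdConnected.measurableSet ⟨?_⟩)
  rintro a ⟨x, hx, _, _, h1, _⟩ b ⟨_, _, y, hy, _, h2⟩ c hc
  exact ⟨x, hx, y, hy, h1.trans hc.1, hc.2.trans h2⟩

/-- As `P` is convex, the bar is a genuine real interval. Finite measure bounds its diameter, so its
end points are finite, and it lies between the open and the closed interval they span. -/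
lemma exists_realPoint_eq (hP : P.OrdConnected) (I : PInterval P)
    (hI : Measure.comap Subtype.val volume I.1 < ∞) : ∃ a b : ℝ, a ≤ b ∧
      realPoint I = (↑a, ↑b) ∧ Measure.comap Subtype.val volume I.1 = ENNReal.ofReal (b - a) := by
  rw [comap_subtype_coe_apply hP.measurableSet] at hI ⊢
  have hord : ∀ x ∈ I.1, ∀ y ∈ I.1, ∀ t : ℝ, (x : ℝ) ≤ t → t ≤ y →
      t ∈ (Subtype.val '' I.1 : Set ℝ) := fun x hx y hy t h1 h2 =>
    ⟨⟨t, hP.out x.2 y.2 ⟨h1, h2⟩⟩, I.2.2.out hx hy ⟨h1, h2⟩, rfl⟩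
  have hdiam : ∀ x ∈ I.1, ∀ y ∈ I.1, (y : ℝ) - x ≤ (volume (Subtype.val '' I.1 : Set ℝ)).toReal := by
    intro x hx y hy
    have h : Set.Icc (x : ℝ) y ⊆ Subtype.val '' I.1 := fun t ht => hord x hx y hy t ht.1 ht.2
    have h' := measure_mono (μ := volume) h
    rw [Real.volume_Icc] at h'
    exact (ENNReal.ofReal_le_iff_le_toReal hI.ne).1 h'
  obtain ⟨x₀, hx₀⟩ := I.2.1
  obtain ⟨a, ha⟩ : ∃ a : ℝ, (a : EReal) = (realPoint I).1 := by
    refine ⟨_, EReal.coe_toReal (ne_of_lt ?_) (ne_of_gt ?_)⟩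
    · exact (iInf_le (fun a : I.1 => (((a : P) : ℝ) : EReal)) ⟨x₀, hx₀⟩).trans_lt
        (EReal.coe_lt_top _)
    · refine (EReal.bot_lt_coe ((x₀ : ℝ) - (volume (Subtype.val '' I.1 : Set ℝ)).toReal)).trans_le
        (le_iInf fun a => EReal.coe_le_coe_iff.2 ?_)
      linarith [hdiam a a.2 x₀ hx₀]
  obtain ⟨b, hb⟩ : ∃ b : ℝ, (b : EReal) = (realPoint I).2 := by
    refine ⟨_, EReal.coe_toReal (ne_of_lt ?_) (ne_of_gt ?_)⟩
    · refine (iSup_le fun a => EReal.coe_le_coe_iff.2 ?_).trans_lt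
        (EReal.coe_lt_top ((x₀ : ℝ) + (volume (Subtype.val '' I.1 : Set ℝ)).toReal))
      linarith [hdiam x₀ hx₀ a a.2]
    · exact (EReal.bot_lt_coe _).trans_le
        (le_iSup (fun a : I.1 => (((a : P) : ℝ) : EReal)) ⟨x₀, hx₀⟩)
  have hax : ∀ x ∈ I.1, a ≤ x := fun x hx => by
    rw [← EReal.coe_le_coe_iff, ha]
    exact iInf_le (fun a : I.1 => (((a : P) : ℝ) : EReal)) ⟨x, hx⟩
  have hxb : ∀ x ∈ I.1, (x : ℝ) ≤ b := fun x hx => by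
    rw [← EReal.coe_le_coe_iff, hb]
    exact le_iSup (fun a : I.1 => (((a : P) : ℝ) : EReal)) ⟨x, hx⟩
  refine ⟨a, b, (hax x₀ hx₀).trans (hxb x₀ hx₀), Prod.ext ha.symm hb.symm, le_antisymm ?_ ?_⟩
  · rw [← Real.volume_Icc]
    refine measure_mono ?_
    rintro _ ⟨x, hx, rfl⟩
    exact ⟨hax x hx, hxb x hx⟩
  · rw [← Real.volume_Ioo]
    refine measure_mono fun t ht => ?_
    have h1 : (realPoint I).1 < (t : EReal) := by
      rw [← ha]; exact EReal.coe_lt_coe_iff.2 ht.1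
    have h2 : (t : EReal) < (realPoint I).2 := by
      rw [← hb]; exact EReal.coe_lt_coe_iff.2 ht.2
    obtain ⟨x, hx⟩ := iInf_lt_iff.1 h1
    obtain ⟨y, hy⟩ := lt_iSup_iff.1 h2
    exact hord x x.2 y y.2 t (EReal.coe_lt_coe_iff.1 hx).le (EReal.coe_lt_coe_iff.1 hy).le

lemma realPoint_inter (I J : PInterval P) (h : (I.1 ∩ J.1).Nonempty) :
    realPoint (I.inter J h) =
      (max (realPoint I).1 (realPoint J).1, min (realPoint I).2 (realPoint J).2) := by
  have hg : Monotone fun a : P => ((a : ℝ) : EReal) := fun a b hab => EReal.coe_le_coe_iff.2 hab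
  exact Prod.ext (iInf_inter_eq_max hg I J h) (iSup_inter_eq_min hg I J h)

lemma realPoint_snd_le_fst (I J : PInterval P) (h : ∀ x ∈ I.1, ∀ y ∈ J.1, x < y) :
    (realPoint I).2 ≤ (realPoint J).1 :=
  iSup_le fun a => le_iInf fun b => EReal.coe_le_coe_iff.2 (h a a.2 b b.2).le

end Real

/-! ### Subsets of the integers -/

section Int

variable {P : Set ℤ}

lemma exists_intPoint_eq (hP : P.OrdConnected) (I : PInterval P)
    (hI : Measure.count I.1 < ∞) : ∃ a b : ℝ, a ≤ b ∧
      intPoint I = (↑a, ↑b) ∧ Measure.count I.1 = ENNReal.ofReal (b - a) := by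
  have hfin : I.1.Finite := Measure.count_apply_lt_top.1 hI
  obtain ⟨m, hm, hm'⟩ := Set.exists_min_image I.1 id hfin I.2.1
  obtain ⟨n, hn, hn'⟩ := Set.exists_max_image I.1 id hfin I.2.1
  have hmn : (m : ℤ) ≤ n := hm' n hn
  have himg : Subtype.val '' I.1 = Set.Icc (m : ℤ) n := by
    ext t
    constructor
    · rintro ⟨x, hx, rfl⟩
      exact ⟨hm' x hx, hn' x hx⟩
    · rintro ⟨h1, h2⟩
      exact ⟨⟨t, hP.out m.2 n.2 ⟨h1, h2⟩⟩, I.2.2.out hm hn ⟨h1, h2⟩, rfl⟩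
  have hmn' : ((m : ℤ) : ℝ) ≤ (n : ℤ) := by exact_mod_cast hmn
  refine ⟨((m : ℤ) : ℝ), ((n : ℤ) : ℝ) + 1, by linarith, Prod.ext ?_ ?_, ?_⟩
  · refine le_antisymm (iInf_le (fun a : I.1 => ((((a : P) : ℤ) : ℝ) : EReal)) ⟨m, hm⟩)
      (le_iInf fun a => EReal.coe_le_coe_iff.2 (Int.cast_le.2 (hm' a a.2)))
  · refine le_antisymm (iSup_le fun a => EReal.coe_le_coe_iff.2 ?_)
      (le_iSup (fun a : I.1 => (((((a : P) : ℤ) : ℝ) + 1 : ℝ) : EReal)) ⟨n, hn⟩)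
    have : (((a : P) : ℤ) : ℝ) ≤ (n : ℤ) := Int.cast_le.2 (hn' a a.2)
    linarith
  · rw [Measure.count_apply MeasurableSet.of_discrete, ← Subtype.val_injective.encard_image, himg,
      ← Finset.coe_Icc, Set.encard_coe_eq_coe_finsetCard, Int.card_Icc]
    have h1 : ((n : ℤ) : ℝ) + 1 - (m : ℤ) = ((((n : ℤ) + 1 - m).toNat : ℕ) : ℝ) := by
      have : ((((n : ℤ) + 1 - m).toNat : ℕ) : ℤ) = (n : ℤ) + 1 - m := Int.toNat_of_nonneg (by omega)
      rw [← Int.cast_natCast, this]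
      push_cast
      ring
    rw [h1, ENNReal.ofReal_natCast]
    rfl

lemma intPoint_inter (I J : PInterval P) (h : (I.1 ∩ J.1).Nonempty) :
    intPoint (I.inter J h) =
      (max (intPoint I).1 (intPoint J).1, min (intPoint I).2 (intPoint J).2) := by
  have hg : Monotone fun a : P => (((a : ℤ) : ℝ) : EReal) := fun a b hab =>
    EReal.coe_le_coe_iff.2 (Int.cast_le.2 hab)
  have hg' : Monotone fun a : P => ((((a : ℤ) : ℝ) + 1 : ℝ) : EReal) := fun a b hab =>
    EReal.coe_le_coe_iff.2 (add_le_add (Int.cast_le.2 hab) le_rfl)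
  exact Prod.ext (iInf_inter_eq_max hg I J h) (iSup_inter_eq_min hg' I J h)

/-- The shift of the right end by one is harmless: `x < y` in `ℤ` means `x + 1 ≤ y`. -/
lemma intPoint_snd_le_fst (I J : PInterval P) (h : ∀ x ∈ I.1, ∀ y ∈ J.1, x < y) :
    (intPoint I).2 ≤ (intPoint J).1 := by
  refine iSup_le fun a => le_iInf fun b => EReal.coe_le_coe_iff.2 ?_
  have : ((a : P) : ℤ) + 1 ≤ (b : P) := h a a.2 b b.2
  exact_mod_cast this

/-- Every bar has a point and so contributes at least 1 to a finite total; hence countability need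
not be assumed over `ℤ`. -/
lemma countable_of_hasFiniteTotalPersistence {K : Type u} [Field K] {ι : Type v}
    {I : ι → PInterval P} {M : P ⥤ ModuleCat.{u} K}
    (D : DirectSumData (fun a => intervalModule K (I a)) M)
    (hM : HasFiniteTotalPersistence Measure.count M) : Countable ι := by
  have h := hM.2
  rw [lintegral_count, tsum_congr D.dimVec_eq_tsum, ENNReal.tsum_comm] at h
  have hc := Summable.countable_support_ennreal h.ne
  refine Set.countable_univ_iff.1 (Set.Countable.mono ?_ hc)
  intro a _ h0
  obtain ⟨p, hp⟩ := (I a).2.1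
  have := ENNReal.tsum_eq_zero.1 h0 p
  rw [dimVec_intervalModule, Set.indicator_of_mem hp] at this
  exact one_ne_zero this

end Int

lemma lt_top_of_hasFiniteTotalPersistence {K : Type u} [Field K] {P : Type} [LinearOrder P]
    [MeasurableSpace P] {μ : Measure P} (hm : ∀ s : Set P, s.OrdConnected → MeasurableSet s)
    {ι : Type v} {I : ι → PInterval P} {M : P ⥤ ModuleCat.{u} K}
    (D : DirectSumData (fun a => intervalModule K (I a)) M)
    (hM : HasFiniteTotalPersistence μ M) (a : ι) : μ (I a).1 < ∞ := by
  rw [← lintegral_dimVec_intervalModule (K := K) hm]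
  refine (lintegral_mono fun p => ?_).trans_lt hM.2
  rw [D.dimVec_eq_tsum]
  exact ENNReal.le_tsum a

end PersMod

end

theorem mainTheorem2 (K : Type u) [Field K] :
    -- `P ⊆ ℤ` with the counting measure
    (∀ (P : Set ℤ) (M N : ↥P ⥤ ModuleCat.{u} K) (ι : Type v) (κ : Type w)
        (I : ι → PersMod.PInterval ↥P) (J : κ → PersMod.PInterval ↥P),
        PersMod.IsCoproductOf (fun a => PersMod.intervalModule K (I a)) M →
        PersMod.IsCoproductOf (fun b => PersMod.intervalModule K (J b)) N →
        PersMod.HasFiniteTotalPersistence Measure.count M →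
        PersMod.HasFiniteTotalPersistence Measure.count N →
        PersMod.wasserstein₁ (PersMod.zigzagDist Measure.count) M N =
            PersMod.zigzagDist Measure.count M N ∧
          (P.OrdConnected →
            PersMod.zigzagDist Measure.count M N =
              PersMod.dgmWasserstein₁ (fun a => PersMod.intPoint (I a))
                (fun b => PersMod.intPoint (J b)))) ∧
    -- `P ⊆ ℝ`, Lebesgue measurable, with the Lebesgue measure
    (∀ (P : Set ℝ), NullMeasurableSet P volume →
      ∀ (M N : ↥P ⥤ ModuleCat.{u} K) (ι : Type v) (κ : Type w) [Countable ι] [Countable κ]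
        (I : ι → PersMod.PInterval ↥P) (J : κ → PersMod.PInterval ↥P),
        PersMod.IsCoproductOf (fun a => PersMod.intervalModule K (I a)) M →
        PersMod.IsCoproductOf (fun b => PersMod.intervalModule K (J b)) N →
        PersMod.HasFiniteTotalPersistence (Measure.comap Subtype.val volume) M →
        PersMod.HasFiniteTotalPersistence (Measure.comap Subtype.val volume) N →
        PersMod.wasserstein₁ (PersMod.zigzagDist (Measure.comap Subtype.val volume)) M N =
            PersMod.zigzagDist (Measure.comap Subtype.val volume) M N ∧
          (P.OrdConnected →
            PersMod.zigzagDist (Measure.comap Subtype.val volume) M N =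
              PersMod.dgmWasserstein₁ (fun a => PersMod.realPoint (I a))
                (fun b => PersMod.realPoint (J b)))) := by
  constructor
  · intro P M N ι κ I J cM cN hM hN
    obtain ⟨D⟩ := cM.directSumData
    obtain ⟨E⟩ := cN.directSumData
    have hm : ∀ s : Set P, s.OrdConnected → MeasurableSet s := fun s _ => MeasurableSet.of_discrete
    have := PersMod.countable_of_hasFiniteTotalPersistence D hM
    have := PersMod.countable_of_hasFiniteTotalPersistence E hN
    obtain ⟨h1, h2⟩ :=
      PersMod.wasserstein₁_eq_zigzagDist_and_zigzagDist_eq_barDist hm D E hM hN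
    refine ⟨h1, fun hP => h2.trans ?_⟩
    exact PersMod.barDist_eq_dgmWasserstein₁ hm PersMod.intPoint (PersMod.exists_intPoint_eq hP)
      PersMod.intPoint_inter PersMod.intPoint_snd_le_fst I J
      (PersMod.lt_top_of_hasFiniteTotalPersistence hm D hM)
      (PersMod.lt_top_of_hasFiniteTotalPersistence hm E hN)
  · intro P _ M N ι κ _ _ I J cM cN hM hN
    obtain ⟨D⟩ := cM.directSumData
    obtain ⟨E⟩ := cN.directSumData
    have hm := PersMod.measurableSet_of_ordConnected_real (P := P)
    obtain ⟨h1, h2⟩ :=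
      PersMod.wasserstein₁_eq_zigzagDist_and_zigzagDist_eq_barDist hm D E hM hN
    refine ⟨h1, fun hP => h2.trans ?_⟩
    exact PersMod.barDist_eq_dgmWasserstein₁ hm PersMod.realPoint (PersMod.exists_realPoint_eq hP)
      PersMod.realPoint_inter PersMod.realPoint_snd_le_fst I J
      (PersMod.lt_top_of_hasFiniteTotalPersistence hm D hM)
      (PersMod.lt_top_of_hasFiniteTotalPersistence hm E hN)
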